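/- Let $\bar e_1,\dots,\bar e_8$ be the standard orthonormal basis of $\mathbb R^8$, and let $C\ell_8$ be the Clifford algebra with $\bar e_B\bar e_C+\bar e_C\bar e_B=-2\delta_{BC}$. Put $$A_8=\mathrm{Re}\big[(\bar e_1+\sqrt{-1}\,\bar e_2)(\bar e_3+\sqrt{-1}\,\bar e_4)(\bar e_5+\sqrt{-1}\,\bar e_6)(\bar e_7+\sqrt{-1}\,\bar e_8)\big],\quad \beta_8=\bar e_1\bar e_3\bar e_5\bar e_7,\quad A=A_8(1+\beta_8),$$ $$V^+=C\ell_8^{even}A,\quad V^-=C\ell_8^{odd}A,\quad \alpha_B=\bar e_1\bar e_BA,\quad \alpha_{B+8}=\bar e_BA\qquad(B=1,\dots,8).$$ Let $G(2,8)=\{e_1e_2 : e_1,e_2\in\mathbb R^8 \text{ orthonormal}\}\subset C\ell_8$, and let $M$ be the set of those $J\in SO(8)$ with $J^2=-I$ for which the bases of $\mathbb R^8$ of the form $v_1,Jv_1,v_2,Jv_2,v_3,Jv_3,v_4,Jv_4$ are negatively oriented with respect to the standard orientation. Theorem 2.1. 1. The spinors $\alpha_1,\dots,\alpha_{16}$ are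 linearly independent, $\alpha_1,\dots,\alpha_8$ span $V^+$ and $\alpha_9,\dots,\alpha_{16}$ span $V^-$. The equation $x(\alpha_1,\dots,\alpha_{16})=(\alpha_1,\dots,\alpha_{16})\Phi(x)$, $x\in C\ell_8$, defines an algebra isomorphism $\Phi\colon C\ell_8\to \mathbb R(16)$ (the spin representation). 2. $G(2,8)\subset Spin(8)$, and sending an oriented $2$-dimensional subspace of $\mathbb R^8$ to $e_1e_2$, where $e_1,e_2$ is any oriented orthonormal basis of it, is a well-defined bijection from the set of oriented $2$-dimensional subspaces of $\mathbb R^8$ onto $G(2,8)$. 3. $M\approx SO(8)/U(4)$: for every $J\in M$ the group $\{g\in SO(8): gJ=Jg\}$ is isomorphic to $U(4)$ as a topological group, and $g\mapsto gJg^t$ induces a homeomorphism from $SO(8)/\{g: gJ=Jg\}$ onto $M$. 4. $G(2,8)$ and $M$ are embedded smooth $12$-dimensional submanifolds of the vector spaces $C\ell_8$ and $\mathbb R(8)$. For every $x\in G(2,8)$ the matrix $\Phi(x)$ is block diagonal with respect to $V^+\oplus V^-$; its upper left block $\Phi^*(x)$, given by $$x(\alpha_1,\dots,\alpha_8)=(\alpha_1,\dots,\alpha_8)\Phi^*(x),$$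 lies in $M$; and $\Phi^*\colon G(2,8)\to M$ is a diffeomorphism. -/

import Mathlib

open scoped Manifold ContDiff TensorProduct Matrix

namespace SpinEight

/-! ### The Clifford algebra of Euclidean `ℝ⁸` with `v * v = -|v|²` -/

/-- Euclidean space `ℝ⁸`. -/
abbrev E8 : Type := EuclideanSpace ℝ (Fin 8)

/-- The negative definite quadratic form `v ↦ -⟨v, v⟩` on `ℝ⁸`. -/
noncomputable def Q8 : QuadraticForm ℝ E8 :=
  -(LinearMap.BilinMap.toQuadraticMap (innerₗ E8))

/-- The Clifford algebra `Cℓ₈`. -/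
abbrev Cl8 : Type := CliffordAlgebra Q8

/-- Vectors of `ℝ⁸`, seen in `Cℓ₈`. -/
noncomputable def vec (v : E8) : Cl8 := CliffordAlgebra.ι Q8 v

/-- The standard orthonormal basis `ē₁, …, ē₈`, seen in `Cℓ₈` and indexed by `0, …, 7`. -/
noncomputable def e (B : Fin 8) : Cl8 := vec (EuclideanSpace.single B 1)

theorem Q8_apply (v : E8) : Q8 v = -(inner ℝ v v) := by
  simp [Q8]

theorem vec_mul_vec_add_swap (u v : E8) :
    vec u * vec v + vec v * vec u = algebraMap ℝ Cl8 (-2 * inner ℝ u v) := by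
  rw [vec, vec, CliffordAlgebra.ι_mul_ι_add_swap]
  congr 1
  simp only [QuadraticMap.polar, Q8_apply, inner_add_left, inner_add_right, real_inner_comm v u]
  ring

/-- The defining relations `ē_B ē_C + ē_C ē_B = -2 δ_{BC}`. -/
theorem e_mul_e_add_swap (B C : Fin 8) :
    e B * e C + e C * e B = algebraMap ℝ Cl8 (if B = C then -2 else 0) := by
  rw [e, e, vec_mul_vec_add_swap]
  congr 1
  by_cases h : B = C <;> simp [h, PiLp.inner_apply]

/-! ### `Cℓ₈` is finite-dimensional, hence carries a norm -/

/-- The products `e₀^{a₀} ⋯` of the first `k` generators, spanning an increasing chain of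
subspaces. -/
noncomputable def chain : ℕ → Submodule ℝ Cl8
  | 0 => ℝ ∙ (1 : Cl8)
  | k + 1 => chain k ⊔ (if h : k < 8 then (chain k).map (LinearMap.mulLeft ℝ (e ⟨k, h⟩)) else ⊥)

theorem chain_fg (k : ℕ) : (chain k).FG := by
  induction k with
  | zero => exact Submodule.fg_span_singleton _
  | succ k ih =>
    rw [chain]
    refine ih.sup ?_
    split_ifs
    · exact ih.map _
    · exact Submodule.fg_bot

theorem one_mem_chain (k : ℕ) : (1 : Cl8) ∈ chain k := by
  induction k with
  | zero => exact Submodule.mem_span_singleton_self _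
  | succ k ih => exact (le_sup_left : chain k ≤ _) ih

theorem e_mul_chain (k : ℕ) (j : Fin 8) (hj : (j : ℕ) < k) :
    ∀ x ∈ chain k, e j * x ∈ chain k := by
  induction k with
  | zero => omega
  | succ k ih =>
    have anti : ∀ (i : Fin 8) (y : Cl8), e j * (e i * y) =
        (if j = i then (-2 : ℝ) else 0) • y - e i * (e j * y) := by
      intro i y
      have h := e_mul_e_add_swap j i
      rw [← mul_assoc, ← mul_assoc, eq_sub_iff_add_eq, ← add_mul, h, ← Algebra.smul_def]
    have sq : ∀ y : Cl8, e j * (e j * y) = -y := by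
      intro y
      have h := anti j y
      rw [if_pos rfl, eq_sub_iff_add_eq, ← two_smul ℝ, neg_smul, ← smul_neg] at h
      exact smul_right_injective Cl8 (two_ne_zero (α := ℝ)) h
    intro x hx
    have hle : chain k ≤ chain (k + 1) := le_sup_left
    rw [chain] at hx
    obtain ⟨a, ha, b, hb, rfl⟩ := Submodule.mem_sup.1 hx
    have hk : k < 8 ∨ ¬ k < 8 := em _
    have hmul : ∀ (h : k < 8), ∀ y ∈ chain k, e ⟨k, h⟩ * y ∈ chain (k + 1) := by
      intro h y hy
      rw [chain, dif_pos h]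
      exact Submodule.mem_sup_right ⟨y, hy, rfl⟩
    rw [mul_add]
    rcases hk with hk | hk
    · rw [dif_pos hk] at hb
      obtain ⟨y, hy, rfl⟩ := hb
      simp only [LinearMap.mulLeft_apply]
      by_cases hjk : (j : ℕ) = k
      · have hj' : j = ⟨k, hk⟩ := Fin.ext hjk
        refine Submodule.add_mem _ ?_ ?_
        · rw [hj']; exact hmul hk a ha
        · rw [← hj', sq]; exact Submodule.neg_mem _ (hle hy)
      · have hlt : (j : ℕ) < k := by omega
        refine Submodule.add_mem _ (hle (ih hlt a ha)) ?_
        rw [anti]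
        exact Submodule.sub_mem _ (Submodule.smul_mem _ _ (hle hy)) (hmul hk _ (ih hlt y hy))
    · rw [dif_neg hk, Submodule.mem_bot] at hb
      subst hb
      have hlt : (j : ℕ) < k := by have := j.2; omega
      rw [mul_zero, add_zero]
      exact hle (ih hlt a ha)

theorem vec_eq_sum (v : E8) : vec v = ∑ i, v i • e i := by
  conv_lhs => rw [← (EuclideanSpace.basisFun (Fin 8) ℝ).sum_repr v]
  simp [vec, e, map_sum]

theorem chain_eight : chain 8 = ⊤ := by
  have hvec : ∀ v : E8, ∀ x ∈ chain 8, vec v * x ∈ chain 8 := by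
    intro v x hx
    rw [vec_eq_sum, Finset.sum_mul]
    refine Submodule.sum_mem _ fun i _ => ?_
    rw [smul_mul_assoc]
    exact Submodule.smul_mem _ _ (e_mul_chain 8 i i.2 x hx)
  refine Submodule.eq_top_iff'.2 fun x => ?_
  have key : ∀ x : Cl8, ∀ y ∈ chain 8, x * y ∈ chain 8 := by
    intro x
    induction x using CliffordAlgebra.induction with
    | algebraMap r =>
      intro y hy
      rw [← Algebra.smul_def]
      exact Submodule.smul_mem _ _ hy
    | ι v => exact hvec v
    | mul a b ha hb =>
      intro y hy
      rw [mul_assoc]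
      exact ha _ (hb _ hy)
    | add a b ha hb =>
      intro y hy
      rw [add_mul]
      exact Submodule.add_mem _ (ha _ hy) (hb _ hy)
  simpa using key x 1 (one_mem_chain 8)

instance finite_Cl8 : Module.Finite ℝ Cl8 :=
  ⟨by rw [← chain_eight]; exact chain_fg 8⟩

/-- A norm on the finite-dimensional real vector space `Cℓ₈`: the sup norm of the coordinates in
some basis. All norms on `Cℓ₈` are equivalent, so the topology and the smooth structure that it
defines are the standard ones. -/
noncomputable instance normedAddCommGroupCl8 : NormedAddCommGroup Cl8 :=
  NormedAddCommGroup.induced Cl8 (Fin (Module.finrank ℝ Cl8) → ℝ)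
    (Module.finBasis ℝ Cl8).equivFun (Module.finBasis ℝ Cl8).equivFun.injective

noncomputable instance normedSpaceCl8 : NormedSpace ℝ Cl8 :=
  NormedSpace.induced ℝ Cl8 (Fin (Module.finrank ℝ Cl8) → ℝ)
    (Module.finBasis ℝ Cl8).equivFun

/-! ### Spinors and the spin representation -/

/-- The real part `Cℓ₈ ⊗ ℂ → Cℓ₈`. -/
noncomputable def cliffordRe : (ℂ ⊗[ℝ] Cl8) →ₗ[ℝ] Cl8 :=
  (TensorProduct.lid ℝ Cl8).toLinearMap ∘ₗ LinearMap.rTensor Cl8 Complex.reLm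

/-- The element `ē_B + √-1 ē_C` of `Cℓ₈ ⊗ ℂ`. -/
noncomputable def isotropic (B C : Fin 8) : ℂ ⊗[ℝ] Cl8 :=
  (1 : ℂ) ⊗ₜ[ℝ] e B + Complex.I ⊗ₜ[ℝ] e C

/-- `A₈ = Re[(ē₁ + √-1 ē₂)(ē₃ + √-1 ē₄)(ē₅ + √-1 ē₆)(ē₇ + √-1 ē₈)]`. -/
noncomputable def A8 : Cl8 :=
  cliffordRe (isotropic 0 1 * isotropic 2 3 * isotropic 4 5 * isotropic 6 7)

/-- `β₈ = ē₁ ē₃ ē₅ ē₇`. -/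
noncomputable def beta8 : Cl8 := e 0 * e 2 * e 4 * e 6

/-- `A = A₈ (1 + β₈)`. -/
noncomputable def spinorA : Cl8 := A8 * (1 + beta8)

/-- The positive spinor space `V⁺ = Cℓ₈^{even} A`. -/
noncomputable def Vplus : Submodule ℝ Cl8 :=
  (CliffordAlgebra.evenOdd Q8 0).map (LinearMap.mulRight ℝ spinorA)

/-- The negative spinor space `V⁻ = Cℓ₈^{odd} A`. -/
noncomputable def Vminus : Submodule ℝ Cl8 :=
  (CliffordAlgebra.evenOdd Q8 1).map (LinearMap.mulRight ℝ spinorA)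

/-- The spinors `α_B = ē₁ ē_B A` (left summand) and `α_{B+8} = ē_B A` (right summand),
`B = 1, …, 8`. -/
noncomputable def alpha : Fin 8 ⊕ Fin 8 → Cl8 :=
  Sum.elim (fun B => e 0 * e B * spinorA) (fun B => e B * spinorA)

/-- `Φ` is the matrix form of left multiplication by `Cℓ₈` on the spinors:
`x (α₁, …, α₁₆) = (α₁, …, α₁₆) Φ(x)`. -/
def IsSpinRepresentation (Φ : Cl8 → Matrix (Fin 8 ⊕ Fin 8) (Fin 8 ⊕ Fin 8) ℝ) : Prop :=
  ∀ (x : Cl8) (j : Fin 8 ⊕ Fin 8), x * alpha j = ∑ i, Φ x i j • alpha i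

/-! ### The oriented Grassmannian -/

/-- An oriented two-dimensional linear subspace of `ℝ⁸`. -/
structure OrientedPlane where
  plane : Submodule ℝ E8
  finrank_plane : Module.finrank ℝ plane = 2
  orientation : Orientation ℝ plane (Fin 2)

/-- The oriented Grassmannian `G(2,8)` inside `Cℓ₈`: all Clifford products `e₁ e₂` of orthonormal
pairs `e₁, e₂` of vectors of `ℝ⁸`. -/
def G28 : Set Cl8 :=
  {x | ∃ u v : E8, ‖u‖ = 1 ∧ ‖v‖ = 1 ∧ inner ℝ u v = 0 ∧ x = vec u * vec v}

/-! ### Oriented orthogonal complex structures on `ℝ⁸` -/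

/-- The rotation group `SO(8)`. -/
abbrev SO8 : Type := Matrix.specialOrthogonalGroup (Fin 8) ℝ

/-- The matrix with rows `v₁, J v₁, v₂, J v₂, v₃, J v₃, v₄, J v₄`. -/
def complexFrame (J : Matrix (Fin 8) (Fin 8) ℝ) (v : Fin 4 → Fin 8 → ℝ) :
    Matrix (Fin 8) (Fin 8) ℝ :=
  Matrix.of ![v 0, J *ᵥ v 0, v 1, J *ᵥ v 1, v 2, J *ᵥ v 2, v 3, J *ᵥ v 3]

/-- The orthogonal complex structures `J` on `ℝ⁸` that induce the orientation opposite to the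
standard one, that is, for which the bases `v₁, J v₁, …, v₄, J v₄` of `ℝ⁸` are negatively oriented
(the sign is the same for all bases of this form, as complex linear automorphisms have positive
real determinant). -/
def M : Set (Matrix (Fin 8) (Fin 8) ℝ) :=
  {J | J ∈ Matrix.specialOrthogonalGroup (Fin 8) ℝ ∧ J * J = -1 ∧
    ∃ v : Fin 4 → Fin 8 → ℝ, (complexFrame J v).det < 0}

/-- The entries of an element of `M`: the inclusion of `M` into the vector space `R(8)`. -/
def M.entries (J : M) : Fin 8 → Fin 8 → ℝ := Matrix.of.symm J.1

/-- An element of `M` as an element of `SO(8)`. -/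
def M.toSO8 (J : M) : SO8 := ⟨J.1, J.2.1⟩

/-- The subgroup `U(ℝ⁸, J)` of `SO(8)`: the rotations that commute with `J`. -/
def commutingRotations (J : M) : Subgroup SO8 := Subgroup.centralizer {M.toSO8 J}

end SpinEight

open SpinEight

namespace SpinEight

/-! ### Spinors -/

/-! The spinor `spinorA` is, up to a scalar, a primitive idempotent. The commuting involutions
ē₁ē₂ē₃ē₄, ē₁ē₂ē₅ē₆, ē₁ē₂ē₇ē₈ and ē₁ē₃ē₅ē₇ act on it by signs. With indices `0, …, 7`, the quadruples
among their products (up to sign) that contain `0` are `0` together with a line of the Fano plane,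
that is, a triple with XOR zero. Hence `e i * e j * spinorA` is plus or minus `e 0 * e (i ^^^ j) *
spinorA`, and all of Clifford multiplication on spinors is encoded in one table of signs, `sgn`. The
matrices `gamma i` built from it satisfy the Clifford relations, so they define `spinRep`. Since
`spinRep spinorA` is 16 times a matrix unit, moving it around by generators gives every matrix unit;
`spinRep` is onto, and bijective because `Cl8` has dimension at most 2⁸ = 16². Independence of the
spinors is read off from this.

The sign table is octonion multiplication: `slash u` is left multiplication by the conjugate of `u`,
and an orthonormal pair `u, v` acts on V⁺ by `-(slash u * (slash v)ᵀ)`. This lies in `M` because it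
does so for one pair (`gamma_one_mem_M`), because images of Spin(8) move any orthonormal pair to any
other, and because conjugation by SO(8) preserves `M` (`neg_slash_mem_M`). Injectivity is linear:
traces of products of four gamma matrices recover the bivector from its matrix
(`ofHalfSpin_neg_slash`).

Surjectivity is triality. SO(8) is transitive on `M`, so it suffices that conjugation by a rotation
sends matrices `slash u * (slash v)ᵀ` to matrices of the same kind. A rotation is an even product of
reflections, hence a product of bimultiplications x ↦ axa by unit octonions; for those the claim is
the Moufang identity (`moufang`).

For smoothness, both spaces carry affine Plücker charts, quotients of linear forms on the ambient
space, which extend to slice charts of the ambient space (`ProjChart`). The half-spin map and its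
inverse are restrictions of linear maps, hence smooth. The identification of `M` with SO(8)/U(4)
rests on writing each `J` as `Rᵀ * stdJ * R` with `R` orthogonal of determinant -1 (`mem_M_iff`). -/

theorem e_mul_self (i : Fin 8) : e i * e i = -1 := by
  have h := e_mul_e_add_swap i i
  rw [if_pos rfl, ← two_smul ℝ, Algebra.algebraMap_eq_smul_one, neg_smul, ← smul_neg] at h
  exact smul_right_injective Cl8 (two_ne_zero (α := ℝ)) h

theorem e_mul_e_swap {i j : Fin 8} (h : i ≠ j) : e i * e j = -(e j * e i) := by
  have := e_mul_e_add_swap i j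
  rw [if_neg h, map_zero] at this
  exact eq_neg_of_add_eq_zero_left this

theorem e_mul_self_mul (i : Fin 8) (x : Cl8) : e i * (e i * x) = -x := by
  rw [← mul_assoc, e_mul_self, neg_one_mul]

theorem e_mul_e_mul_swap {i j : Fin 8} (h : j < i) (x : Cl8) :
    e i * (e j * x) = -(e j * (e i * x)) := by
  rw [← mul_assoc, e_mul_e_swap h.ne', neg_mul, mul_assoc]

theorem e_mul_e_swap_of_lt {i j : Fin 8} (h : j < i) : e i * e j = -(e j * e i) :=
  e_mul_e_swap h.ne'

theorem A8_eq : A8 = e 0 * (e 2 * (e 4 * e 6)) - e 0 * (e 2 * (e 5 * e 7))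
    - e 0 * (e 3 * (e 4 * e 7)) - e 0 * (e 3 * (e 5 * e 6)) - e 1 * (e 2 * (e 4 * e 7))
    - e 1 * (e 2 * (e 5 * e 6)) - e 1 * (e 3 * (e 4 * e 6)) + e 1 * (e 3 * (e 5 * e 7)) := by
  simp only [A8, isotropic, cliffordRe, mul_add, add_mul, Algebra.TensorProduct.tmul_mul_tmul,
    map_add, LinearMap.comp_apply, LinearMap.rTensor_tmul, LinearEquiv.coe_coe,
    TensorProduct.lid_tmul, Complex.reLm_coe, one_mul, mul_one, Complex.I_mul_I, mul_assoc,
    Complex.one_re, Complex.I_re, Complex.neg_re, neg_mul, neg_neg,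
    one_smul, zero_smul, neg_smul, neg_zero]
  abel

/-- Left multiplication by `e 0 * e 1` turns the factor ē₁ + √-1 ē₂ into -√-1 times itself, and `e 2
* e 3` does the same to the second factor. The product of the two therefore acts by the real number
-1, which survives taking real parts. -/
theorem stab_0123 : e 0 * (e 1 * (e 2 * (e 3 * spinorA))) = -spinorA := by
  have : e 0 * (e 1 * (e 2 * (e 3 * A8))) = -A8 := by
    rw [A8_eq]
    simp (disch := decide) only [mul_add, mul_sub, e_mul_e_mul_swap,
      e_mul_self_mul, mul_neg, neg_neg]
    abel
  rw [spinorA, ← neg_mul, ← this]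
  simp only [mul_assoc]

theorem stab_0145 : e 0 * (e 1 * (e 4 * (e 5 * spinorA))) = -spinorA := by
  have : e 0 * (e 1 * (e 4 * (e 5 * A8))) = -A8 := by
    rw [A8_eq]
    simp (disch := decide) only [mul_add, mul_sub, e_mul_e_mul_swap,
      e_mul_self_mul, mul_neg, neg_neg]
    abel
  rw [spinorA, ← neg_mul, ← this]
  simp only [mul_assoc]

theorem stab_0167 : e 0 * (e 1 * (e 6 * (e 7 * spinorA))) = -spinorA := by
  have : e 0 * (e 1 * (e 6 * (e 7 * A8))) = -A8 := by
    rw [A8_eq]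
    simp (disch := decide) only [mul_add, mul_sub, e_mul_e_mul_swap, e_mul_e_swap_of_lt,
      e_mul_self_mul, e_mul_self, mul_neg, mul_one, neg_neg]
    abel
  rw [spinorA, ← neg_mul, ← this]
  simp only [mul_assoc]

/-- Here the factor `1 + beta8` matters: `beta8` commutes with `A8` and squares to 1, so it is
absorbed by `1 + beta8`. -/
theorem stab_0246 : e 0 * (e 2 * (e 4 * (e 6 * spinorA))) = spinorA := by
  have h : e 0 * (e 2 * (e 4 * (e 6 * A8))) = A8 * beta8 := by
    rw [A8_eq, beta8]
    simp (disch := decide) only [mul_add, mul_sub, add_mul, sub_mul, mul_assoc, e_mul_e_mul_swap,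
      e_mul_e_swap_of_lt, e_mul_self_mul, e_mul_self, mul_neg, mul_one, neg_neg]
  have h2 : beta8 * beta8 = 1 := by
    rw [beta8]
    simp (disch := decide) only [mul_assoc, e_mul_e_mul_swap,
      e_mul_self, mul_neg, mul_one, neg_neg]
  have : e 0 * (e 2 * (e 4 * (e 6 * spinorA))) =
      e 0 * (e 2 * (e 4 * (e 6 * A8))) * (1 + beta8) := by
    rw [spinorA]; simp only [mul_assoc]
  rw [this, h, mul_assoc, mul_add, h2, mul_one, add_comm beta8, spinorA]

/-- The signs in `ē_i ē_j A = ± ē_0 ē_{i ^^^ j} A`. -/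
def sgn : Fin 8 → Fin 8 → ℤ :=
  ![![1, 1, 1, 1, 1, 1, 1, 1], ![-1, 1, 1, -1, 1, -1, 1, -1], ![-1, -1, 1, 1, -1, 1, 1, -1],
    ![-1, 1, -1, 1, 1, 1, -1, -1], ![-1, -1, 1, -1, 1, 1, -1, 1], ![-1, 1, -1, -1, -1, 1, 1, 1],
    ![-1, -1, -1, 1, 1, -1, 1, 1], ![-1, 1, 1, 1, -1, -1, -1, 1]]

/-- This and the next two stabilizers are, up to sign, products of three of the previous four; with
them all seven Fano lines are covered. -/
theorem stab_0257 : e 0 * (e 2 * (e 5 * (e 7 * spinorA))) = -spinorA := by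
  rw [← neg_eq_iff_eq_neg]
  conv_rhs => rw [← neg_neg spinorA, ← stab_0145, ← stab_0246, ← neg_neg spinorA, ← stab_0167]
  simp (disch := decide) only [e_mul_e_mul_swap, e_mul_self_mul, mul_neg, neg_neg]

theorem stab_0347 : e 0 * (e 3 * (e 4 * (e 7 * spinorA))) = -spinorA := by
  rw [← neg_eq_iff_eq_neg]
  conv_rhs => rw [← neg_neg spinorA, ← stab_0123, ← stab_0246, ← neg_neg spinorA, ← stab_0167]
  simp (disch := decide) only [e_mul_e_mul_swap, e_mul_self_mul, mul_neg, neg_neg]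

theorem stab_0356 : e 0 * (e 3 * (e 5 * (e 6 * spinorA))) = -spinorA := by
  rw [← neg_eq_iff_eq_neg]
  conv_rhs => rw [← neg_neg spinorA, ← stab_0123, ← stab_0246, ← neg_neg spinorA, ← stab_0145]
  simp (disch := decide) only [e_mul_e_mul_swap, e_mul_self_mul, mul_neg, neg_neg]

/-- After multiplication by `e 0 * e (i ^^^ j)`, the left side is a product of four generators with
indices of XOR zero, applied to `spinorA`. Either indices cancel in pairs, or sorting them gives one
of the seven stabilizers. The table `sgn` records the resulting signs. -/
theorem e_mul_e_mul_spinorA (i j : Fin 8) :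
    e i * (e j * spinorA) = (sgn i j : ℝ) • (e 0 * (e (i ^^^ j) * spinorA)) := by
  have inj : ∀ (k : Fin 8) (x y : Cl8), e 0 * (e k * x) = e 0 * (e k * y) → x = y := by
    intro k x y h
    have h2 := congrArg (fun z => e k * (e 0 * z)) h
    simpa only [e_mul_self_mul, mul_neg, neg_neg] using h2
  apply inj (i ^^^ j)
  fin_cases i <;> fin_cases j <;>
  dsimp <;>
  simp (disch := decide) only [mul_smul_comm, e_mul_e_mul_swap, e_mul_self_mul, stab_0123,
    stab_0145, stab_0167, stab_0246, stab_0257, stab_0347, stab_0356, mul_neg, neg_neg] <;>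
  simp [sgn]

theorem e_mul_alpha_inr (i j : Fin 8) :
    e i * alpha (Sum.inr j) = (sgn i j : ℝ) • alpha (Sum.inl (i ^^^ j)) := by
  simp only [alpha, Sum.elim_inl, Sum.elim_inr, mul_assoc]
  exact e_mul_e_mul_spinorA i j

theorem e_mul_alpha_inl (i j : Fin 8) :
    e i * alpha (Sum.inl j) = -(sgn i (i ^^^ j) : ℝ) • alpha (Sum.inr (i ^^^ j)) := by
  have h := e_mul_alpha_inr i (i ^^^ j)
  have hx : ∀ i j : Fin 8, i ^^^ (i ^^^ j) = j := by decide
  have hs : ∀ i j : Fin 8, sgn i j * sgn i j = 1 := by decide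
  rw [hx] at h
  have h2 := congrArg (fun z => (sgn i (i ^^^ j) : ℝ) • (e i * z)) h
  simp only [e_mul_self_mul, mul_smul_comm, smul_smul, ← Int.cast_mul, hs, Int.cast_one,
    one_smul] at h2
  rw [← h2, smul_neg, neg_smul]

/-! ### The gamma matrices -/

/-- The matrix of `α_{B+8} ↦ ē_i α_{B+8}`. -/
def gamma (i : Fin 8) : Matrix (Fin 8) (Fin 8) ℝ :=
  Matrix.of fun k j => if k = i ^^^ j then (sgn i j : ℝ) else 0

theorem xor_xor_cancel (i j : Fin 8) : i ^^^ (i ^^^ j) = j := by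
  revert i j; decide

theorem gamma_mulVec_single (i j : Fin 8) :
    gamma i *ᵥ Pi.single j 1 = (sgn i j : ℝ) • Pi.single (i ^^^ j) 1 := by
  ext k
  simp [gamma, Pi.single_apply]

theorem gamma_transpose_mulVec_single (i j : Fin 8) :
    (gamma i)ᵀ *ᵥ Pi.single j 1 = (sgn i (i ^^^ j) : ℝ) • Pi.single (i ^^^ j) 1 := by
  ext k
  have h : j = i ^^^ k ↔ k = i ^^^ j := by
    constructor <;> rintro rfl <;> rw [xor_xor_cancel]
  simp only [Matrix.mulVec_single_one, Matrix.col_apply, Matrix.transpose_apply, gamma,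
    Matrix.of_apply, h, Pi.smul_apply, Pi.single_apply, smul_eq_mul, mul_ite, mul_one, mul_zero]
  split_ifs with hk
  · rw [hk]
  · rfl

/-- Each `gamma i` is a signed permutation of the basis, `k` going to `i ^^^ k`. Both products send
the basis vector `k` to the same index, so the relation reduces to an identity of signs that is
checked on all triples. -/
theorem gamma_mul_transpose_add (i j : Fin 8) :
    gamma i * (gamma j)ᵀ + gamma j * (gamma i)ᵀ = (if i = j then (2 : ℝ) else 0) • 1 := by
  refine Matrix.ext_of_mulVec_single fun k => ?_
  have hx : ∀ i j k : Fin 8, i ^^^ (j ^^^ k) = j ^^^ (i ^^^ k) := by decide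
  have hs : ∀ i j k : Fin 8, sgn j (j ^^^ k) * sgn i (j ^^^ k) + sgn i (i ^^^ k) * sgn j (i ^^^ k)
      = if i = j then 2 else 0 := by decide
  have h := congrArg (Int.cast (R := ℝ)) (hs i j k)
  push_cast at h
  simp only [Matrix.add_mulVec, ← Matrix.mulVec_mulVec, gamma_transpose_mulVec_single,
    Matrix.mulVec_smul, gamma_mulVec_single, smul_smul, hx j i k, ← add_smul, h,
    Matrix.smul_mulVec, Matrix.one_mulVec]
  split_ifs with hij
  · rw [hij, xor_xor_cancel]
  · rw [zero_smul, zero_smul]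

theorem gamma_transpose_mul_add (i j : Fin 8) :
    (gamma i)ᵀ * gamma j + (gamma j)ᵀ * gamma i = (if i = j then (2 : ℝ) else 0) • 1 := by
  refine Matrix.ext_of_mulVec_single fun k => ?_
  have hx : ∀ i j k : Fin 8, i ^^^ (j ^^^ k) = j ^^^ (i ^^^ k) := by decide
  have hs : ∀ i j k : Fin 8, sgn j k * sgn i (j ^^^ (i ^^^ k)) +
      sgn i k * sgn j (j ^^^ (i ^^^ k)) = if i = j then 2 else 0 := by decide
  have h := congrArg (Int.cast (R := ℝ)) (hs i j k)
  push_cast at h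
  simp only [Matrix.add_mulVec, ← Matrix.mulVec_mulVec, gamma_transpose_mulVec_single,
    Matrix.mulVec_smul, gamma_mulVec_single, smul_smul, hx i j k, ← add_smul, h,
    Matrix.smul_mulVec, Matrix.one_mulVec]
  split_ifs with hij
  · rw [hij, xor_xor_cancel]
  · rw [zero_smul, zero_smul]

/-- The matrix of Clifford multiplication by `v` from `V⁻` to `V⁺`. -/
noncomputable def slash : E8 →ₗ[ℝ] Matrix (Fin 8) (Fin 8) ℝ where
  toFun v := ∑ i, v i • gamma i
  map_add' u v := by simp [add_smul, Finset.sum_add_distrib]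
  map_smul' c v := by simp [Finset.smul_sum, smul_smul]

theorem slash_apply (v : E8) : slash v = ∑ i, v i • gamma i := rfl

theorem slash_single (i : Fin 8) : slash (EuclideanSpace.single i 1) = gamma i := by
  simp [slash_apply]

theorem slash_mul_transpose_add (u v : E8) :
    slash u * (slash v)ᵀ + slash v * (slash u)ᵀ = (2 * inner ℝ u v) • 1 := by
  have h1 : ∀ u v : E8, slash u * (slash v)ᵀ = ∑ i, ∑ j, (u i * v j) • (gamma i * (gamma j)ᵀ) := by
    intro u v
    simp only [slash_apply, Matrix.transpose_sum, Matrix.transpose_smul, Finset.sum_mul_sum,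
      smul_mul_smul_comm]
  rw [h1, h1 v u, Finset.sum_comm (f := fun i j => (v i * u j) • (gamma i * (gamma j)ᵀ)),
    ← Finset.sum_add_distrib]
  simp only [← Finset.sum_add_distrib, mul_comm (v _), ← smul_add, gamma_mul_transpose_add,
    smul_smul, ← Finset.sum_smul]
  congr 1
  simp [PiLp.inner_apply, Finset.mul_sum, mul_comm]

theorem slash_transpose_mul_add (u v : E8) :
    (slash u)ᵀ * slash v + (slash v)ᵀ * slash u = (2 * inner ℝ u v) • 1 := by
  have h1 : ∀ u v : E8, (slash u)ᵀ * slash v = ∑ i, ∑ j, (u i * v j) • ((gamma i)ᵀ * gamma j) := by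
    intro u v
    simp only [slash_apply, Matrix.transpose_sum, Matrix.transpose_smul, Finset.sum_mul_sum,
      smul_mul_smul_comm]
  rw [h1, h1 v u, Finset.sum_comm (f := fun i j => (v i * u j) • ((gamma i)ᵀ * gamma j)),
    ← Finset.sum_add_distrib]
  simp only [← Finset.sum_add_distrib, mul_comm (v _), ← smul_add, gamma_transpose_mul_add,
    smul_smul, ← Finset.sum_smul]
  congr 1
  simp [PiLp.inner_apply, Finset.mul_sum, mul_comm]

theorem slash_mul_transpose_self (u : E8) : slash u * (slash u)ᵀ = (inner ℝ u u : ℝ) • 1 := by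
  have h := slash_mul_transpose_add u u
  rw [← two_smul ℝ, mul_smul] at h
  exact smul_right_injective _ (two_ne_zero (α := ℝ)) h

theorem slash_transpose_mul_self (u : E8) : (slash u)ᵀ * slash u = (inner ℝ u u : ℝ) • 1 := by
  have h := slash_transpose_mul_add u u
  rw [← two_smul ℝ, mul_smul] at h
  exact smul_right_injective _ (two_ne_zero (α := ℝ)) h

/-! ### The spin representation -/

/-- The spin representation on vectors. -/
noncomputable def spinVec : E8 →ₗ[ℝ] Matrix (Fin 8 ⊕ Fin 8) (Fin 8 ⊕ Fin 8) ℝ where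
  toFun v := Matrix.fromBlocks 0 (slash v) (-(slash v)ᵀ) 0
  map_add' u v := by simp [Matrix.fromBlocks_add, add_comm]
  map_smul' c v := by simp [Matrix.fromBlocks_smul]

theorem spinVec_apply (v : E8) : spinVec v = Matrix.fromBlocks 0 (slash v) (-(slash v)ᵀ) 0 := rfl

/-- The spin representation. -/
noncomputable def spinRep : Cl8 →ₐ[ℝ] Matrix (Fin 8 ⊕ Fin 8) (Fin 8 ⊕ Fin 8) ℝ :=
  CliffordAlgebra.lift Q8 ⟨spinVec, fun v => by
    rw [spinVec_apply, Matrix.fromBlocks_multiply, Q8_apply, Algebra.algebraMap_eq_smul_one,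
      ← Matrix.fromBlocks_one, Matrix.fromBlocks_smul]
    simp [slash_mul_transpose_self, slash_transpose_mul_self]⟩

theorem spinRep_vec (v : E8) : spinRep (vec v) = Matrix.fromBlocks 0 (slash v) (-(slash v)ᵀ) 0 :=
  CliffordAlgebra.lift_ι_apply _ _ _

theorem spinRep_e (i : Fin 8) :
    spinRep (e i) = Matrix.fromBlocks 0 (gamma i) (-(gamma i)ᵀ) 0 := by
  rw [e, spinRep_vec, slash_single]

theorem spinRep_vec_mul_vec (u v : E8) : spinRep (vec u * vec v) =
    Matrix.fromBlocks (-(slash u * (slash v)ᵀ)) 0 0 (-((slash u)ᵀ * slash v)) := by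
  rw [map_mul, spinRep_vec, spinRep_vec, Matrix.fromBlocks_multiply]
  simp

/-- The linear combinations of the spinors `α₁, …, α₁₆`. -/
noncomputable def spinorComb : (Fin 8 ⊕ Fin 8 → ℝ) →ₗ[ℝ] Cl8 := Fintype.linearCombination ℝ alpha

theorem spinorComb_apply (w : Fin 8 ⊕ Fin 8 → ℝ) : spinorComb w = ∑ i, w i • alpha i :=
  Fintype.linearCombination_apply _ _ _

theorem e_mul_alpha (i : Fin 8) (j : Fin 8 ⊕ Fin 8) :
    e i * alpha j = spinorComb (spinRep (e i) *ᵥ Pi.single j 1) := by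
  rw [spinRep_e, spinorComb_apply]
  rcases j with j | j
  · rw [e_mul_alpha_inl]
    have := gamma_transpose_mulVec_single i j
    rw [Matrix.mulVec_single_one] at this ⊢
    have h : ∀ k, gamma i j k = _ := fun k => congrFun this k
    simp [h, Pi.single_apply]
  · rw [e_mul_alpha_inr]
    have := gamma_mulVec_single i j
    rw [Matrix.mulVec_single_one] at this ⊢
    have h : ∀ k, gamma i k j = _ := fun k => congrFun this k
    simp [h, Pi.single_apply]

/-- Linear combinations of spinors intertwine the matrices with Clifford multiplication. This needs
no independence of the spinors; independence is deduced from it later. -/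
theorem mul_spinorComb (x : Cl8) (w : Fin 8 ⊕ Fin 8 → ℝ) :
    x * spinorComb w = spinorComb (spinRep x *ᵥ w) := by
  have he : ∀ i w, e i * spinorComb w = spinorComb (spinRep (e i) *ᵥ w) := by
    intro i w
    have hw : w = ∑ j, w j • Pi.single j (1 : ℝ) := by
      ext k; simp [Finset.sum_apply, Pi.single_apply]
    conv_rhs => rw [hw]
    simp only [spinorComb_apply w, Finset.mul_sum, mul_smul_comm, Matrix.mulVec_sum, Matrix.mulVec_smul,
      map_sum, map_smul, e_mul_alpha]
  induction x using CliffordAlgebra.induction generalizing w with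
  | algebraMap r =>
    rw [AlgHom.commutes, Algebra.algebraMap_eq_smul_one, Algebra.algebraMap_eq_smul_one,
      smul_one_mul, Matrix.smul_mulVec, Matrix.one_mulVec, map_smul]
  | ι v =>
    change vec v * _ = spinorComb (spinRep (vec v) *ᵥ w)
    simp only [vec_eq_sum, Finset.sum_mul, smul_mul_assoc, he, map_sum, map_smul, Matrix.sum_mulVec,
      Matrix.smul_mulVec]
  | mul a b ha hb => rw [mul_assoc, hb, ha, map_mul, Matrix.mulVec_mulVec]
  | add a b ha hb => rw [add_mul, hb, ha, map_add, Matrix.add_mulVec, map_add]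

theorem spinorComb_single (j : Fin 8 ⊕ Fin 8) : spinorComb (Pi.single j 1) = alpha j := by
  simp [spinorComb_apply, Pi.single_apply]

theorem mul_alpha (x : Cl8) (j : Fin 8 ⊕ Fin 8) : x * alpha j = ∑ i, spinRep x i j • alpha i := by
  rw [← spinorComb_single j, mul_spinorComb, spinorComb_apply, Matrix.mulVec_single_one]
  rfl

theorem spinRep_e_mulVec_inl (i j : Fin 8) : spinRep (e i) *ᵥ Pi.single (Sum.inl j) 1 =
    ((-sgn i (i ^^^ j) : ℤ) : ℝ) • Pi.single (Sum.inr (i ^^^ j)) 1 := by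
  have h := fun k => congrFun (gamma_transpose_mulVec_single i j) k
  rw [Matrix.mulVec_single_one] at h
  rw [spinRep_e, Matrix.mulVec_single_one]
  ext (k | k)
  · simp
  · have hk : gamma i j k = _ := h k
    simp only [hk, Pi.single_apply, Matrix.col_apply, Matrix.fromBlocks_apply₂₁, Matrix.neg_apply,
      Matrix.transpose_apply, Pi.smul_apply, Sum.inr.injEq, smul_eq_mul]
    split_ifs <;> simp

theorem spinRep_e_mulVec_inr (i j : Fin 8) : spinRep (e i) *ᵥ Pi.single (Sum.inr j) 1 =
    (sgn i j : ℝ) • Pi.single (Sum.inl (i ^^^ j)) 1 := by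
  have h := fun k => congrFun (gamma_mulVec_single i j) k
  rw [Matrix.mulVec_single_one] at h
  rw [spinRep_e, Matrix.mulVec_single_one]
  ext (k | k)
  · simpa [Pi.single_apply] using h k
  · simp

/-! ### Matrix units and bijectivity of the spin representation -/

/-- The sign of the action of `ē_a ē_b ē_c ē_d` on a spinor `α_j`. -/
def quadSgn (a b c d : Fin 8) : Fin 8 ⊕ Fin 8 → ℤ
  | .inl j => -sgn d (d ^^^ j) * sgn c (d ^^^ j) * -sgn b (b ^^^ (c ^^^ (d ^^^ j))) *
      sgn a (b ^^^ (c ^^^ (d ^^^ j)))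
  | .inr j => sgn d j * -sgn c (c ^^^ (d ^^^ j)) * sgn b (c ^^^ (d ^^^ j)) *
      -sgn a (a ^^^ (b ^^^ (c ^^^ (d ^^^ j))))

/-- A quadruple with XOR zero, as in all monomials of `A8` and in `beta8`, returns every index to
itself and so acts diagonally. -/
theorem spinRep_quad_mulVec (a b c d : Fin 8) (h : ∀ j, a ^^^ (b ^^^ (c ^^^ (d ^^^ j))) = j)
    (j : Fin 8 ⊕ Fin 8) : spinRep (e a * (e b * (e c * e d))) *ᵥ Pi.single j 1 =
      (quadSgn a b c d j : ℝ) • Pi.single j 1 := by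
  rcases j with j | j <;>
  simp only [map_mul, ← Matrix.mulVec_mulVec, spinRep_e_mulVec_inl, spinRep_e_mulVec_inr,
    Matrix.mulVec_smul, smul_smul, ← Int.cast_mul, quadSgn, h]

theorem spinRep_spinorA : spinRep spinorA = Matrix.single (Sum.inl 0) (Sum.inl 0) 16 := by
  refine Matrix.ext_of_mulVec_single fun j => ?_
  -- All factors are diagonal, so only eigenvalues matter. On the first spinor the eight signed
  -- monomials of `A8` all contribute 1 and `1 + beta8` gives 2, whence 16; on every other spinor
  -- one of the two factors vanishes.
  have hs : ∀ j : Fin 8 ⊕ Fin 8,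
      (quadSgn 0 2 4 6 j - quadSgn 0 2 5 7 j - quadSgn 0 3 4 7 j - quadSgn 0 3 5 6 j -
        quadSgn 1 2 4 7 j - quadSgn 1 2 5 6 j - quadSgn 1 3 4 6 j + quadSgn 1 3 5 7 j) *
        (1 + quadSgn 0 2 4 6 j) = if j = Sum.inl 0 then 16 else 0 := by decide
  have h := congrArg (Int.cast (R := ℝ)) (hs j)
  have hadd : ∀ (c : ℝ) (v : Fin 8 ⊕ Fin 8 → ℝ), v + c • v = (1 + c) • v := by
    intro c v
    rw [add_smul, one_smul]
  have hb : beta8 = e 0 * (e 2 * (e 4 * e 6)) := by simp only [beta8, mul_assoc]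
  rw [spinorA, hb, A8_eq, map_mul, map_add spinRep 1, map_one, ← Matrix.mulVec_mulVec,
    Matrix.add_mulVec, Matrix.one_mulVec, spinRep_quad_mulVec 0 2 4 6 (by decide), hadd,
    Matrix.mulVec_smul]
  simp only [map_add, map_sub, Matrix.add_mulVec, Matrix.sub_mulVec]
  rw [spinRep_quad_mulVec 0 2 4 6 (by decide), spinRep_quad_mulVec 0 2 5 7 (by decide),
    spinRep_quad_mulVec 0 3 4 7 (by decide), spinRep_quad_mulVec 0 3 5 6 (by decide),
    spinRep_quad_mulVec 1 2 4 7 (by decide), spinRep_quad_mulVec 1 2 5 6 (by decide),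
    spinRep_quad_mulVec 1 3 4 6 (by decide), spinRep_quad_mulVec 1 3 5 7 (by decide),
    Matrix.single_mulVec_eq]
  push_cast at h
  simp only [← add_smul, ← sub_smul, smul_smul]
  rw [mul_comm, h]
  split_ifs with hj
  · simp [hj]
  · simp [Ne.symm hj]

theorem sgn_self (i : Fin 8) : sgn i i = 1 := by revert i; decide

theorem xor_zero (i : Fin 8) : i ^^^ 0 = i := by revert i; decide

theorem zero_xor (i : Fin 8) : 0 ^^^ i = i := by revert i; decide

theorem sgn_zero (i : Fin 8) : sgn 0 i = 1 := by revert i; decide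

/-- Generators act as signed permutations: multiplying the matrix unit that comes from `spinorA` on
the left by generators reaches every row, and on the right every column. -/
theorem single_mem_range_spinRep (i j : Fin 8 ⊕ Fin 8) (c : ℝ) :
    Matrix.single i j c ∈ spinRep.range := by
  have h0 : Matrix.single (Sum.inl 0) (Sum.inl 0) (1 : ℝ) ∈ spinRep.range := by
    refine ⟨(16⁻¹ : ℝ) • spinorA, ?_⟩
    change spinRep _ = _
    rw [map_smul, spinRep_spinorA, Matrix.smul_single]
    norm_num
  have hl : ∀ i, Matrix.single i (Sum.inl 0) (1 : ℝ) ∈ spinRep.range := by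
    have hr : ∀ i : Fin 8, Matrix.single (Sum.inr i) (Sum.inl 0) (1 : ℝ) =
        -(spinRep (e i) * Matrix.single (Sum.inl 0) (Sum.inl 0) 1) := by
      intro i
      refine Matrix.ext_of_mulVec_single fun k => ?_
      rw [Matrix.neg_mulVec, ← Matrix.mulVec_mulVec, Matrix.single_mulVec_eq,
        Matrix.single_mulVec_eq, Matrix.mulVec_smul, spinRep_e_mulVec_inl, xor_zero, sgn_self]
      simp
    rintro (i | i)
    · have : Matrix.single (Sum.inl i) (Sum.inl 0) (1 : ℝ) =
          spinRep (e 0) * Matrix.single (Sum.inr i) (Sum.inl 0) 1 := by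
        refine Matrix.ext_of_mulVec_single fun k => ?_
        rw [← Matrix.mulVec_mulVec, Matrix.single_mulVec_eq,
          Matrix.single_mulVec_eq, Matrix.mulVec_smul, spinRep_e_mulVec_inr, zero_xor, sgn_zero]
        simp
      rw [this, hr]
      exact mul_mem ⟨_, rfl⟩ (neg_mem (mul_mem ⟨_, rfl⟩ h0))
    · rw [hr]
      exact neg_mem (mul_mem ⟨_, rfl⟩ h0)
  have hmul : ∀ (x : Cl8) (k : Fin 8 ⊕ Fin 8),
      Matrix.single (Sum.inl 0 : Fin 8 ⊕ Fin 8) k (1 : ℝ) * spinRep x =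
      ∑ l, spinRep x k l • Matrix.single (Sum.inl 0 : Fin 8 ⊕ Fin 8) l (1 : ℝ) := by
    intro x k
    ext a b
    rw [Matrix.sum_apply]
    by_cases ha : a = Sum.inl 0
    · subst ha
      simp [Matrix.single_apply]
    · rw [Matrix.single_mul_apply_of_ne (h := ha)]
      simp [Ne.symm ha]
  have hr : ∀ j, Matrix.single (Sum.inl 0) j (1 : ℝ) ∈ spinRep.range := by
    have hr : ∀ j : Fin 8, Matrix.single (Sum.inl 0) (Sum.inr j) (1 : ℝ) =
        Matrix.single (Sum.inl 0) (Sum.inl 0) 1 * spinRep (e j) := by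
      intro j
      rw [hmul, spinRep_e, Fintype.sum_sum_type]
      have : ∀ k, gamma j 0 k = if k = j then 1 else 0 := by
        intro k
        have h1 : (0 = j ^^^ k) ↔ k = j := by revert j k; decide
        simp only [gamma, Matrix.of_apply, h1]
        split_ifs with h
        · rw [h, sgn_self, Int.cast_one]
        · rfl
      simp [this]
    rintro (j | j)
    · have : Matrix.single (Sum.inl 0) (Sum.inl j) (1 : ℝ) =
          -(Matrix.single (Sum.inl 0) (Sum.inr j) 1 * spinRep (e 0)) := by
        rw [hmul, spinRep_e, Fintype.sum_sum_type]
        have : ∀ k, gamma 0 k j = if k = j then 1 else 0 := by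
          intro k
          simp [gamma, zero_xor, sgn_zero]
        simp [this]
      rw [this, hr]
      exact neg_mem (mul_mem (mul_mem h0 ⟨_, rfl⟩) ⟨_, rfl⟩)
    · rw [hr]
      exact mul_mem h0 ⟨_, rfl⟩
  have := Subalgebra.smul_mem _ (mul_mem (hl i) (hr j)) c
  rwa [Matrix.single_mul_single_same, Matrix.smul_single, one_mul, smul_eq_mul, mul_one] at this

theorem spinRep_surjective : Function.Surjective spinRep := by
  intro X
  have : X ∈ spinRep.range := by
    rw [Matrix.matrix_eq_sum_single X]
    exact sum_mem fun i _ => sum_mem fun j _ => single_mem_range_spinRep i j _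
  exact this

theorem finrank_chain_le (k : ℕ) : Module.finrank ℝ (chain k) ≤ 2 ^ k := by
  induction k with
  | zero => exact (finrank_span_le_card _).trans (by simp)
  | succ k ih =>
    rw [chain]
    refine (Submodule.finrank_add_le_finrank_add_finrank _ _).trans ?_
    rw [pow_succ, mul_two]
    refine add_le_add ih ?_
    by_cases h : k < 8
    · rw [dif_pos h]
      have := Submodule.finrank_map_le (LinearMap.mulLeft ℝ (e ⟨k, h⟩)) (chain k)
      exact this.trans ih
    · rw [dif_neg h, finrank_bot]
      exact Nat.zero_le _

/-- The spanning chain bounds the dimension of `Cl8` by 2⁸, which is the dimension of the 16 × 16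
matrices, so surjectivity forces injectivity. -/
theorem spinRep_bijective : Function.Bijective spinRep := by
  refine ⟨?_, spinRep_surjective⟩
  have h1 : Module.finrank ℝ Cl8 ≤ 256 := by
    have := finrank_chain_le 8
    rwa [chain_eight, finrank_top] at this
  have h2 : Module.finrank ℝ (Matrix (Fin 8 ⊕ Fin 8) (Fin 8 ⊕ Fin 8) ℝ) = 256 := by
    simp [Module.finrank_matrix]
  have h3 : Module.finrank ℝ Cl8 = Module.finrank ℝ (Matrix (Fin 8 ⊕ Fin 8) (Fin 8 ⊕ Fin 8) ℝ) :=
    le_antisymm (h2 ▸ h1) (LinearMap.finrank_le_finrank_of_surjective (f := spinRep.toLinearMap) spinRep_surjective)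
  exact (LinearMap.injective_iff_surjective_of_finrank_eq_finrank (f := spinRep.toLinearMap) h3).2
    spinRep_surjective

/-- The spin representation as an isomorphism of algebras. -/
noncomputable def spinEquiv : Cl8 ≃ₐ[ℝ] Matrix (Fin 8 ⊕ Fin 8) (Fin 8 ⊕ Fin 8) ℝ :=
  AlgEquiv.ofBijective spinRep spinRep_bijective

theorem spinEquiv_apply (x : Cl8) : spinEquiv x = spinRep x := rfl

/-! ### Independence of the spinors and the spaces V⁺, V⁻ -/

theorem alpha_inl_zero : alpha (Sum.inl 0) = -spinorA := by
  simp [alpha, e_mul_self]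

theorem spinorA_ne_zero : spinorA ≠ 0 := by
  intro h
  have h1 := congrFun (congrFun spinRep_spinorA (Sum.inl 0)) (Sum.inl 0)
  simp [h] at h1

theorem linearIndependent_alpha : LinearIndependent ℝ alpha := by
  rw [Fintype.linearIndependent_iff]
  intro w hw k
  rw [← spinorComb_apply] at hw
  -- A Clifford element acting as the matrix unit from position `k` to the first position maps a
  -- relation to its `k`-th coefficient times the nonzero spinor `-spinorA`.
  obtain ⟨x, hx⟩ := spinRep_surjective (Matrix.single (Sum.inl 0) k 1)
  have h := mul_spinorComb x w
  rw [hw, mul_zero, hx, Matrix.single_mulVec_eq, map_smul, spinorComb_single, alpha_inl_zero,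
    one_mul, eq_comm, smul_eq_zero] at h
  exact h.resolve_right (neg_ne_zero.2 spinorA_ne_zero)

theorem spinRep_of_mem_even {x : Cl8} (hx : x ∈ CliffordAlgebra.evenOdd Q8 0) :
    (spinRep x).toBlocks₁₂ = 0 ∧ (spinRep x).toBlocks₂₁ = 0 := by
  induction x, hx using CliffordAlgebra.even_induction with
  | algebraMap r =>
    rw [AlgHom.commutes, Algebra.algebraMap_eq_smul_one, ← Matrix.fromBlocks_one,
      Matrix.fromBlocks_smul]
    simp
  | add x y hx hy ihx ihy =>
    rw [map_add, ← Matrix.fromBlocks_toBlocks (spinRep x), ← Matrix.fromBlocks_toBlocks (spinRep y),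
      Matrix.fromBlocks_add]
    simp [ihx, ihy]
  | ι_mul_ι_mul u v x hx ih =>
    rw [map_mul]
    change (spinRep (vec u * vec v) * _).toBlocks₁₂ = 0 ∧ (spinRep (vec u * vec v) * _).toBlocks₂₁ = 0
    rw [spinRep_vec_mul_vec, ← Matrix.fromBlocks_toBlocks (spinRep x), Matrix.fromBlocks_multiply]
    simp [ih]

theorem spinRep_of_mem_odd {x : Cl8} (hx : x ∈ CliffordAlgebra.evenOdd Q8 1) :
    (spinRep x).toBlocks₁₁ = 0 ∧ (spinRep x).toBlocks₂₂ = 0 := by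
  induction x, hx using CliffordAlgebra.odd_induction with
  | ι v =>
    change (spinRep (vec v)).toBlocks₁₁ = 0 ∧ (spinRep (vec v)).toBlocks₂₂ = 0
    simp [spinRep_vec]
  | add x y hx hy ihx ihy =>
    rw [map_add, ← Matrix.fromBlocks_toBlocks (spinRep x), ← Matrix.fromBlocks_toBlocks (spinRep y),
      Matrix.fromBlocks_add]
    simp [ihx, ihy]
  | ι_mul_ι_mul u v x hx ih =>
    rw [map_mul]
    change (spinRep (vec u * vec v) * _).toBlocks₁₁ = 0 ∧ (spinRep (vec u * vec v) * _).toBlocks₂₂ = 0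
    rw [spinRep_vec_mul_vec, ← Matrix.fromBlocks_toBlocks (spinRep x), Matrix.fromBlocks_multiply]
    simp [ih]

theorem mul_spinorA (x : Cl8) : x * spinorA = -∑ i, spinRep x i (Sum.inl 0) • alpha i := by
  rw [← mul_alpha, alpha_inl_zero, mul_neg, neg_neg]

theorem span_alpha_inl : Submodule.span ℝ (Set.range (alpha ∘ Sum.inl)) = Vplus := by
  apply le_antisymm
  · rw [Submodule.span_le]
    rintro _ ⟨B, rfl⟩
    exact ⟨e 0 * e B, CliffordAlgebra.ι_mul_ι_mem_evenOdd_zero Q8 _ _, rfl⟩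
  · rintro _ ⟨x, hx, rfl⟩
    have h := fun i : Fin 8 => congrFun (congrFun (spinRep_of_mem_even hx).2 i) 0
    rw [LinearMap.mulRight_apply, mul_spinorA, Fintype.sum_sum_type]
    refine neg_mem (add_mem (sum_mem fun i _ => Submodule.smul_mem _ _
      (Submodule.subset_span ⟨i, rfl⟩)) (sum_mem fun i _ => ?_))
    have h0 : spinRep x (Sum.inr i) (Sum.inl 0) = 0 := h i
    rw [h0, zero_smul]
    exact zero_mem _

theorem span_alpha_inr : Submodule.span ℝ (Set.range (alpha ∘ Sum.inr)) = Vminus := by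
  apply le_antisymm
  · rw [Submodule.span_le]
    rintro _ ⟨B, rfl⟩
    exact ⟨e B, CliffordAlgebra.ι_mem_evenOdd_one Q8 _, rfl⟩
  · rintro _ ⟨x, hx, rfl⟩
    have h := fun i : Fin 8 => congrFun (congrFun (spinRep_of_mem_odd hx).1 i) 0
    rw [LinearMap.mulRight_apply, mul_spinorA, Fintype.sum_sum_type]
    refine neg_mem (add_mem (sum_mem fun i _ => ?_) (sum_mem fun i _ => Submodule.smul_mem _ _
      (Submodule.subset_span ⟨i, rfl⟩)))
    have h0 : spinRep x (Sum.inl i) (Sum.inl 0) = 0 := h i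
    rw [h0, zero_smul]
    exact zero_mem _

/-! ### The oriented Grassmannian lies in the spin group -/

theorem vec_mul_self (v : E8) : vec v * vec v = -(inner ℝ v v : ℝ) • 1 := by
  rw [vec, CliffordAlgebra.ι_sq_scalar, Q8_apply, Algebra.algebraMap_eq_smul_one]

theorem vec_mul_self_of_norm_eq_one {v : E8} (hv : ‖v‖ = 1) : vec v * vec v = -1 := by
  rw [vec_mul_self, real_inner_self_eq_norm_sq, hv, one_pow, neg_one_smul]

theorem vec_mem_pinGroup {v : E8} (hv : ‖v‖ = 1) : vec v ∈ pinGroup Q8 := by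
  have h := vec_mul_self_of_norm_eq_one hv
  have hs : star (vec v) = -vec v := by
    rw [vec, CliffordAlgebra.star_def, CliffordAlgebra.involute_ι, map_neg,
      CliffordAlgebra.reverse_ι]
  refine pinGroup.mem_iff.2 ⟨⟨⟨vec v, -vec v, ?_, ?_⟩, Subgroup.subset_closure ⟨v, rfl⟩, rfl⟩, ?_⟩
  · rw [mul_neg, h, neg_neg]
  · rw [neg_mul, h, neg_neg]
  · rw [Unitary.mem_iff, hs, neg_mul, mul_neg, h, neg_neg]
    exact ⟨rfl, rfl⟩

theorem G28_subset_spinGroup : G28 ⊆ (spinGroup Q8 : Set Cl8) := by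
  rintro _ ⟨u, v, hu, hv, -, rfl⟩
  exact spinGroup.mem_iff.2 ⟨mul_mem (vec_mem_pinGroup hu) (vec_mem_pinGroup hv),
    CliffordAlgebra.ι_mul_ι_mem_evenOdd_zero Q8 u v⟩

/-! ### Bivectors and their action on the positive spinors -/

theorem trace_eq_of_mulVec_single {X : Matrix (Fin 8) (Fin 8) ℝ} {σ : Fin 8 → Fin 8} {c : Fin 8 → ℤ}
    (h : ∀ n, X *ᵥ Pi.single n 1 = (c n : ℝ) • Pi.single (σ n) 1) :
    X.trace = ((∑ n, if σ n = n then c n else 0 : ℤ) : ℝ) := by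
  rw [Matrix.trace, Int.cast_sum]
  refine Finset.sum_congr rfl fun n _ => ?_
  have := congrFun (h n) n
  rw [Matrix.mulVec_single_one] at this
  rw [Matrix.diag_apply, show X n n = _ from this]
  simp [Pi.single_apply, eq_comm]

/-- This is the usual trace formula for four gamma matrices on a half-spin space. The product is a
signed permutation, so its trace is a sum of signs over fixed indices, and the identity is checked
on all quadruples. -/
theorem trace_gamma_quad (k a b l : Fin 8) :
    ((gamma k)ᵀ * (gamma a * (gamma b)ᵀ) * gamma l).trace =
      8 * ((if a = b ∧ l = k then 1 else 0) - (if a = l ∧ b = k then 1 else 0) +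
        (if a = k ∧ b = l then 1 else 0)) := by
  have hs : ∀ k a b l : Fin 8,
      (∑ n, if k ^^^ (a ^^^ (b ^^^ (l ^^^ n))) = n then sgn l n * sgn b (b ^^^ (l ^^^ n)) *
        sgn a (b ^^^ (l ^^^ n)) * sgn k (k ^^^ (a ^^^ (b ^^^ (l ^^^ n)))) else 0) =
      8 * ((if a = b ∧ l = k then 1 else 0) - (if a = l ∧ b = k then 1 else 0) +
        (if a = k ∧ b = l then 1 else 0)) := by decide +kernel
  rw [trace_eq_of_mulVec_single (σ := fun n => k ^^^ (a ^^^ (b ^^^ (l ^^^ n))))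
    (c := fun n => sgn l n * sgn b (b ^^^ (l ^^^ n)) *
        sgn a (b ^^^ (l ^^^ n)) * sgn k (k ^^^ (a ^^^ (b ^^^ (l ^^^ n))))), hs]
  · push_cast
    rfl
  · intro n
    simp only [← Matrix.mulVec_mulVec, gamma_mulVec_single, gamma_transpose_mulVec_single,
      Matrix.mulVec_smul, smul_smul, Int.cast_mul, mul_assoc]

theorem trace_slash_quad (u v : E8) (k l : Fin 8) :
    ((gamma k)ᵀ * (slash u * (slash v)ᵀ) * gamma l).trace =
      8 * ((if l = k then inner ℝ u v else 0) - u l * v k + u k * v l) := by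
  have h1 : (gamma k)ᵀ * (slash u * (slash v)ᵀ) * gamma l =
      ∑ i, ∑ j, (u i * v j) • ((gamma k)ᵀ * (gamma i * (gamma j)ᵀ) * gamma l) := by
    simp only [slash_apply, Matrix.transpose_sum, Matrix.transpose_smul, smul_mul_smul_comm,
      Finset.mul_sum, Finset.sum_mul, Matrix.mul_smul, Matrix.smul_mul]
    exact Finset.sum_comm
  rw [h1]
  simp only [Matrix.trace_sum, Matrix.trace_smul, trace_gamma_quad, smul_eq_mul, mul_add, mul_sub,
    Finset.sum_add_distrib, Finset.sum_sub_distrib, ite_and]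
  congr 1
  · congr 1
    · split_ifs with h
      · simp [PiLp.inner_apply, Finset.mul_sum, mul_comm]
      · simp
    · simp [mul_comm]
  · simp [mul_comm]

/-- The coordinates of the bivector that acts on the positive spinors by a given matrix. -/
noncomputable def bivec : Matrix (Fin 8) (Fin 8) ℝ →ₗ[ℝ] Matrix (Fin 8) (Fin 8) ℝ where
  toFun X := Matrix.of fun k l =>
    (-1 / 16 : ℝ) * (((gamma k)ᵀ * X * gamma l).trace - ((gamma l)ᵀ * X * gamma k).trace)
  map_add' X Y := by
    ext k l
    simp only [mul_add, add_mul, Matrix.trace_add, Matrix.add_apply, Matrix.of_apply]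
    ring
  map_smul' c X := by
    ext k l
    simp only [Matrix.mul_smul, Matrix.smul_mul, Matrix.trace_smul, Matrix.smul_apply,
      Matrix.of_apply, smul_eq_mul, RingHom.id_apply]
    ring

theorem bivec_apply (X : Matrix (Fin 8) (Fin 8) ℝ) (k l : Fin 8) : bivec X k l =
    (-1 / 16 : ℝ) * (((gamma k)ᵀ * X * gamma l).trace - ((gamma l)ᵀ * X * gamma k).trace) := rfl

/-- Antisymmetrizing the trace formula in `k`, `l` kills the scalar term and doubles the others,
giving 8 · 2 = 16 times the Plücker coordinate up to sign; this explains the factor -1/16. -/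
theorem bivec_neg_slash (u v : E8) (k l : Fin 8) :
    bivec (-(slash u * (slash v)ᵀ)) k l = u k * v l - u l * v k := by
  simp only [bivec_apply, mul_neg, neg_mul, Matrix.trace_neg, trace_slash_quad, eq_comm (a := l)]
  ring

/-- The bilinear form on vectors given by a bivector. -/
noncomputable def bivecForm (a b : E8) : Matrix (Fin 8) (Fin 8) ℝ →ₗ[ℝ] ℝ where
  toFun X := ∑ k, ∑ l, a k * b l * bivec X k l
  map_add' X Y := by simp [mul_add, Finset.sum_add_distrib]
  map_smul' c X := by
    simp only [map_smul, Matrix.smul_apply, smul_eq_mul, RingHom.id_apply, Finset.mul_sum]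
    refine Finset.sum_congr rfl fun k _ => Finset.sum_congr rfl fun l _ => ?_
    ring

theorem bivecForm_apply (a b : E8) (X : Matrix (Fin 8) (Fin 8) ℝ) :
    bivecForm a b X = ∑ k, ∑ l, a k * b l * bivec X k l := rfl

theorem bivecForm_neg_slash (a b u v : E8) : bivecForm a b (-(slash u * (slash v)ᵀ)) =
    inner ℝ u a * inner ℝ v b - inner ℝ u b * inner ℝ v a := by
  simp only [bivecForm_apply, bivec_neg_slash, PiLp.inner_apply, Finset.sum_mul_sum]
  rw [Finset.sum_comm (f := fun i j => inner ℝ (u i) (b i) * inner ℝ (v j) (a j)),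
    ← Finset.sum_sub_distrib]
  refine Finset.sum_congr rfl fun k _ => ?_
  rw [← Finset.sum_sub_distrib]
  refine Finset.sum_congr rfl fun l _ => ?_
  simp only [RCLike.inner_apply, conj_trivial]
  ring

/-- The exterior product of two vectors, in the Clifford algebra. -/
noncomputable def wedge (u v : E8) : Cl8 := vec u * vec v + (inner ℝ u v : ℝ) • 1

theorem vec_mul_vec_swap (u v : E8) :
    vec v * vec u = -(vec u * vec v) - (2 * inner ℝ u v : ℝ) • 1 := by
  have h := vec_mul_vec_add_swap u v
  rw [Algebra.algebraMap_eq_smul_one, neg_mul, neg_smul] at h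
  rw [← sub_eq_zero] at h ⊢
  rw [← h]
  abel

theorem wedge_of_inner_eq_zero {u v : E8} (h : inner ℝ u v = 0) : wedge u v = vec u * vec v := by
  rw [wedge, h, zero_smul, add_zero]

/-- The action of `Cℓ₈` on the positive spinors: the upper left block of the spin
representation. -/
noncomputable def halfSpin : Cl8 →ₗ[ℝ] Matrix (Fin 8) (Fin 8) ℝ where
  toFun x := (spinRep x).toBlocks₁₁
  map_add' x y := by rw [map_add]; rfl
  map_smul' c x := by rw [map_smul]; rfl

theorem halfSpin_vec_mul_vec (u v : E8) : halfSpin (vec u * vec v) = -(slash u * (slash v)ᵀ) := by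
  change (spinRep (vec u * vec v)).toBlocks₁₁ = _
  rw [spinRep_vec_mul_vec, Matrix.toBlocks_fromBlocks₁₁]

/-- The bivector in `Cℓ₈` with given action on the positive spinors. -/
noncomputable def ofHalfSpin : Matrix (Fin 8) (Fin 8) ℝ →ₗ[ℝ] Cl8 where
  toFun X := (1 / 2 : ℝ) • ∑ k, ∑ l, bivec X k l • (e k * e l)
  map_add' X Y := by
    simp only [map_add, Matrix.add_apply, add_smul, Finset.sum_add_distrib, smul_add]
  map_smul' c X := by
    simp only [map_smul, Matrix.smul_apply, smul_eq_mul, RingHom.id_apply, Finset.smul_sum,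
      smul_smul, mul_left_comm c]

/-- A bivector is recovered linearly from its action on positive spinors. This yields both the
injectivity of the half-spin map on `G28` and the smoothness of its inverse. -/
theorem ofHalfSpin_neg_slash (u v : E8) : ofHalfSpin (-(slash u * (slash v)ᵀ)) = wedge u v := by
  have h : ∀ u v : E8, vec u * vec v = ∑ k, ∑ l, (u k * v l) • (e k * e l) := by
    intro u v
    simp only [vec_eq_sum, Finset.sum_mul_sum, smul_mul_smul_comm]
  have h2 : ∑ k, ∑ l, bivec (-(slash u * (slash v)ᵀ)) k l • (e k * e l) =
      vec u * vec v - vec v * vec u := by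
    rw [h, h]
    simp only [← Finset.sum_sub_distrib, ← sub_smul, bivec_neg_slash, mul_comm]
  change (1 / 2 : ℝ) • ∑ k, ∑ l, bivec (-(slash u * (slash v)ᵀ)) k l • (e k * e l) = _
  rw [h2, vec_mul_vec_swap u v, wedge]
  module

/-- The matrix form of the Clifford identity by which `aua` is, up to sign and the factor `|a|²`,
the reflection of `u` in the hyperplane orthogonal to `a`. -/
theorem slash_mul_transpose_mul (a u : E8) : slash a * (slash u)ᵀ * slash a =
    slash ((2 * inner ℝ a u : ℝ) • a - (inner ℝ a a : ℝ) • u) := by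
  rw [eq_sub_of_add_eq (slash_mul_transpose_add a u), sub_mul, Matrix.mul_assoc,
    slash_transpose_mul_self]
  simp

/-! ### Embedded submanifolds of vector spaces with projective charts -/

open Topology in
/-- A parametrization of an open piece of a subset `j : S → E` of a vector space, with inverse the
quotient of two linear maps. -/
structure ProjChart {S E : Type*} [TopologicalSpace S] [NormedAddCommGroup E] [NormedSpace ℝ E]
    (j : S → E) (F : Type*) [NormedAddCommGroup F] [NormedSpace ℝ F] where
  den : E →L[ℝ] ℝ
  num : E →L[ℝ] F
  sec : F →L[ℝ] E
  param : F → S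
  contDiff_param : ContDiff ℝ ∞ (j ∘ param)
  den_param : ∀ y, 0 < den (j (param y))
  num_param : ∀ y, num (j (param y)) = den (j (param y)) • y
  param_num : ∀ s, 0 < den (j s) → param ((den (j s))⁻¹ • num (j s)) = s
  -- The section splits `E` as the image of `sec` plus the kernel of `num`. As `den` vanishes on
  -- that image, the denominator depends only on the second component, which makes the ambient chart
  -- explicitly invertible.
  num_sec : ∀ y, num (sec y) = y
  den_sec : ∀ y, den (sec y) = 0

namespace ProjChart

variable {S E : Type*} [TopologicalSpace S] [NormedAddCommGroup E] [NormedSpace ℝ E]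
  {j : S → E} {F : Type*} [NormedAddCommGroup F] [NormedSpace ℝ F]

/-- The chart inverse to a parametrization. -/
noncomputable def chart (c : ProjChart j F) (hj : Topology.IsEmbedding j) :
    OpenPartialHomeomorph S F where
  toFun s := (c.den (j s))⁻¹ • c.num (j s)
  invFun := c.param
  source := {s | 0 < c.den (j s)}
  target := Set.univ
  map_source' _ _ := Set.mem_univ _
  map_target' y _ := c.den_param y
  left_inv' s hs := c.param_num s hs
  right_inv' y _ := by
    rw [c.num_param, smul_smul, inv_mul_cancel₀ (c.den_param y).ne', one_smul]
  open_source := isOpen_lt continuous_const (c.den.continuous.comp hj.continuous)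
  open_target := isOpen_univ
  continuousOn_toFun := by
    have h1 : Continuous fun s => c.den (j s) := c.den.continuous.comp hj.continuous
    have h2 : Continuous fun s => c.num (j s) := c.num.continuous.comp hj.continuous
    exact (h1.continuousOn.inv₀ fun s hs => ne_of_gt hs).smul h2.continuousOn
  continuousOn_invFun := (hj.continuous_iff.2 c.contDiff_param.continuous).continuousOn

/-- The charted space structure given by projective charts. -/
@[reducible]
noncomputable def chartedSpace (c : S → ProjChart j F) (hj : Topology.IsEmbedding j)
    (hc : ∀ s, 0 < (c s).den (j s)) : ChartedSpace F S where
  atlas := Set.range fun s => (c s).chart hj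
  chartAt s := (c s).chart hj
  mem_chart_source s := hc s
  chart_mem_atlas s := ⟨s, rfl⟩

/-- The component of an ambient vector along the kernel of the chart's numerator. -/
noncomputable def ver (c : ProjChart j F) : E →L[ℝ] E := ContinuousLinearMap.id ℝ E - c.sec ∘L c.num

theorem ver_apply (c : ProjChart j F) (x : E) : c.ver x = x - c.sec (c.num x) := rfl

theorem num_ver (c : ProjChart j F) (x : E) : c.num (c.ver x) = 0 := by
  rw [ver_apply, map_sub, c.num_sec, sub_self]

theorem den_ver (c : ProjChart j F) (x : E) : c.den (c.ver x) = c.den x := by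
  rw [ver_apply, map_sub, c.den_sec, sub_zero]

theorem ver_sec (c : ProjChart j F) (y : F) : c.ver (c.sec y) = 0 := by
  rw [ver_apply, c.num_sec, sub_self]

theorem ver_ver (c : ProjChart j F) (x : E) : c.ver (c.ver x) = c.ver x := by
  rw [ver_apply, num_ver, map_zero, sub_zero]

/-- The ambient chart in which the submanifold becomes a linear subspace. -/
noncomputable def ambient (c : ProjChart j F) : OpenPartialHomeomorph E E where
  -- The `sec` component is the affine coordinate of `x`; the kernel component is the deviation of
  -- `x` from the submanifold point with that coordinate. On the submanifold the deviation is zero,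
  -- so its image lies in the range of `sec`.
  toFun x := c.sec ((c.den x)⁻¹ • c.num x) +
    (c.ver x - c.ver (j (c.param ((c.den x)⁻¹ • c.num x))))
  -- Undoing the shift gives the kernel part of `x`. Its denominator is then `c.den z + c.den (j
  -- (c.param (c.num z)))`, and multiplying the affine coordinate by it restores `c.num x`.
  invFun z := c.ver z + c.ver (j (c.param (c.num z))) +
    (c.den z + c.den (j (c.param (c.num z)))) • c.sec (c.num z)
  source := {x | 0 < c.den x}
  target := {z | 0 < c.den z + c.den (j (c.param (c.num z)))}
  map_source' x hx := by
    simpa only [Set.mem_ofPred_eq, map_add, map_sub, c.den_sec, c.num_sec, c.num_ver, c.den_ver,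
      zero_add, sub_zero, add_zero, sub_add_cancel] using hx
  map_target' z hz := by
    simpa only [Set.mem_ofPred_eq, map_add, map_smul, c.den_ver, c.den_sec, smul_zero, add_zero]
      using hz
  left_inv' x hx := by
    have hx' : c.den x ≠ 0 := ne_of_gt hx
    simp only [map_add, map_sub, map_smul, c.den_sec, c.num_sec, c.num_ver, c.den_ver,
      zero_add, sub_zero, add_zero, sub_add_cancel, c.ver_ver, c.ver_sec, smul_zero, smul_smul,
      mul_inv_cancel₀ hx', one_smul]
    rw [ver_apply, sub_add_cancel]
  right_inv' z hz := by
    have hz' : c.den z + c.den (j (c.param (c.num z))) ≠ 0 := ne_of_gt hz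
    simp only [map_add, map_smul, c.den_ver, c.den_sec, c.num_sec, c.num_ver, smul_zero,
      zero_add, add_zero, smul_smul, inv_mul_cancel₀ hz', one_smul, c.ver_ver, c.ver_sec,
      add_sub_cancel_right]
    rw [ver_apply, add_sub_cancel]
  open_source := isOpen_lt continuous_const c.den.continuous
  open_target := isOpen_lt continuous_const (c.den.continuous.add
    (c.den.continuous.comp (c.contDiff_param.continuous.comp c.num.continuous)))
  continuousOn_toFun := by
    have h : ContinuousOn (fun x => (c.den x)⁻¹ • c.num x) {x | 0 < c.den x} :=
      (c.den.continuous.continuousOn.inv₀ fun s hs => ne_of_gt hs).smul c.num.continuous.continuousOn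
    have h2 := c.contDiff_param.continuous
    exact (c.sec.continuous.comp_continuousOn h).add (c.ver.continuous.continuousOn.sub
      (c.ver.continuous.comp_continuousOn (h2.comp_continuousOn h)))
  continuousOn_invFun := by
    have h2 := c.contDiff_param.continuous.comp c.num.continuous
    exact ((c.ver.continuous.add (c.ver.continuous.comp h2)).add
      ((c.den.continuous.add (c.den.continuous.comp h2)).smul
        (c.sec.continuous.comp c.num.continuous))).continuousOn

theorem contDiffOn_quotient (c : ProjChart j F) :
    ContDiffOn ℝ ∞ (fun x => (c.den x)⁻¹ • c.num x) {x | 0 < c.den x} :=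
  (c.den.contDiff.contDiffOn.inv fun _ hx => ne_of_gt hx).smul c.num.contDiff.contDiffOn

theorem ambient_mem_maximalAtlas (c : ProjChart j F) :
    c.ambient ∈ IsManifold.maximalAtlas 𝓘(ℝ, E) ∞ E := by
  refine StructureGroupoid.mem_maximalAtlas_of_mem_groupoid _ ?_
  rw [contDiffGroupoid, mem_groupoid_of_pregroupoid]
  constructor
  · change ContDiffOn ℝ ∞ (fun x => c.sec ((c.den x)⁻¹ • c.num x) +
      (c.ver x - c.ver (j (c.param ((c.den x)⁻¹ • c.num x))))) _
    refine ContDiffOn.mono (s := {x | 0 < c.den x}) ?_ (fun x hx => hx.1)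
    exact (c.sec.contDiff.comp_contDiffOn c.contDiffOn_quotient).add (c.ver.contDiff.contDiffOn.sub
      (c.ver.contDiff.comp_contDiffOn (c.contDiff_param.comp_contDiffOn c.contDiffOn_quotient)))
  · change ContDiffOn ℝ ∞ (fun z => c.ver z + c.ver (j (c.param (c.num z))) +
      (c.den z + c.den (j (c.param (c.num z)))) • c.sec (c.num z)) _
    have h2 := c.contDiff_param.comp c.num.contDiff
    exact ((c.ver.contDiff.add (c.ver.contDiff.comp h2)).add
      ((c.den.contDiff.add (c.den.contDiff.comp h2)).smul
        (c.sec.contDiff.comp c.num.contDiff))).contDiffOn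

variable {d : ℕ}

theorem isManifold (c : S → ProjChart j (EuclideanSpace ℝ (Fin d))) (hj : Topology.IsEmbedding j)
    (hc : ∀ s, 0 < (c s).den (j s)) :
    letI := chartedSpace c hj hc
    IsManifold (𝓡 d) ∞ S := by
  let _ := chartedSpace c hj hc
  refine isManifold_of_contDiffOn _ _ _ ?_
  rintro _ _ ⟨s, rfl⟩ ⟨t, rfl⟩
  -- A transition map is a smooth parametrization into the ambient space followed by a quotient of
  -- linear maps, smooth wherever the denominator is positive.
  change ContDiffOn ℝ ∞ (fun y => ((c t).den (j ((c s).param y)))⁻¹ • (c t).num (j ((c s).param y))) _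
  refine (c t).contDiffOn_quotient.comp (c s).contDiff_param.contDiffOn ?_
  intro y hy
  exact hy.1.2

theorem finrank_ker (c : ProjChart j (EuclideanSpace ℝ (Fin d))) [FiniteDimensional ℝ E] :
    Module.finrank ℝ (LinearMap.ker c.num.toLinearMap) = Module.finrank ℝ E - d := by
  have h := LinearMap.finrank_range_add_finrank_ker c.num.toLinearMap
  have hs : Function.Surjective c.num.toLinearMap := fun y => ⟨c.sec y, c.num_sec y⟩
  rw [LinearMap.range_eq_top.2 hs, finrank_top, finrank_euclideanSpace_fin] at h
  omega

/-- In the chart of `S` and the ambient chart the inclusion becomes `c.sec`, the inclusion of the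
first factor of `E` = image of `sec` ⊕ kernel of `num`. The complement has dimension `finrank E - d`
by rank-nullity. -/
theorem isSmoothEmbedding {E : Type} [NormedAddCommGroup E] [NormedSpace ℝ E]
    {j : S → E} [FiniteDimensional ℝ E] (c : S → ProjChart j (EuclideanSpace ℝ (Fin d)))
    (hj : Topology.IsEmbedding j) (hc : ∀ s, 0 < (c s).den (j s)) :
    letI := chartedSpace c hj hc
    Manifold.IsSmoothEmbedding (𝓡 d) 𝓘(ℝ, E) ∞ j := by
  let _ := chartedSpace c hj hc
  have := isManifold c hj hc
  refine ⟨⟨EuclideanSpace ℝ (Fin (Module.finrank ℝ E - d)), inferInstance, inferInstance,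
    fun s => ?_⟩, hj⟩
  let κ : EuclideanSpace ℝ (Fin (Module.finrank ℝ E - d)) ≃L[ℝ] LinearMap.ker (c s).num.toLinearMap :=
    ContinuousLinearEquiv.ofFinrankEq (by rw [finrank_ker, finrank_euclideanSpace_fin])
  let eqv : (EuclideanSpace ℝ (Fin d) × EuclideanSpace ℝ (Fin (Module.finrank ℝ E - d))) ≃ₗ[ℝ] E :=
    { toFun := fun p => (c s).sec p.1 + (κ p.2 : E)
      invFun := fun x => ((c s).num x, κ.symm ⟨(c s).ver x, (c s).num_ver x⟩)
      map_add' := fun p q => by simp only [Prod.fst_add, Prod.snd_add, map_add, Submodule.coe_add]; abel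
      map_smul' := fun r p => by simp
      left_inv := fun p => by
        have h : (c s).num (κ p.2 : E) = 0 := (κ p.2).2
        ext1
        · simp [h, (c s).num_sec]
        · apply κ.injective
          ext1
          simp [(c s).ver_sec, (c s).ver_apply (κ p.2 : E), h]
      right_inv := fun x => by simp [(c s).ver_apply] }
  refine Manifold.IsImmersionAtOfComplement.mk_of_charts eqv.toContinuousLinearEquiv
    ((c s).chart hj) (c s).ambient (hc s) (hc s)
    (IsManifold.subset_maximalAtlas ⟨s, rfl⟩) (c s).ambient_mem_maximalAtlas (fun t ht => ht) ?_
  intro y _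
  have h : ((c s).den (j ((c s).param y)))⁻¹ • (c s).num (j ((c s).param y)) = y := by
    rw [(c s).num_param, smul_smul, inv_mul_cancel₀ ((c s).den_param y).ne', one_smul]
  change (c s).sec (((c s).den (j ((c s).param y)))⁻¹ • (c s).num (j ((c s).param y))) +
    ((c s).ver (j ((c s).param y)) - (c s).ver (j ((c s).param
      (((c s).den (j ((c s).param y)))⁻¹ • (c s).num (j ((c s).param y)))))) =
    (c s).sec y + (κ 0 : E)
  rw [h, sub_self, map_zero]
  rfl

end ProjChart

/-! ### Real forms of complex matrices -/

/-- The index of the real or imaginary part of a complex coordinate. -/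
def pairEquiv : Fin 4 × Fin 2 ≃ Fin 8 := finProdFinEquiv

/-- A complex `4 × 4` matrix as a real `8 × 8` matrix. -/
noncomputable def realForm : Matrix (Fin 4) (Fin 4) ℂ →+* Matrix (Fin 8) (Fin 8) ℝ :=
  ((Matrix.reindexRingEquiv ℝ pairEquiv).toRingHom.comp
    (Matrix.compRingEquiv (Fin 4) (Fin 2) ℝ).toRingHom).comp
    (Algebra.leftMulMatrix Complex.basisOneI).toRingHom.mapMatrix

theorem realForm_apply (U : Matrix (Fin 4) (Fin 4) ℂ) (i j : Fin 4) (a b : Fin 2) :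
    realForm U (pairEquiv (i, a)) (pairEquiv (j, b)) =
      !![(U i j).re, -(U i j).im; (U i j).im, (U i j).re] a b := by
  rw [← Algebra.leftMulMatrix_complex]
  simp [realForm, Matrix.comp_apply]

theorem matrix8_ext {X Y : Matrix (Fin 8) (Fin 8) ℝ}
    (h : ∀ (i j : Fin 4) (a b : Fin 2), X (pairEquiv (i, a)) (pairEquiv (j, b)) =
      Y (pairEquiv (i, a)) (pairEquiv (j, b))) : X = Y := by
  ext i j
  obtain ⟨⟨i, a⟩, rfl⟩ := pairEquiv.surjective i
  obtain ⟨⟨j, b⟩, rfl⟩ := pairEquiv.surjective j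
  exact h i j a b

theorem realForm_injective : Function.Injective realForm := by
  intro U V h
  ext i j
  have h2 := fun a => congrFun (congrFun h (pairEquiv (i, a))) (pairEquiv (j, 0))
  simp only [realForm_apply] at h2
  exact Complex.ext (by simpa using h2 0) (by simpa using h2 1)

theorem realForm_conjTranspose (U : Matrix (Fin 4) (Fin 4) ℂ) :
    realForm Uᴴ = (realForm U)ᵀ := by
  refine matrix8_ext fun i j a b => ?_
  rw [Matrix.transpose_apply, realForm_apply, realForm_apply]
  fin_cases a <;> fin_cases b <;> simp

theorem continuous_realForm : Continuous realForm := by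
  refine continuous_matrix fun i j => ?_
  obtain ⟨⟨i, a⟩, rfl⟩ := pairEquiv.surjective i
  obtain ⟨⟨j, b⟩, rfl⟩ := pairEquiv.surjective j
  simp only [realForm_apply]
  have h1 : Continuous fun U : Matrix (Fin 4) (Fin 4) ℂ => (U i j).re :=
    Complex.continuous_re.comp (continuous_id.matrix_elem i j)
  have h2 : Continuous fun U : Matrix (Fin 4) (Fin 4) ℂ => (U i j).im :=
    Complex.continuous_im.comp (continuous_id.matrix_elem i j)
  fin_cases a <;> fin_cases b <;> simpa using by first | exact h1 | exact h2 | exact h2.neg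

theorem det_realForm (U : Matrix (Fin 4) (Fin 4) ℂ) :
    (realForm U).det = Complex.normSq U.det := by
  have h := Matrix.det_det (M := U) (Algebra.leftMulMatrix Complex.basisOneI).toRingHom
  refine (Matrix.det_reindex_self pairEquiv _).trans (h.symm.trans ?_)
  change (Algebra.leftMulMatrix Complex.basisOneI U.det).det = _
  rw [Algebra.leftMulMatrix_complex, Matrix.det_fin_two, Complex.normSq_apply]
  simp

/-- The standard complex structure on `ℝ⁸`. -/
noncomputable def stdJ : Matrix (Fin 8) (Fin 8) ℝ := realForm (Complex.I • 1)

theorem stdJ_apply (i j : Fin 4) (a b : Fin 2) :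
    stdJ (pairEquiv (i, a)) (pairEquiv (j, b)) =
      if i = j then !![0, -1; 1, 0] a b else 0 := by
  rw [stdJ, realForm_apply, Matrix.smul_apply, Matrix.one_apply]
  split_ifs <;> fin_cases a <;> fin_cases b <;> simp

theorem stdJ_mul_self : stdJ * stdJ = -1 := by
  rw [stdJ, ← map_mul, smul_mul_smul_comm, Complex.I_mul_I, one_mul, neg_one_smul, map_neg, map_one]

theorem stdJ_transpose : stdJᵀ = -stdJ := by
  rw [stdJ, ← realForm_conjTranspose, Matrix.conjTranspose_smul, Matrix.conjTranspose_one,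
    Complex.star_def, Complex.conj_I, neg_smul, map_neg]

theorem det_stdJ : stdJ.det = 1 := by
  rw [stdJ, det_realForm]
  simp

theorem sum_pairEquiv (f : Fin 8 → ℝ) :
    ∑ k, f k = ∑ i : Fin 4, (f (pairEquiv (i, 0)) + f (pairEquiv (i, 1))) := by
  rw [← pairEquiv.sum_comp, Fintype.sum_prod_type]
  simp

theorem stdJ_mul_apply (X : Matrix (Fin 8) (Fin 8) ℝ) (i : Fin 4) (k : Fin 8) :
    (stdJ * X) (pairEquiv (i, 0)) k = -X (pairEquiv (i, 1)) k ∧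
      (stdJ * X) (pairEquiv (i, 1)) k = X (pairEquiv (i, 0)) k := by
  constructor <;> rw [Matrix.mul_apply, sum_pairEquiv] <;> simp [stdJ_apply]

theorem mul_stdJ_apply (X : Matrix (Fin 8) (Fin 8) ℝ) (i : Fin 4) (k : Fin 8) :
    (X * stdJ) k (pairEquiv (i, 0)) = X k (pairEquiv (i, 1)) ∧
      (X * stdJ) k (pairEquiv (i, 1)) = -X k (pairEquiv (i, 0)) := by
  constructor <;> rw [Matrix.mul_apply, sum_pairEquiv] <;> simp [stdJ_apply]

theorem exists_realForm_eq {X : Matrix (Fin 8) (Fin 8) ℝ} (h : X * stdJ = stdJ * X) :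
    ∃ U, realForm U = X := by
  refine ⟨Matrix.of fun i j => ⟨X (pairEquiv (i, 0)) (pairEquiv (j, 0)),
    X (pairEquiv (i, 1)) (pairEquiv (j, 0))⟩, ?_⟩
  refine matrix8_ext fun i j a b => ?_
  have h1 := congrFun (congrFun h (pairEquiv (i, 0))) (pairEquiv (j, 0))
  have h2 := congrFun (congrFun h (pairEquiv (i, 1))) (pairEquiv (j, 0))
  rw [(mul_stdJ_apply _ _ _).1, (stdJ_mul_apply _ _ _).1] at h1
  rw [(mul_stdJ_apply _ _ _).1, (stdJ_mul_apply _ _ _).2] at h2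
  rw [realForm_apply]
  fin_cases a <;> fin_cases b <;> simp [h1, h2]

theorem realForm_mul_stdJ (U : Matrix (Fin 4) (Fin 4) ℂ) :
    realForm U * stdJ = stdJ * realForm U := by
  rw [stdJ, ← map_mul, ← map_mul]
  simp

/-- Matrices commuting with `stdJ` are complex linear, and their real determinant is the squared
modulus of the complex one. This is why the sign of a complex frame depends only on `J`. -/
theorem det_nonneg_of_commute {X : Matrix (Fin 8) (Fin 8) ℝ} (h : X * stdJ = stdJ * X) :
    0 ≤ X.det := by
  obtain ⟨U, rfl⟩ := exists_realForm_eq h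
  rw [det_realForm]
  exact Complex.normSq_nonneg _

/-! ### Adapted frames of orthogonal complex structures -/

theorem mem_SO8_iff (X : Matrix (Fin 8) (Fin 8) ℝ) :
    X ∈ Matrix.specialOrthogonalGroup (Fin 8) ℝ ↔ X * Xᵀ = 1 ∧ X.det = 1 := by
  rw [Matrix.mem_specialOrthogonalGroup_iff, Matrix.mem_orthogonalGroup_iff]

theorem complexFrame_apply (J : Matrix (Fin 8) (Fin 8) ℝ) (v : Fin 4 → Fin 8 → ℝ) (i : Fin 4) :
    complexFrame J v (pairEquiv (i, 0)) = v i ∧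
      complexFrame J v (pairEquiv (i, 1)) = J *ᵥ v i := by
  fin_cases i <;> exact ⟨rfl, rfl⟩

theorem transpose_eq_neg {J : Matrix (Fin 8) (Fin 8) ℝ} (h1 : J * Jᵀ = 1) (h2 : J * J = -1) :
    Jᵀ = -J := by
  have h3 : Jᵀ * J = 1 := mul_eq_one_comm.1 h1
  calc Jᵀ = -(Jᵀ * (J * J)) := by rw [h2, mul_neg, mul_one, neg_neg]
    _ = -J := by rw [← mul_assoc, h3, one_mul]

/-- The frame vectors are rows, so right multiplication by `J` applies `Jᵀ = -J` to them; in each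
pair this is exactly what `stdJ` does to the two rows. -/
theorem complexFrame_mul {J : Matrix (Fin 8) (Fin 8) ℝ} (h1 : J * Jᵀ = 1) (h2 : J * J = -1)
    (v : Fin 4 → Fin 8 → ℝ) : complexFrame J v * J = stdJ * complexFrame J v := by
  have hT := transpose_eq_neg h1 h2
  have hrow : ∀ a, (complexFrame J v * J) a = -(J *ᵥ complexFrame J v a) := by
    intro a
    rw [← Matrix.neg_mulVec, ← hT, Matrix.mulVec_transpose]
    rfl
  refine matrix8_ext fun i j a b => ?_
  fin_cases a
  · change (complexFrame J v * J) (pairEquiv (i, 0)) _ =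
      (stdJ * complexFrame J v) (pairEquiv (i, 0)) _
    rw [hrow, (stdJ_mul_apply _ _ _).1, (complexFrame_apply J v i).1, (complexFrame_apply J v i).2]
    rfl
  · change (complexFrame J v * J) (pairEquiv (i, 1)) _ =
      (stdJ * complexFrame J v) (pairEquiv (i, 1)) _
    rw [hrow, (stdJ_mul_apply _ _ _).2, (complexFrame_apply J v i).1, (complexFrame_apply J v i).2,
      Matrix.mulVec_mulVec, h2, Matrix.neg_mulVec, Matrix.one_mulVec, neg_neg]

theorem exists_adapted {J : Matrix (Fin 8) (Fin 8) ℝ} (hT : Jᵀ = -J) (k : ℕ) (hk : k ≤ 4) :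
    ∃ v : Fin k → Fin 8 → ℝ, (∀ i j, v i ⬝ᵥ v j = if i = j then 1 else 0) ∧
      ∀ i j, v i ⬝ᵥ J *ᵥ v j = 0 := by
  have hJ : ∀ x y : Fin 8 → ℝ, x ⬝ᵥ J *ᵥ y = -(y ⬝ᵥ J *ᵥ x) := by
    intro x y
    rw [Matrix.dotProduct_mulVec, ← Matrix.mulVec_transpose, hT, Matrix.neg_mulVec,
      neg_dotProduct, dotProduct_comm]
  have hself : ∀ x : Fin 8 → ℝ, x ⬝ᵥ J *ᵥ x = 0 := fun x => by linarith [hJ x x]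
  induction k with
  | zero => exact ⟨Fin.elim0, fun i => i.elim0, fun i => i.elim0⟩
  | succ k ih =>
    obtain ⟨v, hv1, hv2⟩ := ih (by omega)
    let f : (Fin 8 → ℝ) →ₗ[ℝ] (Fin k ⊕ Fin k → ℝ) :=
      Matrix.mulVecLin (Matrix.of (Sum.elim v fun i => J *ᵥ v i))
    -- Orthogonality to the `k` vectors chosen so far and to their images under `J` is `2k`
    -- equations in dimension 8, so for `k < 4` there is a nonzero solution.
    obtain ⟨w, hw, hw0⟩ := Submodule.exists_mem_ne_zero_of_ne_bot
      (LinearMap.ker_ne_bot_of_finrank_lt (f := f) (by simp; omega))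
    have hfw : ∀ i, f w i = 0 := fun i => congrFun hw i
    have h1 : ∀ i, v i ⬝ᵥ w = 0 := fun i => hfw (Sum.inl i)
    have h2 : ∀ i, w ⬝ᵥ J *ᵥ v i = 0 := fun i => (dotProduct_comm _ _).trans (hfw (Sum.inr i))
    have hpos : 0 < w ⬝ᵥ w := by
      have h3 : 0 ≤ w ⬝ᵥ w := Finset.sum_nonneg fun i _ => mul_self_nonneg _
      exact lt_of_le_of_ne h3 fun h => hw0 (dotProduct_self_eq_zero.1 h.symm)
    set c := (Real.sqrt (w ⬝ᵥ w))⁻¹ with hc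
    have hcc : c * c * (w ⬝ᵥ w) = 1 := by
      rw [hc, ← mul_inv, Real.mul_self_sqrt hpos.le, inv_mul_cancel₀ hpos.ne']
    refine ⟨Fin.snoc v (c • w), fun i j => ?_, fun i j => ?_⟩
    · induction i using Fin.lastCases with
      | last =>
        induction j using Fin.lastCases with
        | last => simp [← mul_assoc, hcc]
        | cast j => simp [dotProduct_comm w, h1, (Fin.castSucc_lt_last j).ne']
      | cast i =>
        induction j using Fin.lastCases with
        | last => simp [h1, (Fin.castSucc_lt_last i).ne]
        | cast j => simp [hv1]
    · induction i using Fin.lastCases with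
      | last =>
        induction j using Fin.lastCases with
        | last => simp [Matrix.mulVec_smul, hself]
        | cast j => simp [h2]
      | cast i =>
        induction j using Fin.lastCases with
        | last => rw [hJ]; simp [h2]
        | cast j => simp [hv2]

theorem exists_orthogonal_complexFrame {J : Matrix (Fin 8) (Fin 8) ℝ} (h1 : J * Jᵀ = 1)
    (h2 : J * J = -1) : ∃ v, complexFrame J v * (complexFrame J v)ᵀ = 1 := by
  have hT := transpose_eq_neg h1 h2
  obtain ⟨v, hv1, hv2⟩ := exists_adapted hT 4 le_rfl
  have hJJ : ∀ x y : Fin 8 → ℝ, J *ᵥ x ⬝ᵥ J *ᵥ y = x ⬝ᵥ y := by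
    intro x y
    rw [Matrix.dotProduct_mulVec, ← Matrix.mulVec_transpose, hT, Matrix.mulVec_mulVec,
      neg_mul, h2, neg_neg, Matrix.one_mulVec]
  refine ⟨v, matrix8_ext fun i j a b => ?_⟩
  have happ : ∀ k l, (complexFrame J v * (complexFrame J v)ᵀ) k l =
      complexFrame J v k ⬝ᵥ complexFrame J v l := fun k l => rfl
  have hi := complexFrame_apply J v i
  have hj := complexFrame_apply J v j
  rw [happ, Matrix.one_apply]
  fin_cases a <;> fin_cases b <;>
    simp only [Fin.zero_eta, Fin.mk_one, hi, hj, hv1, hv2, hJJ, EmbeddingLike.apply_eq_iff_eq,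
      Prod.mk.injEq, and_true, and_false, if_false, one_ne_zero, zero_ne_one, dotProduct_comm _ (v j)]

theorem det_eq_or_of_mul_transpose {R : Matrix (Fin 8) (Fin 8) ℝ} (h : R * Rᵀ = 1) :
    R.det = 1 ∨ R.det = -1 := by
  have := congrArg Matrix.det h
  rw [Matrix.det_mul, Matrix.det_transpose, Matrix.det_one] at this
  exact mul_self_eq_one_iff.1 this

/-- The matrix `R` is an orthonormal complex frame of `J`. Transitivity of SO(8) on `M` and the
shape of the stabilizers both follow from this normal form. -/
theorem mem_M_iff (J : Matrix (Fin 8) (Fin 8) ℝ) :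
    J ∈ M ↔ ∃ R : Matrix (Fin 8) (Fin 8) ℝ, R * Rᵀ = 1 ∧ R.det = -1 ∧ J = Rᵀ * stdJ * R := by
  constructor
  · rintro ⟨hSO, h2, v, hv⟩
    have h1 := ((mem_SO8_iff J).1 hSO).1
    obtain ⟨w, hw⟩ := exists_orthogonal_complexFrame h1 h2
    have hw' := mul_eq_one_comm.1 hw
    have hwJ := complexFrame_mul h1 h2 w
    have hvJ := complexFrame_mul h1 h2 v
    refine ⟨complexFrame J w, hw, ?_, ?_⟩
    · refine (det_eq_or_of_mul_transpose hw).resolve_left fun hd => ?_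
      -- The change from the orthonormal frame to the given negative frame is complex linear and so
      -- has nonnegative determinant; were the orthonormal frame positive, the given one would not
      -- be negative.
      have hcomm : complexFrame J v * (complexFrame J w)ᵀ * stdJ =
          stdJ * (complexFrame J v * (complexFrame J w)ᵀ) := by
        have h3 : (complexFrame J w)ᵀ * stdJ = J * (complexFrame J w)ᵀ := by
          calc (complexFrame J w)ᵀ * stdJ = (complexFrame J w)ᵀ * (stdJ * complexFrame J w) *
                (complexFrame J w)ᵀ := by simp only [mul_assoc, hw, mul_one]
            _ = J * (complexFrame J w)ᵀ := by rw [← hwJ, ← mul_assoc, hw', one_mul]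
        rw [mul_assoc, h3, ← mul_assoc, hvJ, mul_assoc]
      have h4 := det_nonneg_of_commute hcomm
      rw [Matrix.det_mul, Matrix.det_transpose, hd, mul_one] at h4
      exact absurd hv h4.not_gt
    · rw [mul_assoc, ← hwJ, ← mul_assoc, hw', one_mul]
  · rintro ⟨R, hR, hd, rfl⟩
    have hR' := mul_eq_one_comm.1 hR
    have h1 : Rᵀ * stdJ * R * (Rᵀ * stdJ * R) = -1 := by
      calc Rᵀ * stdJ * R * (Rᵀ * stdJ * R) = Rᵀ * (stdJ * (R * Rᵀ) * stdJ) * R := by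
            simp only [mul_assoc]
        _ = -1 := by rw [hR, mul_one, stdJ_mul_self, mul_neg, neg_mul, mul_one, hR']
    have h2 : (Rᵀ * stdJ * R)ᵀ = -(Rᵀ * stdJ * R) := by
      simp only [Matrix.transpose_mul, Matrix.transpose_transpose, stdJ_transpose, mul_neg, neg_mul,
        mul_assoc]
    refine ⟨(mem_SO8_iff _).2 ⟨by rw [h2, mul_neg, h1, neg_neg], ?_⟩, h1,
      fun i => R (pairEquiv (i, 0)), ?_⟩
    · rw [Matrix.det_mul, Matrix.det_mul, Matrix.det_transpose, hd, det_stdJ]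
      norm_num
    · have h3 : complexFrame (Rᵀ * stdJ * R) (fun i => R (pairEquiv (i, 0))) = R := by
        refine matrix8_ext fun i j a b => ?_
        have hf := complexFrame_apply (Rᵀ * stdJ * R) (fun i => R (pairEquiv (i, 0))) i
        fin_cases a
        · exact congrFun hf.1 _
        · refine (congrFun hf.2 _).trans ?_
          have h4 : (Rᵀ * stdJ * R) *ᵥ R (pairEquiv (i, 0)) =
              -((R * (Rᵀ * stdJ * R)) (pairEquiv (i, 0))) := by
            rw [← neg_neg (Rᵀ * stdJ * R), ← h2, Matrix.neg_mulVec, Matrix.mulVec_transpose, h2,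
              neg_neg]
            rfl
          rw [h4, ← mul_assoc, ← mul_assoc, hR, one_mul, Pi.neg_apply, (stdJ_mul_apply _ _ _).1,
            neg_neg]
          rfl
      rw [h3, hd]
      norm_num

theorem conj_mem_M {J g : Matrix (Fin 8) (Fin 8) ℝ} (hJ : J ∈ M)
    (hg : g ∈ Matrix.specialOrthogonalGroup (Fin 8) ℝ) : g * J * gᵀ ∈ M := by
  obtain ⟨R, hR, hd, rfl⟩ := (mem_M_iff J).1 hJ
  obtain ⟨hg1, hg2⟩ := (mem_SO8_iff g).1 hg
  refine (mem_M_iff _).2 ⟨R * gᵀ, ?_, ?_, ?_⟩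
  · rw [Matrix.transpose_mul, Matrix.transpose_transpose, mul_assoc, ← mul_assoc gᵀ,
      mul_eq_one_comm.1 hg1, one_mul, hR]
  · rw [Matrix.det_mul, Matrix.det_transpose, hd, hg2, mul_one]
  · simp only [Matrix.transpose_mul, Matrix.transpose_transpose, mul_assoc]

theorem exists_conj_eq {J K : Matrix (Fin 8) (Fin 8) ℝ} (hJ : J ∈ M) (hK : K ∈ M) :
    ∃ g ∈ Matrix.specialOrthogonalGroup (Fin 8) ℝ, g * J * gᵀ = K := by
  obtain ⟨R, hR, hRd, rfl⟩ := (mem_M_iff J).1 hJ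
  obtain ⟨S, hS, hSd, rfl⟩ := (mem_M_iff K).1 hK
  -- Both frames have determinant -1, so the orthogonal map from one to the other is a rotation.
  refine ⟨Sᵀ * R, (mem_SO8_iff _).2 ⟨?_, ?_⟩, ?_⟩
  · rw [Matrix.transpose_mul, Matrix.transpose_transpose, mul_assoc, ← mul_assoc R, hR, one_mul,
      mul_eq_one_comm.1 hS]
  · rw [Matrix.det_mul, Matrix.det_transpose, hRd, hSd]
    norm_num
  · calc Sᵀ * R * (Rᵀ * stdJ * R) * (Sᵀ * R)ᵀ = Sᵀ * ((R * Rᵀ) * stdJ * (R * Rᵀ)) * S := by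
          simp only [Matrix.transpose_mul, Matrix.transpose_transpose, mul_assoc]
      _ = Sᵀ * stdJ * S := by rw [hR, one_mul, mul_one]

/-! ### The homogeneous space `SO(8)/U(4)` -/

theorem isCompact_unitaryGroup {n 𝕜 : Type*} [Fintype n] [DecidableEq n] [RCLike 𝕜] :
    IsCompact (Matrix.unitaryGroup n 𝕜 : Set (Matrix n n 𝕜)) := by
  have hb : IsCompact (Set.univ.pi fun _ : n => Set.univ.pi fun _ : n =>
      Metric.closedBall (0 : 𝕜) 1) :=
    isCompact_univ_pi fun _ => isCompact_univ_pi fun _ => isCompact_closedBall 0 1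
  refine IsCompact.of_isClosed_subset hb ?_ ?_
  · have : (Matrix.unitaryGroup n 𝕜 : Set (Matrix n n 𝕜)) = {U | U * star U = 1} := by
      ext U
      exact Matrix.mem_unitaryGroup_iff
    rw [this]
    exact isClosed_eq (continuous_id.matrix_mul continuous_id.matrix_conjTranspose) continuous_const
  · intro U hU i _ j _
    rw [mem_closedBall_zero_iff]
    exact entry_norm_bound_of_unitary hU i j

theorem isCompact_SO8 : IsCompact (Matrix.specialOrthogonalGroup (Fin 8) ℝ :
    Set (Matrix (Fin 8) (Fin 8) ℝ)) := by
  refine IsCompact.of_isClosed_subset (isCompact_unitaryGroup (n := Fin 8) (𝕜 := ℝ)) ?_ ?_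
  · have : (Matrix.specialOrthogonalGroup (Fin 8) ℝ : Set (Matrix (Fin 8) (Fin 8) ℝ)) =
        {X | X * Xᵀ = 1} ∩ {X | X.det = 1} := by
      ext X
      rw [SetLike.mem_coe, mem_SO8_iff, Set.mem_inter_iff, Set.mem_ofPred_eq, Set.mem_ofPred_eq]
    rw [this]
    have h1 : Continuous fun X : Matrix (Fin 8) (Fin 8) ℝ => X * Xᵀ :=
      continuous_id.matrix_mul continuous_id.matrix_transpose
    have h2 : Continuous fun X : Matrix (Fin 8) (Fin 8) ℝ => X.det := continuous_id.matrix_det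
    exact (isClosed_singleton.preimage h1).inter (isClosed_singleton.preimage h2)
  · intro X hX
    refine Matrix.mem_unitaryGroup_iff.2 ?_
    have := ((mem_SO8_iff X).1 (SetLike.mem_coe.1 hX)).1
    rwa [Matrix.star_eq_conjTranspose, Matrix.conjTranspose_eq_transpose_of_trivial]

instance : CompactSpace (Matrix.unitaryGroup (Fin 4) ℂ) :=
  isCompact_iff_compactSpace.1 isCompact_unitaryGroup

instance : CompactSpace SO8 := isCompact_iff_compactSpace.1 isCompact_SO8

theorem mem_commutingRotations (J : M) (g : SO8) :
    g ∈ commutingRotations J ↔ g.1 * J.1 = J.1 * g.1 := by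
  rw [commutingRotations, Subgroup.mem_centralizer_singleton_iff, Subtype.ext_iff]
  constructor <;> intro h
  · exact h
  · exact h

theorem SO8.mul_transpose (g : SO8) : g.1 * g.1ᵀ = 1 := ((mem_SO8_iff g.1).1 g.2).1

theorem SO8.transpose_mul (g : SO8) : g.1ᵀ * g.1 = 1 := mul_eq_one_comm.1 g.mul_transpose

/-- The action of `SO(8)` on orthogonal complex structures, by conjugation. -/
def conjM (J : M) (g : SO8) : M := ⟨g.1 * J.1 * g.1ᵀ, conj_mem_M J.2 g.2⟩

theorem SO8.coe_inv (g : SO8) : (g⁻¹ : SO8).1 = g.1ᵀ := by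
  have h : (g⁻¹ : SO8).1 * g.1 = 1 := congrArg Subtype.val (inv_mul_cancel g)
  calc (g⁻¹ : SO8).1 = (g⁻¹ : SO8).1 * (g.1 * g.1ᵀ) := by rw [g.mul_transpose, mul_one]
    _ = g.1ᵀ := by rw [← mul_assoc, h, one_mul]

theorem conjM_eq_iff (J : M) (g h : SO8) :
    conjM J g = conjM J h ↔ g⁻¹ * h ∈ commutingRotations J := by
  rw [mem_commutingRotations, Subtype.ext_iff, Submonoid.coe_mul, SO8.coe_inv]
  change g.1 * J.1 * g.1ᵀ = h.1 * J.1 * h.1ᵀ ↔ _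
  constructor
  · intro H
    calc g.1ᵀ * h.1 * J.1 = g.1ᵀ * (h.1 * J.1 * h.1ᵀ) * h.1 := by
          simp only [mul_assoc, h.transpose_mul, mul_one]
      _ = J.1 * (g.1ᵀ * h.1) := by
          rw [← H]
          simp only [← mul_assoc, g.transpose_mul, one_mul]
  · intro H
    calc g.1 * J.1 * g.1ᵀ = g.1 * (J.1 * (g.1ᵀ * h.1)) * h.1ᵀ := by
          simp only [mul_assoc, h.mul_transpose, mul_one]
      _ = h.1 * J.1 * h.1ᵀ := by
          rw [← H]
          simp only [← mul_assoc, g.mul_transpose, one_mul]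

theorem continuous_conjM (J : M) : Continuous (conjM J) :=
  Continuous.subtype_mk ((continuous_subtype_val.matrix_mul continuous_const).matrix_mul
    continuous_subtype_val.matrix_transpose) _

/-- The orbit map descends to a continuous bijection from a compact space to a Hausdorff space,
hence a homeomorphism. -/
theorem exists_homeomorph_quotient (J : M) : ∃ h : (SO8 ⧸ commutingRotations J) ≃ₜ M, ∀ g : SO8,
    (h (QuotientGroup.mk g) : Matrix (Fin 8) (Fin 8) ℝ) = g.1 * J.1 * g.1ᵀ := by
  let f : SO8 ⧸ commutingRotations J → M := Quotient.lift (conjM J) fun a b hab =>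
    (conjM_eq_iff J a b).2 (QuotientGroup.leftRel_apply.1 hab)
  have hf : Continuous f := (continuous_conjM J).quotient_lift _
  have hb : Function.Bijective f := by
    constructor
    · intro a b
      induction a using QuotientGroup.induction_on with | _ a => ?_
      induction b using QuotientGroup.induction_on with | _ b => ?_
      intro hab
      exact QuotientGroup.eq.2 ((conjM_eq_iff J a b).1 hab)
    · intro K
      obtain ⟨g, hg, h⟩ := exists_conj_eq J.2 K.2
      exact ⟨QuotientGroup.mk ⟨g, hg⟩, Subtype.ext h⟩
  have : CompactSpace (SO8 ⧸ commutingRotations J) := Quotient.compactSpace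
  exact ⟨Continuous.homeoOfEquivCompactToT2 (f := Equiv.ofBijective f hb) hf, fun g => rfl⟩

/-- Conjugation by an orthonormal complex frame `R` carries the commutant of `J` to that of `stdJ`,
the real forms of complex matrices. Orthogonal becomes unitary, and the determinant condition is
automatic: it is ±1 and nonnegative. -/
theorem nonempty_commutingRotations_equiv (J : M) :
    Nonempty (commutingRotations J ≃ₜ* Matrix.unitaryGroup (Fin 4) ℂ) := by
  obtain ⟨R, hR, hd, hJ⟩ := (mem_M_iff J.1).1 J.2
  have hR' : Rᵀ * R = 1 := mul_eq_one_comm.1 hR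
  have hRJ : R * J.1 = stdJ * R := by rw [hJ, ← mul_assoc, ← mul_assoc, hR, one_mul]
  have hJR : J.1 * Rᵀ = Rᵀ * stdJ := by rw [hJ, mul_assoc, hR, mul_one]
  have hunit : ∀ U : Matrix (Fin 4) (Fin 4) ℂ, realForm U * (realForm U)ᵀ = 1 ↔
      U ∈ Matrix.unitaryGroup (Fin 4) ℂ := by
    intro U
    rw [Matrix.mem_unitaryGroup_iff, Matrix.star_eq_conjTranspose, ← realForm_conjTranspose,
      ← map_mul, ← map_one realForm, realForm_injective.eq_iff]
  have hdet : ∀ U : Matrix (Fin 4) (Fin 4) ℂ, realForm U * (realForm U)ᵀ = 1 →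
      (realForm U).det = 1 := by
    intro U hU
    refine (det_eq_or_of_mul_transpose hU).resolve_right fun h => ?_
    have := det_nonneg_of_commute (realForm_mul_stdJ U)
    rw [h] at this
    norm_num at this
  have hSO : ∀ U : Matrix.unitaryGroup (Fin 4) ℂ,
      Rᵀ * realForm U.1 * R ∈ Matrix.specialOrthogonalGroup (Fin 8) ℝ := by
    intro U
    have hU := (hunit U.1).2 U.2
    refine (mem_SO8_iff _).2 ⟨?_, ?_⟩
    · calc Rᵀ * realForm U.1 * R * (Rᵀ * realForm U.1 * R)ᵀ =
            Rᵀ * (realForm U.1 * (R * Rᵀ) * (realForm U.1)ᵀ) * R := by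
            simp only [Matrix.transpose_mul, Matrix.transpose_transpose, mul_assoc]
        _ = 1 := by rw [hR, mul_one, hU, mul_one, hR']
    · rw [Matrix.det_mul, Matrix.det_mul, Matrix.det_transpose, hd, hdet _ hU]
      norm_num
  have hcomm : ∀ U : Matrix.unitaryGroup (Fin 4) ℂ,
      (⟨_, hSO U⟩ : SO8) ∈ commutingRotations J := by
    intro U
    rw [mem_commutingRotations]
    change Rᵀ * realForm U.1 * R * J.1 = J.1 * (Rᵀ * realForm U.1 * R)
    rw [mul_assoc, hRJ, ← mul_assoc J.1, ← mul_assoc J.1, hJR, ← mul_assoc, mul_assoc Rᵀ,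
      realForm_mul_stdJ, ← mul_assoc]
  let φ : Matrix.unitaryGroup (Fin 4) ℂ →* commutingRotations J :=
    { toFun := fun U => ⟨⟨_, hSO U⟩, hcomm U⟩
      map_one' := by
        refine Subtype.ext (Subtype.ext ?_)
        change Rᵀ * realForm 1 * R = 1
        rw [map_one, mul_one, hR']
      map_mul' := fun U V => by
        refine Subtype.ext (Subtype.ext ?_)
        change Rᵀ * realForm (U.1 * V.1) * R = Rᵀ * realForm U.1 * R * (Rᵀ * realForm V.1 * R)
        calc Rᵀ * realForm (U.1 * V.1) * R = Rᵀ * (realForm U.1 * (R * Rᵀ) * realForm V.1) * R := by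
              rw [hR, mul_one, map_mul]
          _ = _ := by simp only [mul_assoc] }
  have hφ : Function.Bijective φ := by
    constructor
    · intro U V h
      have h2 : Rᵀ * realForm U.1 * R = Rᵀ * realForm V.1 * R :=
        congrArg (fun g : commutingRotations J => g.1.1) h
      refine Subtype.ext (realForm_injective ?_)
      have h3 : ∀ X, X = R * (Rᵀ * X * R) * Rᵀ := by
        intro X
        calc X = (R * Rᵀ) * X * (R * Rᵀ) := by rw [hR, one_mul, mul_one]
          _ = _ := by simp only [mul_assoc]
      rw [h3 (realForm U.1), h2, ← h3]
    · rintro ⟨g, hg⟩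
      rw [mem_commutingRotations] at hg
      have hX : R * g.1 * Rᵀ * stdJ = stdJ * (R * g.1 * Rᵀ) := by
        rw [mul_assoc, ← hJR, ← mul_assoc, mul_assoc R, hg, ← mul_assoc, hRJ]
        simp only [mul_assoc]
      obtain ⟨U, hU⟩ := exists_realForm_eq hX
      have hUU : U ∈ Matrix.unitaryGroup (Fin 4) ℂ := by
        rw [← hunit, hU]
        calc R * g.1 * Rᵀ * (R * g.1 * Rᵀ)ᵀ = R * (g.1 * (Rᵀ * R) * g.1ᵀ) * Rᵀ := by
              simp only [Matrix.transpose_mul, Matrix.transpose_transpose, mul_assoc]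
          _ = 1 := by rw [hR', mul_one, g.mul_transpose, mul_one, hR]
      refine ⟨⟨U, hUU⟩, Subtype.ext (Subtype.ext ?_)⟩
      change Rᵀ * realForm U * R = g.1
      rw [hU]
      calc Rᵀ * (R * g.1 * Rᵀ) * R = (Rᵀ * R) * g.1 * (Rᵀ * R) := by simp only [mul_assoc]
        _ = g.1 := by rw [hR', one_mul, mul_one]
  have hcont : Continuous φ := by
    refine Continuous.subtype_mk (Continuous.subtype_mk ?_ _) _
    exact (continuous_const.matrix_mul (continuous_realForm.comp continuous_subtype_val)).matrix_mul
      continuous_const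
  let ψ := MulEquiv.ofBijective φ hφ
  exact ⟨({ ψ with
    continuous_toFun := hcont
    continuous_invFun := (Continuous.homeoOfEquivCompactToT2 (f := ψ.toEquiv) hcont).symm.continuous } :
    Matrix.unitaryGroup (Fin 4) ℂ ≃ₜ* commutingRotations J).symm⟩

/-! ### Triality: bimultiplications by unit vectors -/

/-- The signs of the conjugation `x ↦ x̄` of the octonions. -/
def conjSgn (i : Fin 8) : ℤ := if i = 0 then 1 else -1

/-- The reflection in the real axis, `x ↦ -x̄`. -/
noncomputable def negConj : Matrix (Fin 8) (Fin 8) ℝ := Matrix.diagonal fun i => -(conjSgn i : ℝ)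

theorem negConj_mul_self : negConj * negConj = 1 := by
  rw [negConj, Matrix.diagonal_mul_diagonal, ← Matrix.diagonal_one]
  congr 1
  ext i
  have : ∀ i, conjSgn i * conjSgn i = 1 := by decide
  rw [neg_mul_neg, ← Int.cast_mul, this, Int.cast_one]

theorem negConj_transpose : negConjᵀ = negConj := Matrix.diagonal_transpose _

/-- The reflection in the hyperplane orthogonal to a unit vector. -/
noncomputable def reflMatrix (a : E8) : Matrix (Fin 8) (Fin 8) ℝ :=
  (inner ℝ a a : ℝ) • 1 - (2 : ℝ) • Matrix.vecMulVec a a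

/-- Right multiplication by `a`, in terms of the gamma matrices. -/
noncomputable def rightMul : E8 →ₗ[ℝ] Matrix (Fin 8) (Fin 8) ℝ where
  toFun a := Matrix.of fun k n => (conjSgn n : ℝ) * (gamma n *ᵥ a) k
  map_add' a b := by
    ext k n
    simp [Matrix.mulVec_add, mul_add]
  map_smul' c a := by
    ext k n
    simp [Matrix.mulVec_smul, mul_left_comm]

theorem rightMul_mulVec_single (a : E8) (n : Fin 8) :
    rightMul a *ᵥ Pi.single n 1 = (conjSgn n : ℝ) • (gamma n *ᵥ a) := by
  ext k
  simp [rightMul]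

/-- The vector `conj (a · conj u)`, in terms of octonions. -/
noncomputable def twist (a u : E8) : E8 :=
  ∑ j, ∑ k, (a j * u k * ((conjSgn (j ^^^ k) * conjSgn k * conjSgn j * sgn j k : ℤ) : ℝ)) •
    EuclideanSpace.single (j ^^^ k) 1

/-- The Moufang identity is quadratic in `a`, so on basis vectors it is polarized: only the sum over
the two orders of `i`, `j` vanishes. Every term sends the basis vector `n` to a multiple of one
basis vector, which leaves an identity of signs. -/
theorem moufang_basis (i j k : Fin 8) :
    ((if i = j then (1 : ℝ) else 0) • 1 - (2 : ℝ) • Matrix.single i j 1) * negConj * gamma k -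
      ((conjSgn (j ^^^ k) * conjSgn k * conjSgn j * sgn j k : ℤ) : ℝ) •
        (gamma (j ^^^ k) * rightMul (EuclideanSpace.single i 1)) +
    (((if j = i then (1 : ℝ) else 0) • 1 - (2 : ℝ) • Matrix.single j i 1) * negConj * gamma k -
      ((conjSgn (i ^^^ k) * conjSgn k * conjSgn i * sgn i k : ℤ) : ℝ) •
        (gamma (i ^^^ k) * rightMul (EuclideanSpace.single j 1))) = 0 := by
  refine Matrix.ext_of_mulVec_single fun n => ?_
  have hs : ∀ i j k n : Fin 8,
      sgn k n * -conjSgn (k ^^^ n) * (if i = j then 1 else 0)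
        - 2 * (sgn k n * -conjSgn (k ^^^ n) * (if j = k ^^^ n then 1 else 0))
        - conjSgn (j ^^^ k) * conjSgn k * conjSgn j * sgn j k *
          (conjSgn n * sgn n i * sgn (j ^^^ k) (n ^^^ i))
        + (sgn k n * -conjSgn (k ^^^ n) * (if j = i then 1 else 0)
        - 2 * (sgn k n * -conjSgn (k ^^^ n) * (if i = k ^^^ n then 1 else 0))
        - conjSgn (i ^^^ k) * conjSgn k * conjSgn i * sgn i k *
          (conjSgn n * sgn n j * sgn (i ^^^ k) (n ^^^ j))) = 0 := by decide +kernel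
  have hx1 : ∀ i j k n : Fin 8, (i ^^^ k) ^^^ (n ^^^ j) = (j ^^^ k) ^^^ (n ^^^ i) := by
    decide +kernel
  have hx2 : ∀ i k n : Fin 8, (i ^^^ k) ^^^ (n ^^^ i) = k ^^^ n := by decide
  have hx3 : ∀ i k n : Fin 8, ((k ^^^ n) ^^^ k) ^^^ (n ^^^ i) = i := by decide
  have h := congrArg (Int.cast (R := ℝ)) (hs i j k n)
  push_cast at h
  have e1 : ∀ (i j : Fin 8) (c : ℝ), (if i = j then (1 : ℝ) else 0) • c •
      (Pi.single (k ^^^ n) 1 : Fin 8 → ℝ) =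
      (if i = j then (1 : ℝ) else 0) • c • Pi.single ((j ^^^ k) ^^^ (n ^^^ i)) 1 := by
    intro i j c
    split_ifs with hij
    · rw [hij, hx2]
    · rw [zero_smul, zero_smul]
  have e2 : ∀ i j : Fin 8, (Pi.single (k ^^^ n) (1 : ℝ) : Fin 8 → ℝ) j • (Pi.single i 1 : Fin 8 → ℝ)
      = (if j = k ^^^ n then (1 : ℝ) else 0) • Pi.single ((j ^^^ k) ^^^ (n ^^^ i)) 1 := by
    intro i j
    rw [Pi.single_apply]
    split_ifs with hij
    · rw [hij, hx3]
    · rw [zero_smul, zero_smul]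
  simp only [Matrix.add_mulVec, Matrix.sub_mulVec, ← Matrix.mulVec_mulVec, Matrix.smul_mulVec,
    Matrix.one_mulVec, gamma_mulVec_single, rightMul_mulVec_single, Matrix.mulVec_smul, negConj,
    Matrix.diagonal_mulVec_single, Matrix.single_mulVec_eq, PiLp.ofLp_single,
    Matrix.zero_mulVec]
  have hd : (Pi.single (k ^^^ n) (-(conjSgn (k ^^^ n) : ℝ) * 1) : Fin 8 → ℝ) =
      -(conjSgn (k ^^^ n) : ℝ) • Pi.single (k ^^^ n) 1 := by
    rw [← Pi.single_smul, smul_eq_mul]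
  simp only [hd, one_mul, Pi.smul_apply, smul_eq_mul, mul_smul, e2]
  rw [e1 i j, e1 j i, hx1 i j k n]
  simp only [smul_smul, ← add_smul, ← sub_smul]
  refine (congrArg (· • _) ?_).trans (zero_smul _ _)
  refine Eq.trans ?_ h
  push_cast
  ring

theorem slash_twist (a u : E8) : slash (twist a u) =
    ∑ j, ∑ k, (a j * u k * ((conjSgn (j ^^^ k) * conjSgn k * conjSgn j * sgn j k : ℤ) : ℝ)) •
      gamma (j ^^^ k) := by
  simp only [twist, map_sum, map_smul, slash_single]

/-- The Moufang identity `a(ux)a = (au)(xa)`. -/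
theorem moufang (a u : E8) :
    reflMatrix a * negConj * slash u = slash (twist a u) * rightMul a := by
  let X : Fin 8 → Fin 8 → Fin 8 → Matrix (Fin 8) (Fin 8) ℝ := fun i j k =>
    ((if i = j then (1 : ℝ) else 0) • 1 - (2 : ℝ) • Matrix.single i j 1) * negConj * gamma k -
      ((conjSgn (j ^^^ k) * conjSgn k * conjSgn j * sgn j k : ℤ) : ℝ) •
        (gamma (j ^^^ k) * rightMul (EuclideanSpace.single i 1))
  have hX : ∀ i j k, X i j k + X j i k = 0 := moufang_basis
  have ha : a = ∑ i, a i • EuclideanSpace.single i (1 : ℝ) := by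
    conv_lhs => rw [← (EuclideanSpace.basisFun (Fin 8) ℝ).sum_repr a]
    simp
  have hr : reflMatrix a = ∑ i, ∑ j, (a i * a j) •
      ((if i = j then (1 : ℝ) else 0) • 1 - (2 : ℝ) • Matrix.single i j 1) := by
    ext p q
    simp only [reflMatrix, Matrix.sub_apply, Matrix.smul_apply, Matrix.vecMulVec_apply,
      Matrix.sum_apply, smul_eq_mul, mul_sub, Finset.sum_sub_distrib, PiLp.inner_apply]
    congr 1
    · simp only [Finset.sum_mul, mul_ite, ite_mul, one_mul, zero_mul, mul_zero]
      simp [sq, mul_assoc]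
    · simp [Matrix.single_apply, ite_and, mul_comm]
  have hR : rightMul a = ∑ i, a i • rightMul (EuclideanSpace.single i 1) := by
    conv_lhs => rw [ha]
    simp only [map_sum, map_smul]
  have hsum : reflMatrix a * negConj * slash u - slash (twist a u) * rightMul a =
      ∑ i, ∑ j, ∑ k, (a i * a j * u k) • X i j k := by
    have h1 : reflMatrix a * negConj * slash u = ∑ i, ∑ j, ∑ k, (a i * a j * u k) •
        (((if i = j then (1 : ℝ) else 0) • 1 - (2 : ℝ) • Matrix.single i j 1) * negConj * gamma k) := by
      rw [hr, slash_apply]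
      simp only [Finset.sum_mul]
      refine Finset.sum_congr rfl fun i _ => Finset.sum_congr rfl fun j _ => ?_
      rw [Finset.mul_sum]
      refine Finset.sum_congr rfl fun k _ => ?_
      rw [smul_mul_assoc, smul_mul_assoc, mul_smul_comm, smul_smul]
    have h2 : slash (twist a u) * rightMul a = ∑ i, ∑ j, ∑ k, (a i * a j * u k) •
        ((conjSgn (j ^^^ k) * conjSgn k * conjSgn j * sgn j k : ℤ) : ℝ) •
        (gamma (j ^^^ k) * rightMul (EuclideanSpace.single i 1)) := by
      rw [slash_twist, hR, Finset.mul_sum]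
      refine Finset.sum_congr rfl fun i _ => ?_
      simp only [Finset.sum_mul, smul_mul_smul_comm, smul_smul]
      refine Finset.sum_congr rfl fun j _ => Finset.sum_congr rfl fun k _ => ?_
      congr 1
      ring
    rw [h1, h2]
    simp only [← Finset.sum_sub_distrib, ← smul_sub]
    rfl
  -- The coefficients are symmetric in `i`, `j` while `X` is antisymmetric, so the sum equals its
  -- own negative.
  have hswap : ∑ i, ∑ j, ∑ k, (a i * a j * u k) • X i j k =
      -∑ i, ∑ j, ∑ k, (a i * a j * u k) • X i j k := by
    conv_lhs => rw [Finset.sum_comm]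
    simp only [← Finset.sum_neg_distrib]
    refine Finset.sum_congr rfl fun i _ => Finset.sum_congr rfl fun j _ =>
      Finset.sum_congr rfl fun k _ => ?_
    rw [eq_neg_of_add_eq_zero_left (hX j i k), smul_neg, mul_comm (a j)]
  rw [← sub_eq_zero, hsum]
  have h2 : (2 : ℝ) • (∑ i, ∑ j, ∑ k, (a i * a j * u k) • X i j k) = 0 := by
    rw [two_smul]
    conv_lhs => arg 1; rw [hswap]
    exact neg_add_cancel _
  exact (smul_eq_zero.1 h2).resolve_left two_ne_zero

/-- The columns are the vectors `gamma n *ᵥ a` up to sign. The symmetric part of `(gamma m)ᵀ * gamma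
n` is scalar by the Clifford relations, so these columns are orthogonal and all have the length of
`a`. -/
theorem rightMul_transpose_mul_self (a : E8) :
    (rightMul a)ᵀ * rightMul a = (inner ℝ a a : ℝ) • 1 := by
  have hdot : ∀ m n, ((rightMul a)ᵀ * rightMul a) m n =
      conjSgn m * conjSgn n * ((a : Fin 8 → ℝ) ⬝ᵥ ((gamma m)ᵀ * gamma n) *ᵥ a) := by
    intro m n
    have : ((rightMul a)ᵀ * rightMul a) m n =
        conjSgn m * conjSgn n * ((gamma m *ᵥ a) ⬝ᵥ (gamma n *ᵥ a)) := by
      rw [Matrix.mul_apply, dotProduct, Finset.mul_sum]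
      refine Finset.sum_congr rfl fun k _ => ?_
      simp only [rightMul, LinearMap.coe_mk, AddHom.coe_mk, Matrix.transpose_apply, Matrix.of_apply]
      ring
    rw [this, ← Matrix.mulVec_mulVec, Matrix.dotProduct_mulVec (a : Fin 8 → ℝ), Matrix.vecMul_transpose]
  have hsymm : ∀ m n, ((rightMul a)ᵀ * rightMul a) m n = ((rightMul a)ᵀ * rightMul a) n m := by
    intro m n
    have : ((rightMul a)ᵀ * rightMul a)ᵀ = (rightMul a)ᵀ * rightMul a := by
      rw [Matrix.transpose_mul, Matrix.transpose_transpose]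
    exact congrFun (congrFun this.symm m) n
  have haa : (a : Fin 8 → ℝ) ⬝ᵥ a = inner ℝ a a := by
    simp only [PiLp.inner_apply, dotProduct, RCLike.inner_apply, conj_trivial]
  have hc : ∀ m, (conjSgn m : ℝ) * conjSgn m = 1 := by
    intro m
    have : ∀ m, conjSgn m * conjSgn m = 1 := by decide
    rw [← Int.cast_mul, this, Int.cast_one]
  ext m n
  have h2 : ((rightMul a)ᵀ * rightMul a) m n + ((rightMul a)ᵀ * rightMul a) m n =
      2 * (((inner ℝ a a : ℝ) • 1 : Matrix (Fin 8) (Fin 8) ℝ) m n) := by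
    conv_lhs => rw [hsymm m n]
    conv_lhs => arg 2; rw [hsymm n m]
    rw [hdot, hdot, mul_comm (conjSgn m : ℝ), ← mul_add, ← dotProduct_add, ← Matrix.add_mulVec,
      gamma_transpose_mul_add, Matrix.smul_mulVec, Matrix.one_mulVec, dotProduct_smul, haa,
      Matrix.smul_apply, Matrix.one_apply]
    by_cases h : m = n
    · subst h
      simp [hc]
    · simp [h, Ne.symm h]
  linarith

theorem rightMul_mul_transpose {a : E8} (ha : inner ℝ a a = (1 : ℝ)) :
    rightMul a * (rightMul a)ᵀ = 1 := by
  refine mul_eq_one_comm.1 ?_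
  rw [rightMul_transpose_mul_self, ha, one_smul]

/-! ### Conjugation by rotations permutes the bimultiplications -/

/-- Conjugation by `g` maps decomposable bivectors to decomposable bivectors. -/
def PreservesDecomposables (g : Matrix (Fin 8) (Fin 8) ℝ) : Prop :=
  ∃ τ : E8 → E8, ∀ u v, g * (slash u * (slash v)ᵀ) * gᵀ = slash (τ u) * (slash (τ v))ᵀ

theorem PreservesDecomposables.one : PreservesDecomposables 1 :=
  ⟨id, fun u v => by simp⟩

theorem PreservesDecomposables.mul {g h : Matrix (Fin 8) (Fin 8) ℝ}
    (hg : PreservesDecomposables g) (hh : PreservesDecomposables h) :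
    PreservesDecomposables (g * h) := by
  obtain ⟨σ, hσ⟩ := hg
  obtain ⟨τ, hτ⟩ := hh
  refine ⟨σ ∘ τ, fun u v => ?_⟩
  rw [Function.comp_apply, Function.comp_apply, ← hσ, ← hτ, Matrix.transpose_mul]
  simp only [mul_assoc]

/-- For unit `a`, `reflMatrix a * negConj` is the bimultiplication x ↦ axa. The Moufang identity
moves it past `slash u` at the cost of a right multiplication by `a`, which is orthogonal and
cancels between the two factors. -/
theorem preservesDecomposables_reflMatrix {a : E8} (ha : inner ℝ a a = (1 : ℝ)) :
    PreservesDecomposables (reflMatrix a * negConj) := by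
  refine ⟨twist a, fun u v => ?_⟩
  calc reflMatrix a * negConj * (slash u * (slash v)ᵀ) * (reflMatrix a * negConj)ᵀ
      = (reflMatrix a * negConj * slash u) * (reflMatrix a * negConj * slash v)ᵀ := by
        rw [Matrix.transpose_mul _ (slash v)]
        simp only [mul_assoc]
    _ = slash (twist a u) * (rightMul a * (rightMul a)ᵀ) * (slash (twist a v))ᵀ := by
        rw [moufang, moufang, Matrix.transpose_mul]
        simp only [mul_assoc]
    _ = _ := by rw [rightMul_mul_transpose ha, mul_one]

theorem negConj_mul_reflMatrix (a : E8) :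
    negConj * reflMatrix a = reflMatrix (WithLp.toLp 2 (negConj *ᵥ a)) * negConj := by
  have h1 : inner ℝ (WithLp.toLp 2 (negConj *ᵥ a) : E8) (WithLp.toLp 2 (negConj *ᵥ a) : E8)
      = inner ℝ a a := by
    simp only [EuclideanSpace.inner_eq_star_dotProduct, star_trivial]
    rw [Matrix.dotProduct_mulVec, Matrix.vecMul_mulVec, negConj_transpose, negConj_mul_self,
      Matrix.vecMul_one]
  have h2 : negConj * Matrix.vecMulVec a a =
      Matrix.vecMulVec (negConj *ᵥ a) (negConj *ᵥ a) * negConj := by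
    rw [Matrix.mul_vecMulVec, Matrix.vecMulVec_mul, ← Matrix.vecMul_transpose, negConj_transpose,
      Matrix.vecMul_vecMul, negConj_mul_self, Matrix.vecMul_one]
  rw [reflMatrix, reflMatrix, h1, mul_sub, sub_mul, mul_smul_comm, smul_mul_assoc, mul_one, one_mul,
    mul_smul_comm, smul_mul_assoc, h2]

theorem det_reflMatrix {a : E8} (ha : inner ℝ a a = (1 : ℝ)) : (reflMatrix a).det = -1 := by
  have h : reflMatrix a = 1 + Matrix.replicateCol Unit (-(2 : ℝ) • (a : Fin 8 → ℝ)) *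
      Matrix.replicateRow Unit (a : Fin 8 → ℝ) := by
    rw [reflMatrix, ha, one_smul, ← Matrix.vecMulVec_eq, Matrix.smul_vecMulVec, neg_smul,
      sub_eq_add_neg]
  rw [h, Matrix.det_one_add_replicateCol_mul_replicateRow, dotProduct_smul]
  have : (a : Fin 8 → ℝ) ⬝ᵥ a = 1 := by
    rw [← ha]
    simp only [EuclideanSpace.inner_eq_star_dotProduct, star_trivial]
  rw [this]
  norm_num

theorem reflMatrix_mulVec {a : E8} (ha : inner ℝ a a = (1 : ℝ)) (x : E8) :
    reflMatrix a *ᵥ x = ((ℝ ∙ a)ᗮ.reflection x : E8) := by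
  have hn : ‖a‖ ^ 2 = 1 := by rw [← real_inner_self_eq_norm_sq, ha]
  rw [Submodule.reflection_orthogonal_apply, Submodule.reflection_singleton_apply, RCLike.ofReal_real_eq_id,
    id, hn, div_one, reflMatrix, ha, one_smul, Matrix.sub_mulVec, Matrix.one_mulVec,
    Matrix.smul_mulVec, Matrix.vecMulVec_mulVec]
  ext i
  simp only [EuclideanSpace.inner_eq_star_dotProduct, star_trivial, Pi.sub_apply, Pi.smul_apply,
    MulOpposite.smul_eq_mul_unop, MulOpposite.unop_op, smul_eq_mul, PiLp.sub_apply,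
    PiLp.smul_apply, nsmul_eq_mul, Nat.cast_ofNat, neg_sub, sub_right_inj]
  rw [dotProduct_comm]
  ring

/-- By Cartan–Dieudonné, one can induct on products of reflections. After an even number of them the
matrix preserves decomposables; after an odd number it does so once composed with `negConj`, which
pairs the last reflection into a bimultiplication. -/
theorem exists_matrix_isometry (φ : E8 ≃ₗᵢ[ℝ] E8) : ∃ g : Matrix (Fin 8) (Fin 8) ℝ,
    (∀ x : E8, (φ x : Fin 8 → ℝ) = g *ᵥ x) ∧
    ((g.det = 1 ∧ PreservesDecomposables g) ∨ (g.det = -1 ∧ PreservesDecomposables (g * negConj))) := by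
  have step : ∀ (ψ : E8 ≃ₗᵢ[ℝ] E8) (v : E8),
      (∃ g : Matrix (Fin 8) (Fin 8) ℝ, (∀ x : E8, (ψ x : Fin 8 → ℝ) = g *ᵥ x) ∧
        ((g.det = 1 ∧ PreservesDecomposables g) ∨
          (g.det = -1 ∧ PreservesDecomposables (g * negConj)))) →
      ∃ g : Matrix (Fin 8) (Fin 8) ℝ,
        (∀ x : E8, ((ψ * (ℝ ∙ v)ᗮ.reflection) x : Fin 8 → ℝ) = g *ᵥ x) ∧
        ((g.det = 1 ∧ PreservesDecomposables g) ∨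
          (g.det = -1 ∧ PreservesDecomposables (g * negConj))) := by
    rintro ψ v ⟨g, hg, hd⟩
    by_cases hv : v = 0
    · refine ⟨g, fun x => ?_, hd⟩
      have : (ℝ ∙ v)ᗮ.reflection x = x := by
        rw [Submodule.reflection_eq_self_iff, hv, Submodule.span_zero_singleton]
        simp
      rw [LinearIsometryEquiv.coe_mul, Function.comp_apply, this, hg]
    have hn : ‖v‖ ≠ 0 := norm_ne_zero_iff.2 hv
    have ha : inner ℝ (‖v‖⁻¹ • v) (‖v‖⁻¹ • v) = (1 : ℝ) := by
      rw [real_inner_smul_left, real_inner_smul_right, real_inner_self_eq_norm_sq]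
      field_simp
    have hs : (ℝ ∙ v) = ℝ ∙ (‖v‖⁻¹ • v) :=
      (Submodule.span_singleton_smul_eq (IsUnit.mk0 _ (inv_ne_zero hn)) v).symm
    obtain ⟨a, ha, hr⟩ : ∃ a : E8, inner ℝ a a = (1 : ℝ) ∧
        (ℝ ∙ v)ᗮ.reflection = (ℝ ∙ a)ᗮ.reflection := ⟨_, ha, by simp only [hs]⟩
    rw [hr]
    refine ⟨g * reflMatrix a, fun x => ?_, ?_⟩
    · rw [LinearIsometryEquiv.coe_mul, Function.comp_apply, hg, ← reflMatrix_mulVec ha, Matrix.mulVec_mulVec]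
    rw [Matrix.det_mul, det_reflMatrix ha]
    rcases hd with ⟨h1, h2⟩ | ⟨h1, h2⟩
    · refine Or.inr ⟨by rw [h1, one_mul], ?_⟩
      rw [mul_assoc]
      exact h2.mul (preservesDecomposables_reflMatrix ha)
    · refine Or.inl ⟨by rw [h1]; norm_num, ?_⟩
      -- Inserting `negConj` twice and commuting it past the reflection replaces `a` by its image
      -- under `negConj` and produces another bimultiplication.
      have h3 : g * reflMatrix a = g * negConj *
          (reflMatrix (WithLp.toLp 2 (negConj *ᵥ a)) * negConj) := by
        rw [← negConj_mul_reflMatrix, mul_assoc g, ← mul_assoc negConj, negConj_mul_self, one_mul]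
      rw [h3]
      refine h2.mul (preservesDecomposables_reflMatrix ?_)
      rw [← ha]
      simp only [EuclideanSpace.inner_eq_star_dotProduct, star_trivial]
      rw [Matrix.dotProduct_mulVec, Matrix.vecMul_mulVec, negConj_transpose, negConj_mul_self,
        Matrix.vecMul_one]
  have hφ : φ ∈ Subgroup.closure (Set.range fun v : E8 => (ℝ ∙ v)ᗮ.reflection) := by
    rw [LinearIsometryEquiv.reflections_generate]
    exact Subgroup.mem_top φ
  induction hφ using Subgroup.closure_induction_right with
  | one => exact ⟨1, fun x => by simp, Or.inl ⟨Matrix.det_one, PreservesDecomposables.one⟩⟩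
  | mul_right ψ _ y hy ih =>
    obtain ⟨v, rfl⟩ := hy
    exact step ψ v ih
  | mul_inv_cancel ψ _ y hy ih =>
    obtain ⟨v, rfl⟩ := hy
    rw [Submodule.reflection_inv]
    exact step ψ v ih

theorem preservesDecomposables_of_mem_SO8 {g : Matrix (Fin 8) (Fin 8) ℝ}
    (hg : g ∈ Matrix.specialOrthogonalGroup (Fin 8) ℝ) : PreservesDecomposables g := by
  obtain ⟨h1, h2⟩ := (mem_SO8_iff g).1 hg
  have h1' : gᵀ * g = 1 := mul_eq_one_comm.1 h1
  let f : E8 →ₗ[ℝ] E8 := Matrix.toEuclideanLin g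
  have hf : ∀ x y, inner ℝ (f x) (f y) = (inner ℝ x y : ℝ) := by
    intro x y
    change inner ℝ (WithLp.toLp 2 (g *ᵥ x) : E8) (WithLp.toLp 2 (g *ᵥ y) : E8) = inner ℝ x y
    simp only [EuclideanSpace.inner_eq_star_dotProduct, star_trivial]
    rw [Matrix.dotProduct_mulVec, Matrix.vecMul_mulVec, h1', Matrix.vecMul_one]
  let φ : E8 ≃ₗᵢ[ℝ] E8 := (f.isometryOfInner hf).toLinearIsometryEquiv rfl
  obtain ⟨g', hg', hd⟩ := exists_matrix_isometry φ
  have : g' = g := by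
    refine Matrix.ext_of_mulVec_single fun i => ?_
    exact (hg' (EuclideanSpace.single i 1)).symm
  subst this
  rcases hd with hd | hd
  · exact hd.2
  · rw [h2] at hd
    norm_num at hd

/-! ### The complex structures `-u̸ v̸ᵀ` -/

theorem inner_single_zero_single_one :
    inner ℝ (EuclideanSpace.single 0 1 : E8) (EuclideanSpace.single 1 1 : E8) = (0 : ℝ) := by
  rw [EuclideanSpace.inner_single_left, PiLp.single_apply, if_neg (by decide), mul_zero]

theorem gamma_zero : gamma 0 = 1 := by
  refine Matrix.ext_of_mulVec_single fun j => ?_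
  rw [gamma_mulVec_single, zero_xor, sgn_zero, Int.cast_one, one_smul, Matrix.one_mulVec]

/-- The base point, where the orientation sign is decided: this matrix is `stdJ` conjugated by the
sign change of the second coordinate, a frame of determinant -1. -/
theorem gamma_one_mem_M : -(gamma 0 * (gamma 1)ᵀ) ∈ M := by
  let d : Fin 8 → ℤ := ![1, -1, 1, 1, 1, 1, 1, 1]
  have hd : ∀ k, d k * d k = 1 := by decide
  let R : Matrix (Fin 8) (Fin 8) ℝ := Matrix.diagonal fun k => (d k : ℝ)
  have hR : Rᵀ = R := Matrix.diagonal_transpose _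
  refine (mem_M_iff _).2 ⟨R, ?_, ?_, matrix8_ext fun i j a b => ?_⟩
  · rw [hR, Matrix.diagonal_mul_diagonal, ← Matrix.diagonal_one]
    congr 1
    ext i
    rw [← Int.cast_mul, hd, Int.cast_one]
  · rw [Matrix.det_diagonal, ← Int.cast_prod]
    have : ∏ k, d k = -1 := by decide
    rw [this, Int.cast_neg, Int.cast_one]
  · rw [hR, gamma_zero, one_mul, Matrix.neg_apply, Matrix.transpose_apply, Matrix.mul_diagonal,
      Matrix.diagonal_mul, stdJ_apply]
    have h : ∀ (i j : Fin 4) (a b : Fin 2),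
        -(if pairEquiv (j, b) = 1 ^^^ pairEquiv (i, a) then sgn 1 (pairEquiv (i, a)) else 0) =
        d (pairEquiv (i, a)) * (if i = j then (!![0, -1; 1, 0] : Matrix (Fin 2) (Fin 2) ℤ) a b else 0)
          * d (pairEquiv (j, b)) := by decide +kernel
    have h2 := congrArg (Int.cast (R := ℝ)) (h i j a b)
    push_cast at h2
    refine h2.trans ?_
    congr 2
    split_ifs
    · fin_cases a <;> fin_cases b <;> simp
    · rfl

theorem slash_mul_transpose_swap {u v : E8} (h : inner ℝ u v = (0 : ℝ)) :
    slash u * (slash v)ᵀ = -(slash v * (slash u)ᵀ) := by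
  rw [eq_neg_iff_add_eq_zero, slash_mul_transpose_add, h, mul_zero, zero_smul]

/-- An orthonormal complex frame conjugates `J` to `stdJ`, and determinants are conjugation
invariant. -/
theorem det_eq_one_of_mul_self {J : Matrix (Fin 8) (Fin 8) ℝ} (h1 : J * Jᵀ = 1) (h2 : J * J = -1) :
    J.det = 1 := by
  obtain ⟨v, hv⟩ := exists_orthogonal_complexFrame h1 h2
  have h3 := congrArg Matrix.det (complexFrame_mul h1 h2 v)
  rw [Matrix.det_mul, Matrix.det_mul, det_stdJ, mul_comm] at h3
  refine mul_right_cancel₀ ?_ h3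
  rcases det_eq_or_of_mul_transpose hv with h | h <;> rw [h] <;> norm_num

theorem slash_mul_transpose_orthogonal {u v : E8} (hu : inner ℝ u u = (1 : ℝ))
    (hv : inner ℝ v v = (1 : ℝ)) : slash u * (slash v)ᵀ * (slash u * (slash v)ᵀ)ᵀ = 1 := by
  rw [Matrix.transpose_mul, Matrix.transpose_transpose, mul_assoc, ← mul_assoc _ (slash v),
    slash_transpose_mul_self, hv, one_smul, one_mul, slash_mul_transpose_self, hu, one_smul]

theorem det_slash_mul_transpose_of_inner_eq_zero {u v : E8} (hu : inner ℝ u u = (1 : ℝ))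
    (hv : inner ℝ v v = (1 : ℝ)) (huv : inner ℝ u v = (0 : ℝ)) :
    (slash u * (slash v)ᵀ).det = 1 := by
  refine det_eq_one_of_mul_self (slash_mul_transpose_orthogonal hu hv) ?_
  conv_lhs => arg 2; rw [slash_mul_transpose_swap huv]
  rw [mul_neg, mul_assoc, ← mul_assoc _ (slash v), slash_transpose_mul_self, hv, one_smul, one_mul,
    slash_mul_transpose_self, hu, one_smul]

theorem exists_unit_orthogonal (u v : E8) :
    ∃ w : E8, inner ℝ w w = (1 : ℝ) ∧ inner ℝ u w = (0 : ℝ) ∧ inner ℝ v w = (0 : ℝ) := by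
  classical
  let K : Submodule ℝ E8 := Submodule.span ℝ (({u, v} : Finset E8) : Set E8)
  have hK : Kᗮ ≠ ⊥ := by
    intro h
    have h1 := K.finrank_add_finrank_orthogonal
    have h2 : Module.finrank ℝ K ≤ 2 := (finrank_span_finset_le_card _).trans
      Finset.card_le_two
    rw [h, finrank_bot, finrank_euclideanSpace, Fintype.card_fin] at h1
    omega
  obtain ⟨w, hw, h0⟩ := Submodule.exists_mem_ne_zero_of_ne_bot hK
  have hn : ‖w‖ ≠ 0 := norm_ne_zero_iff.2 h0
  have hu : inner ℝ u w = (0 : ℝ) := hw u (Submodule.subset_span (by simp))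
  have hv : inner ℝ v w = (0 : ℝ) := hw v (Submodule.subset_span (by simp))
  refine ⟨‖w‖⁻¹ • w, ?_, by rw [real_inner_smul_right, hu, mul_zero],
    by rw [real_inner_smul_right, hv, mul_zero]⟩
  rw [real_inner_smul_left, real_inner_smul_right, real_inner_self_eq_norm_sq]
  field_simp

theorem slash_mul_transpose_mem_SO8 {u v : E8} (hu : inner ℝ u u = (1 : ℝ))
    (hv : inner ℝ v v = (1 : ℝ)) :
    slash u * (slash v)ᵀ ∈ Matrix.specialOrthogonalGroup (Fin 8) ℝ := by
  refine (mem_SO8_iff _).2 ⟨slash_mul_transpose_orthogonal hu hv, ?_⟩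
  -- A unit vector orthogonal to both factors the matrix into two orthogonal complex structures,
  -- each of determinant 1.
  obtain ⟨w, hw, huw, hvw⟩ := exists_unit_orthogonal u v
  have h : slash u * (slash v)ᵀ = slash u * (slash w)ᵀ * (slash w * (slash v)ᵀ) := by
    rw [mul_assoc, ← mul_assoc _ (slash w), slash_transpose_mul_self, hw, one_smul, one_mul]
  rw [h, Matrix.det_mul, det_slash_mul_transpose_of_inner_eq_zero hu hw huw,
    det_slash_mul_transpose_of_inner_eq_zero hw hv (by rw [real_inner_comm, hvw]), one_mul]

theorem slash_mul_transpose_eq {a : E8} (ha : inner ℝ a a = (1 : ℝ)) (u : E8) :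
    slash a * (slash u)ᵀ = slash ((2 * inner ℝ a u : ℝ) • a - u) * (slash a)ᵀ := by
  have h := congrArg (· * (slash a)ᵀ) (slash_mul_transpose_mul a u)
  simp only [mul_assoc, slash_mul_transpose_self, ha, one_smul, mul_one] at h
  exact h

theorem slash_transpose_mul_eq {b : E8} (hb : inner ℝ b b = (1 : ℝ)) (u : E8) :
    (slash b)ᵀ * slash u = (slash ((2 * inner ℝ b u : ℝ) • b - u))ᵀ * slash b := by
  have h := congrArg (fun X => Xᵀ * slash b) (slash_mul_transpose_mul b u)
  simp only [Matrix.transpose_mul, Matrix.transpose_transpose, mul_assoc, slash_transpose_mul_self,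
    hb, one_smul, mul_one] at h
  exact h

/-- With `a` the unit vector bisecting `v` and `w`, the product of the reflections in `v` and then
`a` rotates `v` to `w` and fixes `u`. Its spin image `slash a * (slash v)ᵀ` lies in SO(8), and
conjugation by it preserves `M`. -/
theorem neg_slash_mem_M_rotate {u v w : E8} (hv : inner ℝ v v = (1 : ℝ)) (hw : inner ℝ w w = (1 : ℝ))
    (huv : inner ℝ u v = (0 : ℝ)) (huw : inner ℝ u w = (0 : ℝ)) (hvw : v + w ≠ 0)
    (h : -(slash u * (slash v)ᵀ) ∈ M) : -(slash u * (slash w)ᵀ) ∈ M := by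
  have hs : ‖v + w‖ ≠ 0 := norm_ne_zero_iff.2 hvw
  have hs2 : ‖v + w‖ ^ 2 = 2 + 2 * inner ℝ v w := by
    rw [← real_inner_self_eq_norm_sq, inner_add_left, inner_add_right, inner_add_right, hv, hw,
      real_inner_comm v w]
    ring
  obtain ⟨a, ha, hau, hav⟩ : ∃ a : E8, inner ℝ a a = (1 : ℝ) ∧ inner ℝ a u = (0 : ℝ) ∧
      (2 * inner ℝ a v : ℝ) • a = v + w := by
    refine ⟨‖v + w‖⁻¹ • (v + w), ?_, ?_, ?_⟩
    · rw [real_inner_smul_left, real_inner_smul_right, real_inner_self_eq_norm_sq]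
      field_simp
    · rw [real_inner_smul_left, inner_add_left, real_inner_comm, huv, real_inner_comm, huw, add_zero,
        mul_zero]
    · rw [real_inner_smul_left, inner_add_left, hv, real_inner_comm, smul_smul]
      have : 2 * (‖v + w‖⁻¹ * (1 + inner ℝ v w)) * ‖v + w‖⁻¹ = (1 : ℝ) := by
        field_simp
        rw [hs2]
        ring
      rw [this, one_smul]
  have h2 := conj_mem_M h (slash_mul_transpose_mem_SO8 ha hv)
  have h3 : slash a * (slash v)ᵀ * -(slash u * (slash v)ᵀ) * (slash a * (slash v)ᵀ)ᵀ =
      -(slash u * (slash w)ᵀ) := by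
    have e1 : (slash v)ᵀ * slash u = (slash (-u))ᵀ * slash v := by
      rw [slash_transpose_mul_eq hv, real_inner_comm, huv, mul_zero, zero_smul, zero_sub]
    have e2 : slash a * (slash (-u))ᵀ = slash u * (slash a)ᵀ := by
      rw [slash_mul_transpose_eq ha, inner_neg_right, hau, neg_zero, mul_zero, zero_smul, zero_sub,
        neg_neg]
    have e3 : slash a * (slash v)ᵀ = slash w * (slash a)ᵀ := by
      rw [slash_mul_transpose_eq ha, hav, add_sub_cancel_left]
    calc slash a * (slash v)ᵀ * -(slash u * (slash v)ᵀ) * (slash a * (slash v)ᵀ)ᵀ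
        = -(slash a * ((slash v)ᵀ * slash u) * (slash v)ᵀ * (slash v * (slash a)ᵀ)) := by
          rw [Matrix.transpose_mul, Matrix.transpose_transpose]
          simp only [mul_neg, neg_mul, mul_assoc]
      _ = -(slash a * (slash (-u))ᵀ * (slash v * (slash v)ᵀ) * (slash v * (slash a)ᵀ)) := by
          rw [e1]
          simp only [mul_assoc]
      _ = -(slash u * ((slash a)ᵀ * (slash a * (slash v)ᵀ)ᵀ)) := by
          rw [e2, slash_mul_transpose_self, hv, one_smul, mul_one, Matrix.transpose_mul,
            Matrix.transpose_transpose]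
          simp only [mul_assoc]
      _ = _ := by
          rw [e3, Matrix.transpose_mul, Matrix.transpose_transpose, ← mul_assoc (slash a)ᵀ,
            slash_transpose_mul_self, ha, one_smul, one_mul]
  rwa [h3] at h2

theorem neg_slash_mem_M_of_mem {u v w : E8} (hv : inner ℝ v v = (1 : ℝ)) (hw : inner ℝ w w = (1 : ℝ))
    (huv : inner ℝ u v = (0 : ℝ)) (huw : inner ℝ u w = (0 : ℝ))
    (h : -(slash u * (slash v)ᵀ) ∈ M) : -(slash u * (slash w)ᵀ) ∈ M := by
  have hne : ∀ {x y : E8}, inner ℝ x x = (1 : ℝ) → inner ℝ x y = (0 : ℝ) → x + y ≠ 0 := by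
    intro x y hx hxy h0
    have := congrArg (inner ℝ x) h0
    rw [inner_add_right, hx, hxy, inner_zero_right] at this
    norm_num at this
  by_cases h0 : v + w = 0
  · obtain ⟨x, hx, hux, hvx⟩ := exists_unit_orthogonal u v
    have hwx : w = -v := eq_neg_of_add_eq_zero_right h0
    refine neg_slash_mem_M_rotate hx hw hux huw (hne hx ?_)
      (neg_slash_mem_M_rotate hv hx huv hux (hne hv hvx) h)
    rw [hwx, inner_neg_right, real_inner_comm, hvx, neg_zero]
  · exact neg_slash_mem_M_rotate hv hw huv huw h0 h

/-- The half-spin image of an oriented plane is an oriented complex structure. -/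
theorem neg_slash_mem_M {u v : E8} (hu : inner ℝ u u = (1 : ℝ)) (hv : inner ℝ v v = (1 : ℝ))
    (huv : inner ℝ u v = (0 : ℝ)) : -(slash u * (slash v)ᵀ) ∈ M := by
  let x : E8 := EuclideanSpace.single 0 1
  let y : E8 := EuclideanSpace.single 1 1
  have hx : inner ℝ x x = (1 : ℝ) := by simp [x]
  have hy : inner ℝ y y = (1 : ℝ) := by simp [y]
  have hxy : inner ℝ x y = (0 : ℝ) := inner_single_zero_single_one
  have h0 : -(slash x * (slash y)ᵀ) ∈ M := by
    rw [slash_single, slash_single]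
    exact gamma_one_mem_M
  -- The pair is changed one vector at a time, `(x, y)` to `(x, w)` to `(u, w)` to `(u, v)`; the
  -- first vector is changed by swapping the pair with a sign.
  obtain ⟨w, hw, hxw, huw⟩ := exists_unit_orthogonal x u
  have hswap : ∀ {a b : E8}, inner ℝ a b = (0 : ℝ) →
      slash a * (slash b)ᵀ = slash b * (slash (-a))ᵀ := by
    intro a b hab
    rw [slash_mul_transpose_swap hab, map_neg, Matrix.transpose_neg, mul_neg]
  have hwx : inner ℝ w (-x) = (0 : ℝ) := by rw [inner_neg_right, real_inner_comm, hxw, neg_zero]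
  have hwu : inner ℝ w (-u) = (0 : ℝ) := by rw [inner_neg_right, real_inner_comm, huw, neg_zero]
  have h1 := neg_slash_mem_M_of_mem hy hw hxy hxw h0
  rw [hswap hxw] at h1
  have h2 := neg_slash_mem_M_of_mem (by rw [inner_neg_neg, hx]) (by rw [inner_neg_neg, hu]) hwx hwu h1
  rw [← hswap huw] at h2
  exact neg_slash_mem_M_of_mem hw hv huw huv h2

/-- Every oriented complex structure is the half-spin image of an oriented plane. -/
theorem exists_eq_neg_slash {J : Matrix (Fin 8) (Fin 8) ℝ} (hJ : J ∈ M) :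
    ∃ u v : E8, inner ℝ u u = (1 : ℝ) ∧ inner ℝ v v = (1 : ℝ) ∧ inner ℝ u v = (0 : ℝ) ∧
      J = -(slash u * (slash v)ᵀ) := by
  obtain ⟨g, hg, rfl⟩ := exists_conj_eq gamma_one_mem_M hJ
  obtain ⟨τ, hτ⟩ := preservesDecomposables_of_mem_SO8 hg
  have hg1 := ((mem_SO8_iff g).1 hg).1
  -- Nothing about `τ` is known beyond the conjugation formula. Symmetrizing that formula turns both
  -- sides into scalar matrices, and comparing them shows that inner products are preserved.
  have hinner : ∀ u v, inner ℝ (τ u) (τ v) = (inner ℝ u v : ℝ) := by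
    intro u v
    have h1 := slash_mul_transpose_add (τ u) (τ v)
    rw [← hτ, ← hτ, ← add_mul, ← mul_add, slash_mul_transpose_add, mul_smul_comm, smul_mul_assoc,
      mul_one, hg1] at h1
    have h2 := congrFun (congrFun h1 0) 0
    simp only [Matrix.smul_apply, Matrix.one_apply_eq, smul_eq_mul, mul_one] at h2
    linarith
  refine ⟨τ (EuclideanSpace.single 0 1), τ (EuclideanSpace.single 1 1), ?_, ?_, ?_, ?_⟩
  · rw [hinner]; simp
  · rw [hinner]; simp
  · rw [hinner, inner_single_zero_single_one]
  · rw [← hτ, slash_single, slash_single, mul_neg, neg_mul]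

/-! ### Oriented planes and products of orthonormal pairs -/

/-- A change of basis multiplies the exterior product by its determinant, so orthonormal bases of
one plane with the same orientation have the same product. -/
theorem wedge_smul_add_smul (u v : E8) (p q r s : ℝ) :
    wedge (p • u + q • v) (r • u + s • v) = (p * s - q * r) • wedge u v := by
  have h1 := vec_mul_self u
  have h2 := vec_mul_self v
  have h3 := vec_mul_vec_swap u v
  have hv : ∀ (a b : ℝ) (x y : E8), vec (a • x + b • y) = a • vec x + b • vec y := by
    intro a b x y
    simp only [vec, map_add, map_smul]
  simp only [wedge, hv, add_mul, mul_add, smul_mul_smul_comm, inner_add_left, inner_add_right,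
    real_inner_smul_left, real_inner_smul_right, real_inner_comm u v]
  rw [h1, h2, h3]
  module

theorem bivecForm_halfSpin (a b u v : E8) : bivecForm a b (halfSpin (vec u * vec v)) =
    inner ℝ u a * inner ℝ v b - inner ℝ u b * inner ℝ v a := by
  rw [halfSpin_vec_mul_vec, bivecForm_neg_slash]

theorem coe_eq_smul_add_smul {K : Submodule ℝ E8} (b : OrthonormalBasis (Fin 2) ℝ K) (x : K) :
    (x : E8) = (inner ℝ (b 0) x : ℝ) • (b 0 : E8) + (inner ℝ (b 1) x : ℝ) • (b 1 : E8) := by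
  have h := congrArg Subtype.val (b.sum_repr' x)
  rw [Fin.sum_univ_two] at h
  exact h.symm

theorem det_orthonormalBasis_two {K : Submodule ℝ E8} (b c : OrthonormalBasis (Fin 2) ℝ K) :
    b.toBasis.det c = inner ℝ (b 0) (c 0) * inner ℝ (b 1) (c 1) -
      inner ℝ (b 1) (c 0) * inner ℝ (b 0) (c 1) := by
  rw [Module.Basis.det_apply, Matrix.det_fin_two]
  simp only [Module.Basis.toMatrix_apply, OrthonormalBasis.coe_toBasis_repr_apply,
    OrthonormalBasis.repr_apply_apply]
  ring

theorem inner_coe_orthonormalBasis {K : Submodule ℝ E8} (b : OrthonormalBasis (Fin 2) ℝ K)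
    (i j : Fin 2) : inner ℝ (b i : E8) (b j : E8) = if i = j then (1 : ℝ) else 0 :=
  orthonormal_iff_ite.1 b.orthonormal i j

theorem vec_mul_vec_eq_of_orientation_eq {K : Submodule ℝ E8} (b c : OrthonormalBasis (Fin 2) ℝ K)
    (h : b.toBasis.orientation = c.toBasis.orientation) :
    vec (c 0) * vec (c 1) = vec (b 0) * vec (b 1) := by
  have hdet := b.det_to_matrix_orthonormalBasis_of_same_orientation c h
  rw [det_orthonormalBasis_two] at hdet
  rw [← wedge_of_inner_eq_zero (inner_coe_orthonormalBasis c 0 1),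
    ← wedge_of_inner_eq_zero (inner_coe_orthonormalBasis b 0 1),
    coe_eq_smul_add_smul b (c 0), coe_eq_smul_add_smul b (c 1), wedge_smul_add_smul, hdet, one_smul]

/-- Equal products give equal Plücker forms. Contracting the form with `b 1` or `b 0` recovers the
other vector of `b`, now written as a combination of `c 0` and `c 1`. -/
theorem le_of_vec_mul_vec_eq {K L : Submodule ℝ E8} (b : OrthonormalBasis (Fin 2) ℝ K)
    (c : OrthonormalBasis (Fin 2) ℝ L) (h : vec (b 0) * vec (b 1) = vec (c 0) * vec (c 1)) :
    K ≤ L := by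
  have hf : ∀ x y : E8, inner ℝ (b 0 : E8) x * inner ℝ (b 1 : E8) y -
      inner ℝ (b 0 : E8) y * inner ℝ (b 1 : E8) x =
      inner ℝ (c 0 : E8) x * inner ℝ (c 1 : E8) y -
      (inner ℝ (c 0 : E8) y * inner ℝ (c 1 : E8) x : ℝ) := by
    intro x y
    rw [← bivecForm_halfSpin, ← bivecForm_halfSpin, h]
  have h0 : (b 0 : E8) = (inner ℝ (c 1 : E8) (b 1 : E8) : ℝ) • (c 0 : E8) -
      (inner ℝ (c 0 : E8) (b 1 : E8) : ℝ) • (c 1 : E8) := by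
    refine ext_inner_right ℝ fun x => ?_
    have := hf x (b 1)
    rw [inner_coe_orthonormalBasis, inner_coe_orthonormalBasis, if_pos rfl, if_neg (by decide),
      mul_one, zero_mul, sub_zero] at this
    rw [this, inner_sub_left, real_inner_smul_left, real_inner_smul_left]
    ring
  have h1 : (b 1 : E8) = (inner ℝ (c 0 : E8) (b 0 : E8) : ℝ) • (c 1 : E8) -
      (inner ℝ (c 1 : E8) (b 0 : E8) : ℝ) • (c 0 : E8) := by
    refine ext_inner_right ℝ fun x => ?_
    have := hf (b 0) x
    rw [inner_coe_orthonormalBasis, inner_coe_orthonormalBasis, if_pos rfl, if_neg (by decide),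
      one_mul, mul_zero, sub_zero] at this
    rw [this, inner_sub_left, real_inner_smul_left, real_inner_smul_left]
    ring
  intro x hx
  have hx' := coe_eq_smul_add_smul b ⟨x, hx⟩
  rw [Submodule.coe_mk] at hx'
  rw [hx', h0, h1]
  have m0 := (c 0).2
  have m1 := (c 1).2
  exact L.add_mem (L.smul_mem _ (L.sub_mem (L.smul_mem _ m0) (L.smul_mem _ m1)))
    (L.smul_mem _ (L.sub_mem (L.smul_mem _ m1) (L.smul_mem _ m0)))

theorem orientation_eq_of_vec_mul_vec_eq {K : Submodule ℝ E8} (b c : OrthonormalBasis (Fin 2) ℝ K)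
    (h : vec (b 0) * vec (b 1) = vec (c 0) * vec (c 1)) :
    b.toBasis.orientation = c.toBasis.orientation := by
  refine (Module.Basis.orientation_eq_iff_det_pos _ _).2 ?_
  rw [OrthonormalBasis.coe_toBasis, det_orthonormalBasis_two]
  have hf := congrArg (fun z => bivecForm (c 0) (c 1) (halfSpin z)) h
  simp only [bivecForm_halfSpin, inner_coe_orthonormalBasis] at hf
  have h2 : inner ℝ (b 0) (c 0) * inner ℝ (b 1) (c 1) -
      inner ℝ (b 1) (c 0) * inner ℝ (b 0) (c 1) = (1 : ℝ) := by
    refine Eq.trans ?_ (hf.trans ?_)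
    · simp only [Submodule.coe_inner]
      ring
    · simp
  rw [h2]
  exact one_pos

namespace OrientedPlane

/-- An oriented orthonormal basis of an oriented plane. -/
noncomputable def basis (P : OrientedPlane) : OrthonormalBasis (Fin 2) ℝ P.plane :=
  P.orientation.finOrthonormalBasis two_pos P.finrank_plane

theorem basis_orientation (P : OrientedPlane) : P.basis.toBasis.orientation = P.orientation :=
  P.orientation.finOrthonormalBasis_orientation two_pos P.finrank_plane

/-- The product of the vectors of an oriented orthonormal basis. -/
noncomputable def product (P : OrientedPlane) : G28 :=
  ⟨vec (P.basis 0) * vec (P.basis 1), P.basis 0, P.basis 1, P.basis.orthonormal.1 0,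
    P.basis.orthonormal.1 1, inner_coe_orthonormalBasis P.basis 0 1, rfl⟩

theorem product_eq (P : OrientedPlane) (b : OrthonormalBasis (Fin 2) ℝ P.plane)
    (h : b.toBasis.orientation = P.orientation) : (P.product : Cl8) = vec (b 0) * vec (b 1) :=
  vec_mul_vec_eq_of_orientation_eq b P.basis (h.trans P.basis_orientation.symm)

theorem product_bijective : Function.Bijective product := by
  constructor
  · intro P Q h
    have h' : vec (P.basis 0) * vec (P.basis 1) = vec (Q.basis 0) * vec (Q.basis 1) :=
      congrArg Subtype.val h
    have hPQ : P.plane = Q.plane :=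
      le_antisymm (le_of_vec_mul_vec_eq _ _ h') (le_of_vec_mul_vec_eq _ _ h'.symm)
    have hP := P.basis_orientation
    have hQ := Q.basis_orientation
    -- The chosen bases depend on the planes and must become free variables before the two planes
    -- can be identified.
    generalize P.basis = b at h' hP
    generalize Q.basis = c at h' hQ
    obtain ⟨K, hK, o⟩ := P
    obtain ⟨L, hL, o'⟩ := Q
    dsimp only at hPQ
    subst hPQ
    have := orientation_eq_of_vec_mul_vec_eq b c h'
    rw [hP, hQ] at this
    dsimp only at this
    subst this
    rfl
  · rintro ⟨x, u, v, hu, hv, huv, rfl⟩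
    have ho : Orthonormal ℝ ![u, v] := by
      rw [orthonormal_iff_ite]
      intro i j
      fin_cases i <;> fin_cases j <;> simp [hu, hv, huv, real_inner_comm]
    let B := Module.Basis.span ho.linearIndependent
    have hB : ∀ i, (B i : E8) = ![u, v] i := fun i => congrArg Subtype.val (Module.Basis.span_apply ho.linearIndependent i)
    have hBo : Orthonormal ℝ B := by
      rw [orthonormal_iff_ite] at ho ⊢
      intro i j
      rw [Submodule.coe_inner, hB, hB, ho]
    let P : OrientedPlane :=
      ⟨Submodule.span ℝ (Set.range ![u, v]), by
        rw [finrank_span_eq_card ho.linearIndependent, Fintype.card_fin], B.orientation⟩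
    refine ⟨P, Subtype.ext ?_⟩
    have h := P.product_eq (B.toOrthonormalBasis hBo) (by
      rw [Module.Basis.toBasis_toOrthonormalBasis])
    rw [h, Module.Basis.coe_toOrthonormalBasis, hB, hB]
    rfl

end OrientedPlane

/-! ### Charts of the oriented Grassmannian -/

/-- The Plücker coordinate of an element of the Clifford algebra in the direction `a ∧ b`. -/
noncomputable def pluckerForm (a b : E8) : Cl8 →ₗ[ℝ] ℝ := bivecForm a b ∘ₗ halfSpin

theorem pluckerForm_vec_mul_vec (a b u v : E8) : pluckerForm a b (vec u * vec v) =
    inner ℝ u a * inner ℝ v b - inner ℝ u b * inner ℝ v a := bivecForm_halfSpin a b u v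

theorem pluckerForm_wedge (a b u v : E8) : pluckerForm a b (wedge u v) =
    inner ℝ u a * inner ℝ v b - inner ℝ u b * inner ℝ v a := by
  have h1 : pluckerForm a b 1 = 0 := by
    have h := pluckerForm_vec_mul_vec a b (EuclideanSpace.single 0 1) (EuclideanSpace.single 0 1)
    rw [vec_mul_self_of_norm_eq_one (by simp), map_neg] at h
    linarith [h]
  rw [wedge, map_add, map_smul, h1, smul_zero, add_zero, pluckerForm_vec_mul_vec]

/-- The exterior product as a bilinear map. -/
noncomputable def wedgeBilin : E8 →ₗ[ℝ] E8 →ₗ[ℝ] Cl8 :=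
  LinearMap.mk₂ ℝ wedge
    (fun u v w => by simp only [wedge, vec, map_add, add_mul, inner_add_left]; module)
    (fun c u v => by
      simp only [wedge, vec, map_smul, smul_mul_assoc, real_inner_smul_left]; module)
    (fun u v w => by simp only [wedge, vec, map_add, mul_add, inner_add_right]; module)
    (fun c u v => by
      simp only [wedge, vec, map_smul, mul_smul_comm, real_inner_smul_right]; module)

theorem contDiff_wedge {F : Type*} [NormedAddCommGroup F] [NormedSpace ℝ F] {f g : F → E8}
    (hf : ContDiff ℝ ∞ f) (hg : ContDiff ℝ ∞ g) : ContDiff ℝ ∞ fun y => wedge (f y) (g y) := by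
  exact (wedgeBilin.toContinuousBilinearMap.contDiff.comp hf).clm_apply hg

/-- The Gram determinant of two vectors. -/
noncomputable def gram (u v : E8) : ℝ := inner ℝ u u * inner ℝ v v - inner ℝ u v ^ 2

theorem gram_smul_add_smul (u v : E8) (p q r s : ℝ) :
    gram (p • u + q • v) (r • u + s • v) = (p * s - q * r) ^ 2 * gram u v := by
  simp only [gram, inner_add_left, inner_add_right, real_inner_smul_left, real_inner_smul_right,
    real_inner_comm u v]
  ring

theorem smul_wedge_mem_G28 {u v : E8} (h : 0 < gram u v) :
    (Real.sqrt (gram u v))⁻¹ • wedge u v ∈ G28 := by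
  have hv : v ≠ 0 := by
    rintro rfl
    simp [gram] at h
  have hvv : inner ℝ v v ≠ (0 : ℝ) := inner_self_ne_zero.2 hv
  -- Gram–Schmidt: subtracting the projection of `u` on `v` changes neither the wedge nor the Gram
  -- determinant, which becomes a product of squared lengths.
  set t : ℝ := inner ℝ u v / inner ℝ v v with ht
  set w : E8 := u - t • v with hw
  have hw' : w = (1 : ℝ) • u + (-t) • v := by rw [hw]; module
  have hv' : v = (0 : ℝ) • u + (1 : ℝ) • v := by module
  have hwv : inner ℝ w v = (0 : ℝ) := by
    rw [hw, inner_sub_left, real_inner_smul_left, ht, div_mul_cancel₀ _ hvv, sub_self]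
  have hwedge : wedge w v = wedge u v := by
    have h1 := wedge_smul_add_smul u v 1 (-t) 0 1
    rw [← hw', ← hv'] at h1
    simpa using h1
  have hgram : gram u v = inner ℝ w w * inner ℝ v v := by
    have h1 : gram w v = gram u v := by
      have h1 := gram_smul_add_smul u v 1 (-t) 0 1
      rw [← hw', ← hv'] at h1
      simpa using h1
    rw [← h1, gram, hwv]
    ring
  have hw0 : w ≠ 0 := by
    intro h0
    rw [hgram, h0, inner_zero_left, zero_mul] at h
    exact lt_irrefl _ h
  refine ⟨‖w‖⁻¹ • w, ‖v‖⁻¹ • v, norm_smul_inv_norm hw0, norm_smul_inv_norm hv, ?_, ?_⟩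
  · rw [real_inner_smul_left, real_inner_smul_right, hwv, mul_zero, mul_zero]
  · rw [← hwedge, wedge_of_inner_eq_zero hwv, hgram, real_inner_self_eq_norm_sq,
      real_inner_self_eq_norm_sq, ← mul_pow, Real.sqrt_sq (by positivity), mul_inv]
    simp only [vec, map_smul, smul_mul_smul_comm]

section Chart

variable (b : OrthonormalBasis (Fin 8) ℝ E8)

/-- The basis vectors other than the first two. -/
noncomputable def normalVec (i : Fin 6) : E8 := b (Fin.natAdd 2 i)

theorem inner_basis (i j : Fin 8) : inner ℝ (b i) (b j) = if i = j then (1 : ℝ) else 0 :=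
  orthonormal_iff_ite.1 b.orthonormal i j

/-- The first spanning vector of the plane with given coordinates. -/
noncomputable def graphFst (y : EuclideanSpace ℝ (Fin 12)) : E8 :=
  b 0 + ∑ i : Fin 6, y (Fin.castAdd 6 i) • normalVec b i

/-- The second spanning vector of the plane with given coordinates. -/
noncomputable def graphSnd (y : EuclideanSpace ℝ (Fin 12)) : E8 :=
  b 1 + ∑ i : Fin 6, y (Fin.natAdd 6 i) • normalVec b i

theorem inner_normalVec (i j : Fin 6) :
    inner ℝ (normalVec b i) (normalVec b j) = if i = j then (1 : ℝ) else 0 := by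
  have h : ∀ i j : Fin 6, (Fin.natAdd 2 i : Fin 8) = Fin.natAdd 2 j ↔ i = j := by decide
  rw [normalVec, normalVec, inner_basis]
  simp only [h]

theorem inner_normalVec_zero (i : Fin 6) : inner ℝ (normalVec b i) (b 0) = (0 : ℝ) := by
  have h : ∀ i : Fin 6, (Fin.natAdd 2 i : Fin 8) ≠ 0 := by decide
  rw [normalVec, inner_basis, if_neg (h i)]

theorem inner_normalVec_one (i : Fin 6) : inner ℝ (normalVec b i) (b 1) = (0 : ℝ) := by
  have h : ∀ i : Fin 6, (Fin.natAdd 2 i : Fin 8) ≠ 1 := by decide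
  rw [normalVec, inner_basis, if_neg (h i)]

theorem inner_zero_zero : inner ℝ (b 0) (b 0) = (1 : ℝ) := by rw [inner_basis, if_pos rfl]

theorem inner_one_one : inner ℝ (b 1) (b 1) = (1 : ℝ) := by rw [inner_basis, if_pos rfl]

theorem inner_zero_one : inner ℝ (b 0) (b 1) = (0 : ℝ) := by rw [inner_basis, if_neg (by decide)]

theorem inner_one_zero : inner ℝ (b 1) (b 0) = (0 : ℝ) := by rw [inner_basis, if_neg (by decide)]

theorem inner_zero_normalVec (i : Fin 6) : inner ℝ (b 0) (normalVec b i) = (0 : ℝ) := by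
  rw [real_inner_comm, inner_normalVec_zero]

theorem inner_one_normalVec (i : Fin 6) : inner ℝ (b 1) (normalVec b i) = (0 : ℝ) := by
  rw [real_inner_comm, inner_normalVec_one]

theorem inner_graphFst_zero (y : EuclideanSpace ℝ (Fin 12)) :
    inner ℝ (graphFst b y) (b 0) = (1 : ℝ) := by
  simp [graphFst, inner_add_left, sum_inner, real_inner_smul_left, inner_normalVec_zero]

theorem inner_graphFst_one (y : EuclideanSpace ℝ (Fin 12)) :
    inner ℝ (graphFst b y) (b 1) = (0 : ℝ) := by
  rw [graphFst, inner_add_left, inner_zero_one, sum_inner]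
  simp [real_inner_smul_left, inner_normalVec_one]

theorem inner_graphFst_normalVec (y : EuclideanSpace ℝ (Fin 12)) (i : Fin 6) :
    inner ℝ (graphFst b y) (normalVec b i) = y (Fin.castAdd 6 i) := by
  rw [graphFst, inner_add_left, inner_zero_normalVec, sum_inner]
  simp [real_inner_smul_left, inner_normalVec]

theorem inner_graphSnd_zero (y : EuclideanSpace ℝ (Fin 12)) :
    inner ℝ (graphSnd b y) (b 0) = (0 : ℝ) := by
  rw [graphSnd, inner_add_left, inner_one_zero, sum_inner]
  simp [real_inner_smul_left, inner_normalVec_zero]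

theorem inner_graphSnd_one (y : EuclideanSpace ℝ (Fin 12)) :
    inner ℝ (graphSnd b y) (b 1) = (1 : ℝ) := by
  simp [graphSnd, inner_add_left, sum_inner, real_inner_smul_left, inner_normalVec_one]

theorem inner_graphSnd_normalVec (y : EuclideanSpace ℝ (Fin 12)) (i : Fin 6) :
    inner ℝ (graphSnd b y) (normalVec b i) = y (Fin.natAdd 6 i) := by
  rw [graphSnd, inner_add_left, inner_one_normalVec, sum_inner]
  simp [real_inner_smul_left, inner_normalVec]

theorem ext_inner_basis {u v : E8} (h0 : inner ℝ u (b 0) = (inner ℝ v (b 0) : ℝ))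
    (h1 : inner ℝ u (b 1) = (inner ℝ v (b 1) : ℝ))
    (h : ∀ i, inner ℝ u (normalVec b i) = (inner ℝ v (normalVec b i) : ℝ)) : u = v := by
  refine InnerProductSpace.ext_inner_right_basis b.toBasis fun i => ?_
  rw [OrthonormalBasis.coe_toBasis]
  refine Fin.addCases (m := 2) (n := 6) (fun k => ?_) (fun k => h k) i
  fin_cases k
  · exact h0
  · exact h1

theorem gram_graph_pos (y : EuclideanSpace ℝ (Fin 12)) : 0 < gram (graphFst b y) (graphSnd b y) := by
  set u := graphFst b y with hu
  set v := graphSnd b y with hv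
  have hv0 : v ≠ 0 := by
    intro h
    have := inner_graphSnd_one b y
    rw [← hv, h, inner_zero_left] at this
    exact zero_ne_one this
  have hne : u - (inner ℝ u v / inner ℝ v v : ℝ) • v ≠ 0 := by
    intro h
    have := congrArg (fun x => inner ℝ x (b 0)) h
    simp only [inner_sub_left, real_inner_smul_left] at this
    rw [hu, hv, inner_graphFst_zero, inner_graphSnd_zero, inner_zero_left] at this
    norm_num at this
  have hvv : 0 < inner ℝ v v := real_inner_self_pos.2 hv0
  have h1 := mul_pos (real_inner_self_pos.2 hne) hvv
  have h2 : inner ℝ (u - (inner ℝ u v / inner ℝ v v : ℝ) • v)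
      (u - (inner ℝ u v / inner ℝ v v : ℝ) • v) * inner ℝ v v = gram u v := by
    simp only [gram, inner_sub_left, inner_sub_right, real_inner_smul_left, real_inner_smul_right,
      real_inner_comm u v]
    field_simp
    ring
  rwa [h2] at h1

/-- The linear forms whose quotients by the first Plücker coordinate are the affine coordinates. -/
noncomputable def affineForm : Fin 12 → Cl8 →ₗ[ℝ] ℝ :=
  Fin.addCases (m := 6) (n := 6) (fun i => pluckerForm (normalVec b i) (b 1))
    (fun i => pluckerForm (b 0) (normalVec b i))

theorem affineForm_castAdd (i : Fin 6) :
    affineForm b (Fin.castAdd 6 i) = pluckerForm (normalVec b i) (b 1) :=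
  Fin.addCases_left i

theorem affineForm_natAdd (i : Fin 6) :
    affineForm b (Fin.natAdd 6 i) = pluckerForm (b 0) (normalVec b i) :=
  Fin.addCases_right i

theorem forall_fin_twelve {p : Fin 12 → Prop} (h1 : ∀ i : Fin 6, p (Fin.castAdd 6 i))
    (h2 : ∀ i : Fin 6, p (Fin.natAdd 6 i)) (k : Fin 12) : p k :=
  Fin.addCases (m := 6) (n := 6) h1 h2 k

theorem affineForm_wedge_graph (y : EuclideanSpace ℝ (Fin 12)) (k : Fin 12) :
    affineForm b k (wedge (graphFst b y) (graphSnd b y)) = y k := by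
  revert k
  refine forall_fin_twelve (fun i => ?_) (fun i => ?_)
  · rw [affineForm_castAdd, pluckerForm_wedge, inner_graphFst_normalVec, inner_graphSnd_one,
      inner_graphFst_one, mul_one, zero_mul, sub_zero]
  · rw [affineForm_natAdd, pluckerForm_wedge, inner_graphFst_zero, inner_graphSnd_normalVec,
      inner_graphSnd_zero, mul_zero, one_mul, sub_zero]

/-- A linear right inverse of the family of linear forms. -/
noncomputable def affineSec : EuclideanSpace ℝ (Fin 12) →ₗ[ℝ] Cl8 where
  toFun y := ∑ i : Fin 6, y (Fin.castAdd 6 i) • (vec (normalVec b i) * vec (b 1)) +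
    ∑ i : Fin 6, y (Fin.natAdd 6 i) • (vec (b 0) * vec (normalVec b i))
  map_add' x y := by
    simp only [PiLp.add_apply, add_smul, Finset.sum_add_distrib]
    abel
  map_smul' c x := by
    simp only [PiLp.smul_apply, smul_eq_mul, mul_smul, Finset.smul_sum, smul_add, RingHom.id_apply]

theorem affineSec_apply (y : EuclideanSpace ℝ (Fin 12)) : affineSec b y =
    ∑ i : Fin 6, y (Fin.castAdd 6 i) • (vec (normalVec b i) * vec (b 1)) +
    ∑ i : Fin 6, y (Fin.natAdd 6 i) • (vec (b 0) * vec (normalVec b i)) := rfl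

theorem affineForm_affineSec (y : EuclideanSpace ℝ (Fin 12)) (k : Fin 12) :
    affineForm b k (affineSec b y) = y k := by
  revert k
  refine forall_fin_twelve (fun i => ?_) (fun i => ?_)
  · rw [affineForm_castAdd, affineSec_apply]
    simp only [map_add, map_sum, map_smul, pluckerForm_vec_mul_vec, inner_normalVec,
      inner_normalVec_one, inner_one_one, inner_zero_one, inner_zero_normalVec, inner_one_normalVec]
    simp
  · rw [affineForm_natAdd, affineSec_apply]
    simp only [map_add, map_sum, map_smul, pluckerForm_vec_mul_vec, inner_normalVec,
      inner_normalVec_zero, inner_zero_zero, inner_one_zero, inner_zero_normalVec,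
      inner_one_normalVec]
    simp

theorem pluckerForm_affineSec (y : EuclideanSpace ℝ (Fin 12)) :
    pluckerForm (b 0) (b 1) (affineSec b y) = 0 := by
  rw [affineSec_apply]
  simp only [map_add, map_sum, map_smul, pluckerForm_vec_mul_vec, inner_normalVec_zero,
    inner_normalVec_one, inner_zero_one]
  simp

/-- The plane with given affine coordinates. -/
noncomputable def graphPlane (y : EuclideanSpace ℝ (Fin 12)) : G28 :=
  ⟨_, smul_wedge_mem_G28 (gram_graph_pos b y)⟩

theorem coe_graphPlane (y : EuclideanSpace ℝ (Fin 12)) : (graphPlane b y : Cl8) =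
    (Real.sqrt (gram (graphFst b y) (graphSnd b y)))⁻¹ • wedge (graphFst b y) (graphSnd b y) := rfl

theorem pluckerForm_graphPlane (y : EuclideanSpace ℝ (Fin 12)) :
    pluckerForm (b 0) (b 1) (graphPlane b y) =
      (Real.sqrt (gram (graphFst b y) (graphSnd b y)))⁻¹ := by
  rw [coe_graphPlane, map_smul, pluckerForm_wedge, inner_graphFst_zero, inner_graphSnd_one,
    inner_graphFst_one, zero_mul, sub_zero, mul_one, smul_eq_mul, mul_one]

theorem contDiff_graphPlane : ContDiff ℝ ∞ fun y => (graphPlane b y : Cl8) := by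
  have hy : ∀ k, ContDiff ℝ ∞ fun y : EuclideanSpace ℝ (Fin 12) => y k := fun k =>
    (EuclideanSpace.proj (𝕜 := ℝ) k).contDiff
  have h1 : ContDiff ℝ ∞ (graphFst b) :=
    contDiff_const.add (ContDiff.sum fun i _ => (hy _).smul contDiff_const)
  have h2 : ContDiff ℝ ∞ (graphSnd b) :=
    contDiff_const.add (ContDiff.sum fun i _ => (hy _).smul contDiff_const)
  have h3 : ContDiff ℝ ∞ fun y => gram (graphFst b y) (graphSnd b y) :=
    ((h1.inner ℝ h1).mul (h2.inner ℝ h2)).sub ((h1.inner ℝ h2).pow 2)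
  exact ((h3.sqrt fun y => (gram_graph_pos b y).ne').inv
    fun y => (Real.sqrt_pos.2 (gram_graph_pos b y)).ne').smul (contDiff_wedge h1 h2)

/-- Cramer's rule: the graph vectors are the combinations of `u`, `v` whose components along `b 0`,
`b 1` are (1, 0) and (0, 1). The change of basis has determinant `d⁻¹`, and since `d` is positive
the normalization returns `x` and not its opposite. -/
theorem graphPlane_of_pos (x : G28) (hx : 0 < pluckerForm (b 0) (b 1) x)
    (y : EuclideanSpace ℝ (Fin 12))
    (hy : ∀ k, y k = (pluckerForm (b 0) (b 1) x)⁻¹ * affineForm b k x) : graphPlane b y = x := by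
  obtain ⟨x, u, v, hu, hv, huv, rfl⟩ := x
  dsimp only at hx hy
  have hd := pluckerForm_vec_mul_vec (b 0) (b 1) u v
  set d := pluckerForm (b 0) (b 1) (vec u * vec v)
  have hd0 : d ≠ 0 := hx.ne'
  have hU : graphFst b y = (d⁻¹ * inner ℝ v (b 1)) • u + (-(d⁻¹ * inner ℝ u (b 1))) • v := by
    refine ext_inner_basis b ?_ ?_ fun i => ?_ <;>
      simp only [inner_add_left, real_inner_smul_left, inner_graphFst_zero, inner_graphFst_one,
        inner_graphFst_normalVec, hy, affineForm_castAdd, pluckerForm_vec_mul_vec]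
    · field_simp
      rw [hd]
      ring
    · ring
    · ring
  have hV : graphSnd b y = (-(d⁻¹ * inner ℝ v (b 0))) • u + (d⁻¹ * inner ℝ u (b 0)) • v := by
    refine ext_inner_basis b ?_ ?_ fun i => ?_ <;>
      simp only [inner_add_left, real_inner_smul_left, inner_graphSnd_zero, inner_graphSnd_one,
        inner_graphSnd_normalVec, hy, affineForm_natAdd, pluckerForm_vec_mul_vec]
    · ring
    · field_simp
      rw [hd]
      ring
    · ring
  have hdet : d⁻¹ * inner ℝ v (b 1) * (d⁻¹ * inner ℝ u (b 0)) -
      -(d⁻¹ * inner ℝ u (b 1)) * -(d⁻¹ * inner ℝ v (b 0)) = d⁻¹ := by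
    field_simp
    rw [hd]
    ring
  have hg : gram u v = 1 := by
    rw [gram, real_inner_self_eq_norm_sq, real_inner_self_eq_norm_sq, hu, hv, huv]
    norm_num
  refine Subtype.ext ?_
  rw [coe_graphPlane, hU, hV, gram_smul_add_smul, wedge_smul_add_smul, hdet, hg, mul_one,
    Real.sqrt_sq (inv_pos.2 hx).le, inv_inv, smul_smul, mul_inv_cancel₀ hd0, one_smul,
    wedge_of_inner_eq_zero huv]

/-- The affine chart of the oriented Grassmannian given by an orthonormal basis. -/
noncomputable def planeChart :
    ProjChart (Subtype.val : G28 → Cl8) (EuclideanSpace ℝ (Fin 12)) where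
  den := LinearMap.toContinuousLinearMap (pluckerForm (b 0) (b 1))
  num := LinearMap.toContinuousLinearMap
    ((WithLp.linearEquiv 2 ℝ (Fin 12 → ℝ)).symm.toLinearMap ∘ₗ LinearMap.pi (affineForm b))
  sec := LinearMap.toContinuousLinearMap (affineSec b)
  param := graphPlane b
  contDiff_param := contDiff_graphPlane b
  den_param y := by
    change 0 < pluckerForm (b 0) (b 1) (graphPlane b y)
    rw [pluckerForm_graphPlane]
    exact inv_pos.2 (Real.sqrt_pos.2 (gram_graph_pos b y))
  num_param y := by
    ext k
    change affineForm b k (graphPlane b y) = pluckerForm (b 0) (b 1) (graphPlane b y) * y k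
    rw [pluckerForm_graphPlane, coe_graphPlane, map_smul, affineForm_wedge_graph, smul_eq_mul]
  param_num x hx := graphPlane_of_pos b x hx _ fun k => rfl
  num_sec y := by
    ext k
    exact affineForm_affineSec b y k
  den_sec y := pluckerForm_affineSec b y

end Chart

theorem exists_planeChart (x : G28) : ∃ b : OrthonormalBasis (Fin 8) ℝ E8,
    0 < (planeChart b).den (x : Cl8) := by
  obtain ⟨x, u, v, hu, hv, huv, rfl⟩ := x
  -- Gram–Schmidt keeps the orthonormal vectors `u`, `v` and replaces the zeros by a completion to
  -- an orthonormal basis. In this basis the denominator at `x` is 1.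
  let f : Fin 8 → E8 := fun i => if i = 0 then u else if i = 1 then v else 0
  have hf : Pairwise fun i j => inner ℝ (f i) (f j) = (0 : ℝ) := by
    intro i j hij
    by_cases i = 0 <;> by_cases j = 0 <;> by_cases i = 1 <;> by_cases j = 1 <;>
      simp_all [f, real_inner_comm]
  have hn0 : f 0 ≠ 0 := norm_ne_zero_iff.1 (by simp [f, hu])
  have hn1 : f 1 ≠ 0 := norm_ne_zero_iff.1 (by simp [f, hv])
  let b := InnerProductSpace.gramSchmidtOrthonormalBasis (𝕜 := ℝ) (by simp) f
  have h0 : b 0 = u :=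
    (InnerProductSpace.gramSchmidtOrthonormalBasis_apply_of_orthogonal _ hf hn0).trans
      (by simp [f, hu])
  have h1 : b 1 = v :=
    (InnerProductSpace.gramSchmidtOrthonormalBasis_apply_of_orthogonal _ hf hn1).trans
      (by simp [f, hv])
  refine ⟨b, ?_⟩
  change 0 < pluckerForm (b 0) (b 1) (vec u * vec v)
  rw [pluckerForm_vec_mul_vec, h0, h1, huv, real_inner_self_eq_norm_sq, real_inner_self_eq_norm_sq,
    hu, hv]
  norm_num

/-- Transport of a projective chart along a bijection that is linear in the ambient spaces. -/
def ProjChart.transport {S T E E' F : Type*} [TopologicalSpace S] [TopologicalSpace T]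
    [NormedAddCommGroup E] [NormedSpace ℝ E] [NormedAddCommGroup E'] [NormedSpace ℝ E']
    [NormedAddCommGroup F] [NormedSpace ℝ F] {j : S → E} (c : ProjChart j F) (f : S ≃ T)
    (j' : T → E') (K : E →L[ℝ] E') (L : E' →L[ℝ] E) (hK : ∀ s, j' (f s) = K (j s))
    (hL : ∀ s, L (K (j s)) = j s) (hsec : ∀ y, L (K (c.sec y)) = c.sec y) : ProjChart j' F where
  den := c.den ∘L L
  num := c.num ∘L L
  sec := K ∘L c.sec
  param y := f (c.param y)
  contDiff_param := by
    have h : (j' ∘ fun y => f (c.param y)) = K ∘ (j ∘ c.param) := funext fun y => hK _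
    rw [h]
    exact K.contDiff.comp c.contDiff_param
  den_param y := by
    rw [hK, ContinuousLinearMap.comp_apply, hL]
    exact c.den_param y
  num_param y := by
    rw [hK, ContinuousLinearMap.comp_apply, ContinuousLinearMap.comp_apply, hL]
    exact c.num_param y
  param_num t ht := by
    obtain ⟨s, rfl⟩ := f.surjective t
    simp only [hK, ContinuousLinearMap.comp_apply, hL] at ht ⊢
    rw [c.param_num s ht]
  num_sec y := by
    simp only [ContinuousLinearMap.comp_apply, hsec]
    exact c.num_sec y
  den_sec y := by
    simp only [ContinuousLinearMap.comp_apply, hsec]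
    exact c.den_sec y

/-! ### The bijection between oriented planes and complex structures -/

theorem ofHalfSpin_halfSpin {u v : E8} (h : inner ℝ u v = (0 : ℝ)) :
    ofHalfSpin (halfSpin (vec u * vec v)) = vec u * vec v := by
  rw [halfSpin_vec_mul_vec, ofHalfSpin_neg_slash, wedge_of_inner_eq_zero h]

theorem halfSpin_mem_M (x : G28) : halfSpin x ∈ M := by
  obtain ⟨x, u, v, hu, hv, huv, rfl⟩ := x
  rw [halfSpin_vec_mul_vec]
  refine neg_slash_mem_M ?_ ?_ huv
  · rw [real_inner_self_eq_norm_sq, hu, one_pow]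
  · rw [real_inner_self_eq_norm_sq, hv, one_pow]

theorem norm_eq_one_of_inner_self {u : E8} (h : inner ℝ u u = (1 : ℝ)) : ‖u‖ = 1 := by
  rw [real_inner_self_eq_norm_sq] at h
  exact (pow_eq_one_iff_of_nonneg (norm_nonneg u) two_ne_zero).1 h

theorem ofHalfSpin_mem_G28 (J : M) : ofHalfSpin J.1 ∈ G28 := by
  obtain ⟨u, v, hu, hv, huv, h⟩ := exists_eq_neg_slash J.2
  refine ⟨u, v, norm_eq_one_of_inner_self hu, norm_eq_one_of_inner_self hv, huv, ?_⟩
  rw [h, ofHalfSpin_neg_slash, wedge_of_inner_eq_zero huv]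

/-- The half-spin representation, as a bijection from oriented planes to complex structures. -/
noncomputable def planeEquiv : G28 ≃ M where
  toFun x := ⟨halfSpin x, halfSpin_mem_M x⟩
  invFun J := ⟨ofHalfSpin J.1, ofHalfSpin_mem_G28 J⟩
  left_inv x := by
    obtain ⟨x, u, v, hu, hv, huv, rfl⟩ := x
    exact Subtype.ext (ofHalfSpin_halfSpin huv)
  right_inv J := by
    obtain ⟨u, v, hu, hv, huv, h⟩ := exists_eq_neg_slash J.2
    refine Subtype.ext ?_
    change halfSpin (ofHalfSpin J.1) = J.1
    rw [h, ofHalfSpin_neg_slash, wedge_of_inner_eq_zero huv, halfSpin_vec_mul_vec]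

/-- The half-spin representation, with values in matrix entries. -/
noncomputable def halfSpinEntries : Cl8 →L[ℝ] Fin 8 → Fin 8 → ℝ :=
  LinearMap.toContinuousLinearMap ((Matrix.ofLinearEquiv ℝ).symm.toLinearMap ∘ₗ halfSpin)

/-- The bivector with given half-spin matrix entries. -/
noncomputable def ofHalfSpinEntries : (Fin 8 → Fin 8 → ℝ) →L[ℝ] Cl8 :=
  LinearMap.toContinuousLinearMap (ofHalfSpin ∘ₗ (Matrix.ofLinearEquiv ℝ).toLinearMap)

theorem entries_planeEquiv (x : G28) : M.entries (planeEquiv x) = halfSpinEntries x := rfl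

theorem ofHalfSpin_halfSpin_coe (x : G28) : ofHalfSpin (halfSpin x) = x :=
  congrArg Subtype.val (planeEquiv.symm_apply_apply x)

/-- The section takes values in sums of products of orthogonal vectors, where `ofHalfSpin` inverts
`halfSpin`; this is what the transport of charts from `G28` to `M` requires. -/
theorem ofHalfSpin_halfSpin_affineSec (b : OrthonormalBasis (Fin 8) ℝ E8)
    (y : EuclideanSpace ℝ (Fin 12)) :
    ofHalfSpin (halfSpin (affineSec b y)) = affineSec b y := by
  simp only [affineSec_apply, map_add, map_sum, map_smul,
    ofHalfSpin_halfSpin (inner_normalVec_one b _), ofHalfSpin_halfSpin (inner_zero_normalVec b _)]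

/-- The chart of the space of complex structures given by an orthonormal basis. -/
noncomputable def complexChart (b : OrthonormalBasis (Fin 8) ℝ E8) :
    ProjChart M.entries (EuclideanSpace ℝ (Fin 12)) :=
  (planeChart b).transport planeEquiv M.entries halfSpinEntries ofHalfSpinEntries
    entries_planeEquiv ofHalfSpin_halfSpin_coe (ofHalfSpin_halfSpin_affineSec b)

theorem exists_complexChart (J : M) : ∃ b : OrthonormalBasis (Fin 8) ℝ E8,
    0 < (complexChart b).den (M.entries J) := by
  obtain ⟨b, hb⟩ := exists_planeChart (planeEquiv.symm J)
  exact ⟨b, hb⟩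

theorem isEmbedding_entries : Topology.IsEmbedding M.entries := Topology.IsEmbedding.subtypeVal

theorem isEmbedding_coe_G28 : Topology.IsEmbedding (Subtype.val : G28 → Cl8) :=
  Topology.IsEmbedding.subtypeVal

theorem continuous_planeEquiv : Continuous planeEquiv :=
  isEmbedding_entries.continuous_iff.2 (halfSpinEntries.continuous.comp continuous_subtype_val)

theorem continuous_planeEquiv_symm : Continuous planeEquiv.symm :=
  isEmbedding_coe_G28.continuous_iff.2
    (ofHalfSpinEntries.continuous.comp isEmbedding_entries.continuous)

theorem mul_alpha_inl (x : G28) (j : Fin 8) :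
    x.1 * alpha (Sum.inl j) = ∑ i, halfSpin x i j • alpha (Sum.inl i) := by
  obtain ⟨x, u, v, hu, hv, huv, rfl⟩ := x
  rw [mul_alpha, Fintype.sum_sum_type, halfSpin_vec_mul_vec]
  simp [spinRep_vec_mul_vec]

theorem spinEquiv_eq_fromBlocks (x : G28) : spinEquiv x.1 =
    Matrix.fromBlocks (halfSpin x) 0 0 (spinEquiv x.1).toBlocks₂₂ := by
  obtain ⟨x, u, v, hu, hv, huv, rfl⟩ := x
  rw [spinEquiv_apply, halfSpin_vec_mul_vec, spinRep_vec_mul_vec, Matrix.toBlocks_fromBlocks₂₂]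

end SpinEight

/-! ### The theorem -/

theorem theorem2p1 :
    -- `α₁, …, α₈` is a basis of `V⁺` and `α₉, …, α₁₆` is a basis of `V⁻`
    LinearIndependent ℝ alpha ∧
    Submodule.span ℝ (Set.range (alpha ∘ Sum.inl)) = Vplus ∧
    Submodule.span ℝ (Set.range (alpha ∘ Sum.inr)) = Vminus ∧
    -- `G(2,8)` lies in `Spin(8)` and consists of the oriented planes of `ℝ⁸`
    G28 ⊆ (spinGroup Q8 : Set Cl8) ∧
    (∃ r : OrientedPlane ≃ G28, ∀ (P : OrientedPlane) (b : OrthonormalBasis (Fin 2) ℝ P.plane),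
      b.toBasis.orientation = P.orientation → (r P : Cl8) = vec (b 0) * vec (b 1)) ∧
    -- `M` is `SO(8)/U(4)`
    (∀ J : M, Nonempty (commutingRotations J ≃ₜ* Matrix.unitaryGroup (Fin 4) ℂ) ∧
      ∃ h : (SO8 ⧸ commutingRotations J) ≃ₜ M, ∀ g : SO8,
        (h (QuotientGroup.mk g) : Matrix (Fin 8) (Fin 8) ℝ) = g.1 * J.1 * g.1ᵀ) ∧
    -- the spin representation `Φ : Cℓ₈ ≅ R(16)`
    ∃ Φ : Cl8 ≃ₐ[ℝ] Matrix (Fin 8 ⊕ Fin 8) (Fin 8 ⊕ Fin 8) ℝ,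
      IsSpinRepresentation Φ ∧
      -- `G(2,8)` and `M` are embedded smooth submanifolds of `Cℓ₈` and `R(8)`
      ∃ (_ : ChartedSpace (EuclideanSpace ℝ (Fin 12)) G28)
        (_ : ChartedSpace (EuclideanSpace ℝ (Fin 12)) M),
        IsManifold (𝓡 12) ∞ G28 ∧
        IsManifold (𝓡 12) ∞ M ∧
        Manifold.IsSmoothEmbedding (𝓡 12) 𝓘(ℝ, Cl8) ∞ (Subtype.val : G28 → Cl8) ∧
        Manifold.IsSmoothEmbedding (𝓡 12) 𝓘(ℝ, Fin 8 → Fin 8 → ℝ) ∞ M.entries ∧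
        -- `Φ*` is a diffeomorphism
        ∃ F : G28 ≃ₘ⟮𝓡 12, 𝓡 12⟯ M, ∀ x : G28,
          (∀ j : Fin 8, x.1 * alpha (Sum.inl j) = ∑ i, (F x).1 i j • alpha (Sum.inl i)) ∧
          Φ x.1 = Matrix.fromBlocks (F x).1 0 0 (Φ x.1).toBlocks₂₂ := by
  refine ⟨linearIndependent_alpha, span_alpha_inl, span_alpha_inr, G28_subset_spinGroup,
    ⟨Equiv.ofBijective _ OrientedPlane.product_bijective, OrientedPlane.product_eq⟩,
    fun J => ⟨nonempty_commutingRotations_equiv J, exists_homeomorph_quotient J⟩,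
    spinEquiv, mul_alpha, ?_⟩
  choose b hb using exists_planeChart
  choose c hc using exists_complexChart
  let _ := ProjChart.chartedSpace (fun x => planeChart (b x)) isEmbedding_coe_G28 hb
  let _ := ProjChart.chartedSpace (fun J => complexChart (c J)) isEmbedding_entries hc
  have hG : IsManifold (𝓡 12) ∞ G28 := ProjChart.isManifold _ isEmbedding_coe_G28 hb
  have hM : IsManifold (𝓡 12) ∞ M := ProjChart.isManifold _ isEmbedding_entries hc
  have eG : Manifold.IsSmoothEmbedding (𝓡 12) 𝓘(ℝ, Cl8) ∞ (Subtype.val : G28 → Cl8) :=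
    ProjChart.isSmoothEmbedding _ isEmbedding_coe_G28 hb
  have eM : Manifold.IsSmoothEmbedding (𝓡 12) 𝓘(ℝ, Fin 8 → Fin 8 → ℝ) ∞ M.entries :=
    ProjChart.isSmoothEmbedding _ isEmbedding_entries hc
  refine ⟨_, _, hG, hM, eG, eM, ⟨planeEquiv, ?_, ?_⟩,
    fun x => ⟨mul_alpha_inl x, spinEquiv_eq_fromBlocks x⟩⟩
  -- Smoothness into an embedded submanifold is tested in the ambient space, where the map and its
  -- inverse are restrictions of linear maps.
  · exact (ContMDiff.iff_comp_isImmersion eM.isImmersion).2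
      ⟨continuous_planeEquiv, halfSpinEntries.contMDiff.comp eG.contMDiff⟩
  · exact (ContMDiff.iff_comp_isImmersion eG.isImmersion).2
      ⟨continuous_planeEquiv_symm, ofHalfSpinEntries.contMDiff.comp eM.contMDiff⟩
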